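/- **Setting.** Lattice sites are the integers. A family of complex numbers $C_{m_0m_1\cdots m_I}$ ($I\ge 0$, $m_j\in\mathbb Z$) is a TILC (translationally invariant local coefficient) if it is invariant under $m_j\mapsto m_j+1$ (all $j$ simultaneously) and there are $L,M>0$ with $|C_{m_0\cdots m_I}|\le L e^{-M|m_0-m_\ell|}$ for all $\ell$ and all $m$. Fix a local difference operator $\nabla_{mn}=\nabla(m-n)$: $\nabla$ is a TILC, $\nabla\neq 0$, and $\sum_k\nabla(k)=0$. The component fields are, for each sign $\pm$ and each $n\in\mathbb Z$, the bosonic $\phi_{\pm n},F_{\pm n}$ (fermion number $N_F=0$) and the fermionic $\chi_{\pm n}$ ($N_F=1$), $\bar\chi_{\pm n}$ ($N_F=-1$). A local functional is a formal sum $\sum_{k\ge 0}\sum_{v_0,\dots,v_k}\sum_{n_0,\dots,n_k}A_{v}(n_0,\dots,n_k)\,X_{v_0n_0}\cdots X_{v_kn_k}$ of monomials in these graded-commuting fields, each monomial containing at least one field, where every coefficient $A_v$ is a TILC. (The sum over the order $k+1$ may be finite or infinite.) It has $N_F=q$ if only monomials of fermion number $q$ occur. The supercharges $Q_\pm$ are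 the odd left derivations with $$Q_\pm\phi_{\pm n}=\pm\bar\chi_{\pm n},\quad Q_\pm\bar\chi_{\pm n}=0,\quad Q_\pm\chi_{\pm n}=F_{\pm n},\quad Q_\pm F_{\pm n}=0,$$ $$Q_\pm\phi_{\mp n}=0,\quad Q_\pm\bar\chi_{\mp n}=0,\quad Q_\pm\chi_{\mp n}=\mp i(\nabla\phi_\mp)_n,\quad Q_\pm F_{\mp n}=-i(\nabla\bar\chi_\mp)_n .$$ With Grassmann variables $\theta_\pm$ the superfields are $$\Phi_{\pm n}=\phi_{\pm n}\pm\theta_\pm\bar\chi_{\pm n},\qquad \Upsilon_{\pm n}=F_{\pm n}-i\theta_\mp(\nabla\bar\chi_\pm)_n,\qquad S_{\pm n}=\bar\chi_{\pm n},$$ $$\Psi_{\pm n}=\chi_{\pm n}+\theta_\pm\{F_{\pm n}-i\theta_\mp(\nabla\bar\chi_\pm)_n\}\pm i\theta_\mp(\nabla\phi_\pm)_n ,$$ with the same fermion numbers as their lowest components. A local functional of superfields is a local functional with $\phi,\bar\chi,\chi,F$ replaced by $\Phi,S,\Psi,\Upsilon$. Further $\int d^2\theta=\int d\theta_-\,d\theta_+$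 with $\int d^2\theta\,\theta_+\theta_-=1$. A TILC $C_{mn_1\cdots n_k}$ satisfies the cyclic Leibniz rule (CLR) if it is symmetric in $n_1,\dots,n_k$ and $$\sum_{p}\sum_m\nabla_{mn_{p(0)}}C_{mn_{p(1)}\cdots n_{p(k)}}=0\quad\text{for all }n_0,\dots,n_k,$$ where $p$ runs over the cyclic permutations of $\{0,1,\dots,k\}$. **Proposition.** Let $\mathcal S$ be a local functional of superfields with $N_F=0$ that is nilpotent-SUSY invariant, i.e. $Q_+S=Q_-S=0$ for the functional $S=\mathcal S|_{\theta_\pm=0}$ of the component fields. Then there are a local functional $\mathcal T(+,-)$ of superfields with $N_F=2$ and, for each sign $\pm$ and each $k=0,1,2,\dots$, a TILC $C^{\pm}_{mn_1\cdots n_k}$ that satisfies the CLR, such that (in particular $\mathcal S$ does not depend on $\theta_\pm$) $$\mathcal S=\int d^2\theta\,\mathcal T(+,-)-\int d^2\theta\,\theta_-\sum_k\sum_{m,n_1,\dots,n_k}C^{+}_{mn_1\cdots n_k}\Psi_{+m}\Phi_{+n_1}\cdots\Phi_{+n_k}+\int d^2\theta\,\theta_+\sum_k\sum_{m,n_1,\dots,n_k}C^{-}_{mn_1\cdots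 n_k}\Psi_{-m}\Phi_{-n_1}\cdots\Phi_{-n_k}.$$ Moreover, for every order $k+1$ at which $\mathcal S$ has no terms, $\mathcal T$ has no terms of that order and $C^{\pm}_{mn_1\cdots n_k}=0$; so if $\mathcal S$ is a finite sum over orders, then so are all the sums on the right-hand side. -/

import Mathlib

/-!
Lattice sites are the integers. Coefficients are complex numbers.

The component fields `φ_±`, `χ̄_±`, `χ_±`, `F_±` and the superfields `Φ_±`, `S_±`, `Ψ_±`, `Υ_±`
are both labelled by `Letter`.
-/

/-- The index `+` or `-` of a field. -/
inductive Sgn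
  | plus
  | minus
  deriving DecidableEq

instance : Fintype Sgn := ⟨{Sgn.plus, Sgn.minus}, fun s => by cases s <;> simp⟩

/-- The four kinds of component fields `φ`, `χ̄`, `χ`, `F`; the superfields whose lowest components
they are are `Φ`, `S`, `Ψ`, `Υ`, in this order. -/
inductive Kind
  | phi
  | chibar
  | chi
  | aux
  deriving DecidableEq

instance : Fintype Kind :=
  ⟨{Kind.phi, Kind.chibar, Kind.chi, Kind.aux}, fun k => by cases k <;> simp⟩

/-- A field (or superfield) without its lattice site. -/
abbrev Letter : Type := Kind × Sgn

namespace Sgn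

/-- The opposite index. -/
def opp : Sgn → Sgn
  | plus => minus
  | minus => plus

/-- The index as a number `1` or `-1`. -/
def val : Sgn → ℂ
  | plus => 1
  | minus => -1

end Sgn

namespace Letter

/-- Fermion number: `0` for `φ` and `F`, `1` for `χ`, `-1` for `χ̄`
(the same for the superfields). -/
def fermionNumber (v : Letter) : ℤ :=
  match v.1 with
  | Kind.phi => 0
  | Kind.chibar => -1
  | Kind.chi => 1
  | Kind.aux => 0

/-- Whether a field is fermionic, i.e. Grassmann odd. -/
def isOdd (v : Letter) : Bool :=
  match v.1 with
  | Kind.phi => false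
  | Kind.chibar => true
  | Kind.chi => true
  | Kind.aux => false

end Letter

/-! ### Coefficients -/

/-- Translationally invariant local coefficients (TILC) `C_{m_0 m_1 … m_I}`. -/
def IsTILC {I : ℕ} (C : (Fin (I + 1) → ℤ) → ℂ) : Prop :=
  (∀ m, C (fun i => m i + 1) = C m) ∧
    ∃ L M : ℝ, 0 < L ∧ 0 < M ∧
      ∀ m, ∀ l, ‖C m‖ ≤ L * Real.exp (-(M * |((m 0 - m l : ℤ) : ℝ)|))

/-- A local difference operator `∇_{mn} = D (m - n)`: a nonzero TILC that annihilates constants. -/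
def IsDifferenceOperator (D : ℤ → ℂ) : Prop :=
  (∃ L M : ℝ, 0 < L ∧ 0 < M ∧ ∀ k : ℤ, ‖D k‖ ≤ L * Real.exp (-(M * |(k : ℝ)|))) ∧
    ∑' k, D k = 0 ∧ D ≠ 0

/-- The cyclic Leibniz rule for `C_{m n_1 … n_k}`: symmetry in the last `k` indices and
`∑_p ∑_m ∇_{m n_{p(0)}} C_{m n_{p(1)} … n_{p(k)}} = 0`, where `p` runs over the cyclic
permutations `i ↦ p + i` of `{0, …, k}`. -/
def SatisfiesCLR (D : ℤ → ℂ) {k : ℕ} (C : (Fin (k + 1) → ℤ) → ℂ) : Prop :=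
  (∀ (m : ℤ) (n : Fin k → ℤ) (σ : Equiv.Perm (Fin k)),
      C (Fin.cons m (n ∘ σ)) = C (Fin.cons m n)) ∧
    ∀ n : Fin (k + 1) → ℤ,
      ∑ p : Fin (k + 1), ∑' m : ℤ,
        D (m - n p) * C (Fin.cons m (fun j : Fin k => n (p + j.succ))) = 0

/-! ### Functionals of the component fields -/

/-- A functional `∑_k ∑_v ∑_n A_k(v, n) X_{v_0, n_0} ⋯ X_{v_k, n_k}`, where `v_0, …, v_k` are
fields and `n_0, …, n_k` are lattice sites, given by its coefficients. Each monomial contains at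
least one field. Different coefficients can give the same functional, see `Functional.Same`. -/
abbrev Functional : Type :=
  (k : ℕ) → (Fin (k + 1) → Letter) → (Fin (k + 1) → ℤ) → ℂ

/-- The sign with
`X_{v_{σ 0}} ⋯ X_{v_{σ k}} = reorderSign v σ * X_{v_0} ⋯ X_{v_k}`. -/
def reorderSign {d : ℕ} (v : Fin d → Letter) (σ : Equiv.Perm (Fin d)) : ℂ :=
  ∏ i, ∏ j, if i < j ∧ σ j < σ i ∧ (v (σ i)).isOdd = true ∧ (v (σ j)).isOdd = true
    then (-1 : ℂ) else 1

/-- The number of fermionic fields to the left of position `i`. -/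
def oddBefore {d : ℕ} (v : Fin d → Letter) (i : Fin d) : ℕ :=
  (Finset.univ.filter fun j => j < i ∧ (v j).isOdd = true).card

namespace Functional

/-- The sum of the coefficients of all reorderings of a monomial, with their signs. -/
def gradedSymm (A : Functional) : Functional := fun k v n =>
  ∑ σ : Equiv.Perm (Fin (k + 1)), reorderSign v σ * A k (v ∘ σ) (n ∘ σ)

/-- Two families of coefficients give the same functional of the (graded commuting) fields. -/
def Same (A B : Functional) : Prop := gradedSymm A = gradedSymm B

/-- Local functionals: all coefficients are TILC. -/
def IsLocal (A : Functional) : Prop := ∀ k v, IsTILC (A k v)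

/-- Only monomials of fermion number `q` occur. -/
def HasFermionNumber (A : Functional) (q : ℤ) : Prop :=
  ∀ k v n, A k v n ≠ 0 → ∑ i, (v i).fermionNumber = q

end Functional

/-- A linear form `∑_{w, m} ℓ(w, m) X_{w, m}` in the component fields. -/
abbrev LinForm : Type := Letter → ℤ → ℂ

/-- The component field `X_{w, n}` as a linear form. -/
def fieldAt (w : Letter) (n : ℤ) : LinForm := fun w' m => if w' = w ∧ m = n then 1 else 0

/-- The linear form `(∇ X_w)_n = ∑_m ∇_{nm} X_{w, m}`. -/
def nablaAt (D : ℤ → ℂ) (w : Letter) (n : ℤ) : LinForm :=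
  fun w' m => if w' = w then D (n - m) else 0

/-- The supersymmetry transformation `δ_s X_{v, n}` of the component fields. -/
def delta (D : ℤ → ℂ) : Sgn → Letter → ℤ → LinForm
  | Sgn.plus, (Kind.phi, Sgn.plus), n => fieldAt (Kind.chibar, Sgn.plus) n
  | Sgn.plus, (Kind.chibar, Sgn.plus), _ => 0
  | Sgn.plus, (Kind.chi, Sgn.plus), n => fieldAt (Kind.aux, Sgn.plus) n
  | Sgn.plus, (Kind.aux, Sgn.plus), _ => 0
  | Sgn.plus, (Kind.phi, Sgn.minus), _ => 0
  | Sgn.plus, (Kind.chibar, Sgn.minus), _ => 0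
  | Sgn.plus, (Kind.chi, Sgn.minus), n => (-Complex.I) • nablaAt D (Kind.phi, Sgn.minus) n
  | Sgn.plus, (Kind.aux, Sgn.minus), n => (-Complex.I) • nablaAt D (Kind.chibar, Sgn.minus) n
  | Sgn.minus, (Kind.phi, Sgn.minus), n => -fieldAt (Kind.chibar, Sgn.minus) n
  | Sgn.minus, (Kind.chibar, Sgn.minus), _ => 0
  | Sgn.minus, (Kind.chi, Sgn.minus), n => fieldAt (Kind.aux, Sgn.minus) n
  | Sgn.minus, (Kind.aux, Sgn.minus), _ => 0
  | Sgn.minus, (Kind.phi, Sgn.plus), _ => 0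
  | Sgn.minus, (Kind.chibar, Sgn.plus), _ => 0
  | Sgn.minus, (Kind.chi, Sgn.plus), n => Complex.I • nablaAt D (Kind.phi, Sgn.plus) n
  | Sgn.minus, (Kind.aux, Sgn.plus), n => (-Complex.I) • nablaAt D (Kind.chibar, Sgn.plus) n

/-- The supercharge `Q_s` on functionals: the odd left derivation that extends `delta`. -/
noncomputable def superCharge (D : ℤ → ℂ) (s : Sgn) (A : Functional) : Functional :=
  fun k w m => ∑ i : Fin (k + 1), (-1 : ℂ) ^ oddBefore w i *
    ∑ v : Letter, ∑' n : ℤ,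
      A k (Function.update w i v) (Function.update m i n) * delta D s v n (w i) (m i)

/-! ### The Grassmann variables `θ_±` -/

/-- Elements `one + θ_+ tp + θ_- tm + θ_+ θ_- tpm`, with the Grassmann variables written to the left
of the coefficients. -/
@[ext]
structure Theta (M : Type) where
  one : M
  tp : M
  tm : M
  tpm : M

namespace Theta

variable {M : Type} [AddCommGroup M] [Module ℂ M]

instance : Add (Theta M) := ⟨fun x y => ⟨x.one + y.one, x.tp + y.tp, x.tm + y.tm, x.tpm + y.tpm⟩⟩

instance : SMul ℂ (Theta M) := ⟨fun c x => ⟨c • x.one, c • x.tp, c • x.tm, c • x.tpm⟩⟩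

/-- An element that does not involve `θ_±`. -/
def const (x : M) : Theta M := ⟨x, 0, 0, 0⟩

/-- Multiplication by `θ_s` from the left. -/
def thetaMul : Sgn → Theta M → Theta M
  | Sgn.plus, x => ⟨0, x.one, 0, x.tm⟩
  | Sgn.minus, x => ⟨0, 0, x.one, -x.tp⟩

/-- The Grassmann integral `∫ dθ_s`, with `∫ dθ_s θ_s = 1`. -/
def intTheta : Sgn → Theta M → Theta M
  | Sgn.plus, x => ⟨x.tp, 0, x.tpm, 0⟩
  | Sgn.minus, x => ⟨x.tm, -x.tpm, 0, 0⟩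

/-- The Grassmann integral `∫ d²θ = ∫ dθ_- dθ_+`, with `∫ d²θ θ_+ θ_- = 1`. -/
def berezin (x : Theta M) : M := (intTheta Sgn.minus (intTheta Sgn.plus x)).one

/-- The Grassmann algebra generated by `θ_±` over the complex numbers. -/
instance : One (Theta ℂ) := ⟨⟨1, 0, 0, 0⟩⟩

instance : Mul (Theta ℂ) :=
  ⟨fun x y => ⟨x.one * y.one, x.one * y.tp + x.tp * y.one, x.one * y.tm + x.tm * y.one,
    x.one * y.tpm + x.tp * y.tm - x.tm * y.tp + x.tpm * y.one⟩⟩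

/-- The substitution `θ_± ↦ -θ_±`, which is the effect of moving a fermionic field across. -/
def involute (x : Theta ℂ) : Theta ℂ := ⟨x.one, -x.tp, -x.tm, x.tpm⟩

end Theta

/-! ### Superfields -/

/-- The superfields `Φ_{s n}`, `S_{s n}`, `Ψ_{s n}`, `Υ_{s n}`. -/
noncomputable def superfield (D : ℤ → ℂ) : Letter → ℤ → Theta LinForm
  | (Kind.phi, s), n =>
      Theta.const (fieldAt (Kind.phi, s) n)
        + s.val • Theta.thetaMul s (Theta.const (fieldAt (Kind.chibar, s) n))
  | (Kind.chibar, s), n => Theta.const (fieldAt (Kind.chibar, s) n)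
  | (Kind.chi, s), n =>
      Theta.const (fieldAt (Kind.chi, s) n)
        + Theta.thetaMul s
            (Theta.const (fieldAt (Kind.aux, s) n)
              + (-Complex.I) • Theta.thetaMul s.opp (Theta.const (nablaAt D (Kind.chibar, s) n)))
        + (s.val * Complex.I) • Theta.thetaMul s.opp (Theta.const (nablaAt D (Kind.phi, s) n))
  | (Kind.aux, s), n =>
      Theta.const (fieldAt (Kind.aux, s) n)
        + (-Complex.I) • Theta.thetaMul s.opp (Theta.const (nablaAt D (Kind.chibar, s) n))

/-- The coefficient of the field `X_{w, m}` in a superfield. -/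
def Theta.coeffAt (x : Theta LinForm) (w : Letter) (m : ℤ) : Theta ℂ :=
  ⟨x.one w m, x.tp w m, x.tm w m, x.tpm w m⟩

/-- The coefficient, in the Grassmann algebra, of the monomial `X_{w_0, m_0} ⋯ X_{w_{d-1}, m_{d-1}}`
in the product of the superfields labelled by `(v_0, n_0), …, (v_{d-1}, n_{d-1})`, after all `θ_±`
have been moved to the left across the fields. -/
noncomputable def superMonomial (D : ℤ → ℂ) {d : ℕ} (v : Fin d → Letter) (n : Fin d → ℤ)
    (w : Fin d → Letter) (m : Fin d → ℤ) : Theta ℂ :=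
  (List.ofFn fun i =>
    Theta.involute^[oddBefore w i] ((superfield D (v i) (n i)).coeffAt (w i) (m i))).prod

/-- The functional of superfields `∑ A_k(v, n) Ξ_{v_0, n_0} ⋯ Ξ_{v_k, n_k}`, which arises when the
superfields are put in the place of the component fields, expanded in `θ_±` and in the component
fields. -/
noncomputable def superFunctional (D : ℤ → ℂ) (A : Functional) : Theta Functional where
  one := fun _ w m => ∑ v, ∑' n, A _ v n * (superMonomial D v n w m).one
  tp := fun _ w m => ∑ v, ∑' n, A _ v n * (superMonomial D v n w m).tp
  tm := fun _ w m => ∑ v, ∑' n, A _ v n * (superMonomial D v n w m).tm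
  tpm := fun _ w m => ∑ v, ∑' n, A _ v n * (superMonomial D v n w m).tpm

/-- Equality of functionals that involve `θ_±`. -/
def Theta.Same (x y : Theta Functional) : Prop :=
  x.one.Same y.one ∧ x.tp.Same y.tp ∧ x.tm.Same y.tm ∧ x.tpm.Same y.tpm

/-- The sum over `k` of the terms `∑ C_{m n_1 … n_k} Ψ_{s m} Φ_{s n_1} ⋯ Φ_{s n_k}`. -/
def clrTerms (s : Sgn) (C : (k : ℕ) → (Fin (k + 1) → ℤ) → ℂ) : Functional := fun k w n =>
  if w = Fin.cons (Kind.chi, s) (fun _ : Fin k => (Kind.phi, s)) then C k n else 0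

/-!
Orders do not mix, so the argument runs at a fixed order `k + 1`. There a functional is a family of
coefficients, indexed by words of `k + 1` fields, in the space `tilc k` of TILC. The difference
operator in the `i`-th lattice site is an operator `conv hD i` on this space, and these operators
commute. A derivation is given by a matrix of polynomials in the difference operator (`oddDer`); its
products with other derivations are computed from matrix products (`oddDer_oddDer`). A functional of
superfields has the components `A`, `Q_+ A`, `Q_- A`, `Q_- Q_+ A` (`superFunctional_tp_apply`,
`superFunctional_tm_apply`, `superFunctional_tpm_apply`). Hence the claim is that a family `A` closed
under both supercharges is, up to reorderings, of the form `Q_- Q_+ T + Q_+ K_+ + Q_- K_-`, where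
`K_s` consists of terms `χ_s φ_s ⋯ φ_s` and is closed under `Q_{-s}`. The last property is the cyclic
Leibniz rule (`satisfiesCLR_of_oddDer_eq_zero`).

Let `h_s` be the derivation that sends `χ̄_s` to `± φ_s` and `F_s` to `χ_s`. It anticommutes with
`Q_{-s}`, and its anticommutator with `Q_s` counts the fields of sign `s`
(`homotopyKernel_anticomm`). On the words with `a > 0` fields of sign `+` and `b > 0` of sign `-`,
both homotopies together show that `A = -Q_- Q_+ h_- h_+ A / (a b)`. On the words with fields of sign
`s` only, `A` is a multiple of `Q_s K` with `K = h_s A`, which has fermion number one and is closed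
under `Q_{-s}`. The terms of `K` without `χ̄_s` and `F_s` are of the form `χ_s φ_s ⋯ φ_s`. The
remaining terms have at least two fields `χ_s` or `F_s`, and are to be shown exact under `Q_{-s}`,
so that they contribute to `T`.

On the fields of sign `s`, the supercharge `Q_{-s}` is the Koszul differential of the commuting
difference operators in the lattice sites; `χ_s` and `F_s` have degree one. Its homology vanishes in
degree two and higher (`exists_oddDer_koszulKernel_eq`), because in every site except the zeroth
the difference operator has a left inverse that commutes with the difference operators of all other
sites except the zeroth. The left inverse has to preserve exponential decay although the symbol of
the difference operator vanishes at `1` and perhaps elsewhere on the unit circle. It is built from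
the Laurent coefficients of the inverse symbol on circles slightly inside and slightly outside of
the unit circle, the choice depending on the side of the origin (`exists_leftInverse_kernel`).
-/

/-! ### Signs of reorderings -/

section Signs

variable {d : ℕ}

theorem neg_one_pow_oddBefore (v : Fin d → Letter) (i : Fin d) :
    (-1 : ℂ) ^ oddBefore v i = ∏ j, if j < i ∧ (v j).isOdd = true then (-1 : ℂ) else 1 := by
  rw [oddBefore, Finset.prod_ite]
  simp

theorem neg_one_pow_oddBefore_update {v : Fin d → Letter} {i : Fin d} {x : Letter}
    (hx : x.isOdd ≠ (v i).isOdd) (j : Fin d) :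
    (-1 : ℂ) ^ oddBefore (Function.update v i x) j
      = (if i < j then -1 else 1) * (-1 : ℂ) ^ oddBefore v j := by
  rw [neg_one_pow_oddBefore, neg_one_pow_oddBefore,
    ← Finset.mul_prod_erase _ _ (Finset.mem_univ i),
    ← Finset.mul_prod_erase _ (fun l => if l < j ∧ (v l).isOdd = true then (-1 : ℂ) else 1)
      (Finset.mem_univ i), ← mul_assoc]
  congr 1
  · rw [Function.update_self]
    cases h : x.isOdd <;> cases h' : (v i).isOdd <;> simp_all
  · refine Finset.prod_congr rfl fun l hl => ?_
    rw [Function.update_of_ne (Finset.ne_of_mem_erase hl)]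

theorem neg_one_pow_oddBefore_update_of_le (v : Fin d → Letter) {i j : Fin d} (x : Letter)
    (hij : j ≤ i) :
    (-1 : ℂ) ^ oddBefore (Function.update v i x) j = (-1 : ℂ) ^ oddBefore v j := by
  rw [neg_one_pow_oddBefore, neg_one_pow_oddBefore]
  refine Finset.prod_congr rfl fun l _ => ?_
  by_cases hl : l = i
  · subst hl
    simp [not_lt.2 hij]
  · rw [Function.update_of_ne hl]

theorem neg_one_pow_oddBefore_mul_self (v : Fin d → Letter) (i : Fin d) :
    (-1 : ℂ) ^ oddBefore v i * (-1 : ℂ) ^ oddBefore v i = 1 := by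
  rw [← mul_pow]
  simp

/-- A symmetric function has the same product over the pairs of an index set in any total order. -/
theorem prod_pairs_comp_perm {h : Fin d → Fin d → ℂ} (hsymm : ∀ i j, h i j = h j i)
    (τ : Equiv.Perm (Fin d)) :
    ∏ i, ∏ j, (if i < j then h (τ i) (τ j) else 1) = ∏ i, ∏ j, (if i < j then h i j else 1) := by
  have h1 : ∏ i, ∏ j, (if i < j then h (τ i) (τ j) else 1)
      = ∏ a, ∏ b, (if τ.symm a < τ.symm b then h a b else 1) := by
    rw [← Equiv.prod_comp τ (fun a => ∏ b, if τ.symm a < τ.symm b then h a b else 1)]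
    refine Finset.prod_congr rfl fun i _ => ?_
    rw [← Equiv.prod_comp τ (fun b => if τ.symm (τ i) < τ.symm b then h (τ i) b else 1)]
    simp only [Equiv.symm_apply_apply]
  have h2 : ∏ a, ∏ b, (if τ.symm a < τ.symm b then h a b else 1)
      = (∏ a, ∏ b, if a < b ∧ τ.symm a < τ.symm b then h a b else 1)
        * ∏ a, ∏ b, if b < a ∧ τ.symm a < τ.symm b then h a b else 1 := by
    simp only [← Finset.prod_mul_distrib]
    refine Finset.prod_congr rfl fun a _ => Finset.prod_congr rfl fun b _ => ?_
    rcases lt_trichotomy a b with hab | hab | hab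
    · simp [hab, lt_asymm hab]
    · simp [hab]
    · simp [hab, lt_asymm hab]
  rw [h1, h2, Finset.prod_comm (f := fun a b => if b < a ∧ τ.symm a < τ.symm b then h a b else 1)]
  simp only [← Finset.prod_mul_distrib]
  refine Finset.prod_congr rfl fun a _ => Finset.prod_congr rfl fun b _ => ?_
  by_cases hab : a < b
  · rcases lt_trichotomy (τ.symm a) (τ.symm b) with h' | h' | h'
    · simp [hab, h', lt_asymm h']
    · exact absurd (τ.symm.injective h') hab.ne
    · simp [hab, h', lt_asymm h', hsymm b a]
  · simp [hab]

/-- Reorderings compose up to signs. -/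
theorem reorderSign_mul (v : Fin d → Letter) (σ τ : Equiv.Perm (Fin d)) :
    reorderSign v (σ * τ) = reorderSign v σ * reorderSign (v ∘ σ) τ := by
  let h : Fin d → Fin d → ℂ := fun a b =>
    if (a < b ∧ σ b < σ a ∨ b < a ∧ σ a < σ b) ∧ (v (σ a)).isOdd = true ∧ (v (σ b)).isOdd = true
      then -1 else 1
  have hsymm : ∀ a b, h a b = h b a := by
    intro a b
    simp only [h]
    congr 1
    apply propext
    tauto
  have h1 : reorderSign v σ = ∏ i, ∏ j, (if i < j then h i j else 1) := by
    refine Finset.prod_congr rfl fun a _ => Finset.prod_congr rfl fun b _ => ?_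
    by_cases hab : a < b
    · simp [h, hab, lt_asymm hab]
    · simp [hab]
  rw [h1, ← prod_pairs_comp_perm hsymm τ, reorderSign, reorderSign]
  simp only [← Finset.prod_mul_distrib]
  refine Finset.prod_congr rfl fun i _ => Finset.prod_congr rfl fun j _ => ?_
  by_cases hij : i < j
  · have hne : τ i ≠ τ j := fun e => hij.ne (τ.injective e)
    have hne' : σ (τ i) ≠ σ (τ j) := fun e => hne (σ.injective e)
    simp only [hij, true_and, if_true, h, Equiv.Perm.coe_mul, Function.comp_apply]
    by_cases ho : (v (σ (τ i))).isOdd = true ∧ (v (σ (τ j))).isOdd = true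
    · rcases hne.lt_or_gt with h3 | h3 <;> rcases hne'.lt_or_gt with h4 | h4 <;>
        simp [ho, h3, lt_asymm h3, h4, lt_asymm h4]
    · simp [ho]
  · simp [hij]

theorem reorderSign_mul_self (v : Fin d → Letter) (σ : Equiv.Perm (Fin d)) :
    reorderSign v σ * reorderSign v σ = 1 := by
  rw [reorderSign]
  simp only [← Finset.prod_mul_distrib]
  refine Finset.prod_eq_one fun i _ => Finset.prod_eq_one fun j _ => ?_
  split_ifs <;> simp

/-- A monomial with at most one fermionic field can be reordered without signs. -/
theorem reorderSign_eq_one {v : Fin d → Letter} {a : Fin d}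
    (hv : ∀ i, i ≠ a → (v i).isOdd = false) (σ : Equiv.Perm (Fin d)) : reorderSign v σ = 1 := by
  refine Finset.prod_eq_one fun i _ => Finset.prod_eq_one fun j _ => if_neg ?_
  rintro ⟨h1, -, h3, h4⟩
  have e : ∀ i, (v i).isOdd = true → i = a := fun i hi => by
    by_contra hne
    simp [hv i hne] at hi
  exact h1.ne (σ.injective ((e _ h3).trans (e _ h4).symm))

theorem update_comp_perm {α : Type*} (w : Fin d → α) (σ : Equiv.Perm (Fin d)) (a : Fin d) (x : α) :
    Function.update w (σ a) x ∘ σ = Function.update (w ∘ σ) a x := by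
  funext j
  by_cases h : j = a
  · subst h
    simp
  · simp [h]

/-- How a reordering sign changes when the parity of one field changes: this is what makes
reorderings commute with odd derivations. -/
theorem reorderSign_mul_oddBefore {w : Fin d → Letter} {σ : Equiv.Perm (Fin d)} {a : Fin d}
    {x : Letter} (hx : x.isOdd ≠ (w (σ a)).isOdd) :
    reorderSign w σ * (-1 : ℂ) ^ oddBefore (w ∘ σ) a
      = (-1 : ℂ) ^ oddBefore w (σ a) * reorderSign (Function.update w (σ a) x) σ := by
  set w' := Function.update w (σ a) x with hw'
  have hw : ∀ i, i ≠ a → w' (σ i) = w (σ i) := fun i hi => by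
    rw [hw', Function.update_of_ne (fun e => hi (σ.injective e))]
  have hwa : (w' (σ a)).isOdd ≠ (w (σ a)).isOdd := by rwa [hw', Function.update_self]
  have key : reorderSign w σ * reorderSign w' σ
      = (-1 : ℂ) ^ oddBefore (w ∘ σ) a * (-1 : ℂ) ^ oddBefore w (σ a) := by
    have h1 : reorderSign w σ * reorderSign w' σ
        = ∏ i, ∏ j,
          (if i = a then (if a < j ∧ σ j < σ a ∧ (w (σ j)).isOdd = true then -1 else 1) else 1)
          * (if j = a then (if i < a ∧ σ a < σ i ∧ (w (σ i)).isOdd = true then (-1 : ℂ) else 1)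
            else 1) := by
      simp only [reorderSign, ← Finset.prod_mul_distrib]
      refine Finset.prod_congr rfl fun i _ => Finset.prod_congr rfl fun j _ => ?_
      by_cases hi : i = a
      · by_cases hj : j = a
        · simp [hi, hj]
        · subst hi
          rw [hw j hj]
          simp only [hj, if_true, if_false, mul_one]
          revert hwa
          cases (w' (σ i)).isOdd <;> cases (w (σ i)).isOdd <;> simp
      · by_cases hj : j = a
        · subst hj
          rw [hw i hi]
          simp only [hi, if_true, if_false, one_mul]
          revert hwa
          cases (w' (σ j)).isOdd <;> cases (w (σ j)).isOdd <;> simp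
        · rw [hw i hi, hw j hj]
          simp only [hi, hj, if_false, mul_one]
          split_ifs <;> simp
    rw [h1]
    simp only [Finset.prod_mul_distrib]
    rw [Finset.prod_comm (f := fun i j => if i = a then
      (if a < j ∧ σ j < σ a ∧ (w (σ j)).isOdd = true then (-1 : ℂ) else 1) else 1)]
    simp only [Finset.prod_ite_eq', Finset.mem_univ, if_true]
    rw [neg_one_pow_oddBefore, neg_one_pow_oddBefore, ← Equiv.prod_comp σ
      (fun j => if j < σ a ∧ (w j).isOdd = true then (-1 : ℂ) else 1)]
    simp only [← Finset.prod_mul_distrib]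
    refine Finset.prod_congr rfl fun j _ => ?_
    by_cases hj : j = a
    · simp [hj]
    · have hσ : σ j ≠ σ a := fun e => hj (σ.injective e)
      rcases lt_or_gt_of_ne hj with h3 | h3 <;> rcases hσ.lt_or_gt with h4 | h4 <;>
        by_cases ho : (w (σ j)).isOdd = true <;>
        simp [h3, lt_asymm h3, h4, lt_asymm h4, ho]
  calc reorderSign w σ * (-1 : ℂ) ^ oddBefore (w ∘ σ) a
      = reorderSign w σ * (-1 : ℂ) ^ oddBefore (w ∘ σ) a
        * (reorderSign w' σ * reorderSign w' σ) := by rw [reorderSign_mul_self, mul_one]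
    _ = (reorderSign w σ * reorderSign w' σ) * (-1 : ℂ) ^ oddBefore (w ∘ σ) a
        * reorderSign w' σ := by ring
    _ = _ := by
      rw [key]
      rw [show ∀ x y z : ℂ, x * y * x * z = (x * x) * (y * z) from fun x y z => by ring,
        neg_one_pow_oddBefore_mul_self, one_mul]

end Signs

/-! ### The one-sided inverse of a difference operator -/

section LeftInverseKernel

open Metric Filter Topology

theorem summable_exp_neg_mul_abs {ε : ℝ} (hε : 0 < ε) :
    Summable fun k : ℤ => Real.exp (-(ε * |(k : ℝ)|)) := by
  have h : Summable fun n : ℕ => Real.exp (-(ε * |((n : ℤ) : ℝ)|)) := by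
    refine (summable_geometric_of_lt_one (Real.exp_nonneg (-ε))
      (Real.exp_lt_one_iff.2 (by linarith))).congr fun n => ?_
    rw [← Real.exp_nat_mul]
    congr 1
    push_cast
    rw [abs_of_nonneg (Nat.cast_nonneg n)]
    ring
  refine Summable.of_nat_of_neg h (h.congr fun n => ?_)
  simp

/-- The annulus of the points whose modulus lies strictly between `e^{-ε}` and `e^ε`. -/
def logAnnulus (ε : ℝ) : Set ℂ := {z | Real.exp (-ε) < ‖z‖ ∧ ‖z‖ < Real.exp ε}

theorem isOpen_logAnnulus (ε : ℝ) : IsOpen (logAnnulus ε) :=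
  (isOpen_lt continuous_const continuous_norm).inter (isOpen_lt continuous_norm continuous_const)

theorem ne_zero_of_mem_logAnnulus {ε : ℝ} {z : ℂ} (hz : z ∈ logAnnulus ε) : z ≠ 0 :=
  norm_pos_iff.1 ((Real.exp_pos _).trans hz.1)

theorem mem_logAnnulus_of_norm_eq_exp {ε t : ℝ} {z : ℂ} (hz : ‖z‖ = Real.exp t) (ht : |t| < ε) :
    z ∈ logAnnulus ε := by
  rw [abs_lt] at ht
  simp only [logAnnulus, Set.mem_ofPred_eq, hz, Real.exp_lt_exp]
  exact ht

theorem isPreconnected_logAnnulus (ε : ℝ) : IsPreconnected (logAnnulus ε) := by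
  have h : logAnnulus ε = Complex.exp '' (Complex.re ⁻¹' Set.Ioo (-ε) ε) := by
    ext z
    constructor
    · intro hz
      refine ⟨Complex.log z, ?_, Complex.exp_log (ne_zero_of_mem_logAnnulus hz)⟩
      have hpos := norm_pos_iff.2 (ne_zero_of_mem_logAnnulus hz)
      simp only [Set.mem_preimage, Complex.log_re, Set.mem_Ioo]
      exact ⟨(Real.lt_log_iff_exp_lt hpos).2 hz.1, (Real.log_lt_iff_lt_exp hpos).2 hz.2⟩
    · rintro ⟨w, hw, rfl⟩
      simp only [logAnnulus, Set.mem_ofPred_eq, Complex.norm_exp, Real.exp_lt_exp]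
      exact hw
  rw [h]
  exact ((convex_Ioo (-ε) ε).linear_preimage Complex.reLm).isPreconnected.image _
    Complex.continuous_exp.continuousOn

theorem norm_zpow_le_of_mem_logAnnulus {ε : ℝ} {z : ℂ} (hz : z ∈ logAnnulus ε) (j : ℤ) :
    ‖z ^ j‖ ≤ Real.exp (ε * |(j : ℝ)|) := by
  have hpos := norm_pos_iff.2 (ne_zero_of_mem_logAnnulus hz)
  rw [norm_zpow, ← Real.exp_log hpos, ← Real.rpow_intCast, ← Real.exp_mul, Real.exp_le_exp,
    mul_comm]
  have h : |Real.log ‖z‖| ≤ ε :=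
    abs_le.2 ⟨((Real.lt_log_iff_exp_lt hpos).2 hz.1).le, ((Real.log_lt_iff_lt_exp hpos).2 hz.2).le⟩
  calc (j : ℝ) * Real.log ‖z‖ ≤ |(j : ℝ) * Real.log ‖z‖| := le_abs_self _
    _ = |Real.log ‖z‖| * |(j : ℝ)| := by rw [abs_mul, mul_comm]
    _ ≤ ε * |(j : ℝ)| := by gcongr

/-- The symbol of a difference operator, as a Laurent series. -/
noncomputable def symbol (D : ℤ → ℂ) (z : ℂ) : ℂ := ∑' j : ℤ, D j * z ^ j

section Symbol

variable {D : ℤ → ℂ} {L M : ℝ}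

theorem norm_symbol_term_le (hD : ∀ k : ℤ, ‖D k‖ ≤ L * Real.exp (-(M * |(k : ℝ)|)))
    {z : ℂ} (hz : z ∈ logAnnulus (M / 2)) (j : ℤ) :
    ‖D j * z ^ j‖ ≤ L * Real.exp (-(M / 2 * |(j : ℝ)|)) := by
  calc ‖D j * z ^ j‖ ≤ (L * Real.exp (-(M * |(j : ℝ)|))) * Real.exp (M / 2 * |(j : ℝ)|) := by
        rw [norm_mul]
        exact mul_le_mul (hD j) (norm_zpow_le_of_mem_logAnnulus hz j) (norm_nonneg _)
          ((norm_nonneg _).trans (hD j))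
    _ = L * Real.exp (-(M / 2 * |(j : ℝ)|)) := by
        rw [mul_assoc, ← Real.exp_add]
        ring_nf

theorem hasSum_symbol (hM : 0 < M) (hD : ∀ k : ℤ, ‖D k‖ ≤ L * Real.exp (-(M * |(k : ℝ)|)))
    {z : ℂ} (hz : z ∈ logAnnulus (M / 2)) : HasSum (fun j : ℤ => D j * z ^ j) (symbol D z) :=
  (Summable.of_norm_bounded ((summable_exp_neg_mul_abs (half_pos hM)).mul_left L)
    (norm_symbol_term_le hD hz)).hasSum

theorem differentiableOn_symbol (hM : 0 < M)
    (hD : ∀ k : ℤ, ‖D k‖ ≤ L * Real.exp (-(M * |(k : ℝ)|))) :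
    DifferentiableOn ℂ (symbol D) (logAnnulus (M / 2)) := by
  refine Complex.differentiableOn_tsum_of_summable_norm
    ((summable_exp_neg_mul_abs (half_pos hM)).mul_left L) (fun j z hz => ?_) (isOpen_logAnnulus _)
    fun j z hz => norm_symbol_term_le hD hz j
  exact ((differentiableAt_zpow.2 (Or.inl (ne_zero_of_mem_logAnnulus hz))).const_mul
    _).differentiableWithinAt

/-- Term-by-term integration of the symbol against a continuous function on a circle. -/
theorem hasSum_circleIntegral_mul_symbol (hM : 0 < M)
    (hD : ∀ k : ℤ, ‖D k‖ ≤ L * Real.exp (-(M * |(k : ℝ)|))) {t : ℝ} (ht : |t| < M / 2)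
    {u : ℂ → ℂ} (hu : ContinuousOn u (sphere 0 (Real.exp t))) :
    HasSum (fun j : ℤ => ∮ z in C(0, Real.exp t), u z * (D j * z ^ j))
      (∮ z in C(0, Real.exp t), u z * symbol D z) := by
  have hmem : ∀ θ, circleMap 0 (Real.exp t) θ ∈ sphere (0 : ℂ) (Real.exp t) := fun θ =>
    circleMap_mem_sphere _ (Real.exp_nonneg _) _
  have hann : ∀ z ∈ sphere (0 : ℂ) (Real.exp t), z ∈ logAnnulus (M / 2) := fun z hz =>
    mem_logAnnulus_of_norm_eq_exp (by simpa using hz) ht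
  obtain ⟨B, hB⟩ := (isCompact_sphere (0 : ℂ) (Real.exp t)).exists_bound_of_continuousOn hu
  have hsum := (summable_exp_neg_mul_abs (half_pos hM)).mul_left (Real.exp t * (B * L))
  have huc : Continuous fun θ => u (circleMap 0 (Real.exp t) θ) :=
    hu.comp_continuous (continuous_circleMap _ _) hmem
  simp only [circleIntegral, deriv_circleMap]
  refine intervalIntegral.hasSum_integral_of_dominated_convergence
    (fun j _ => Real.exp t * (B * L) * Real.exp (-(M / 2 * |(j : ℝ)|))) (fun j => ?_)
    (fun j => ?_) ?_ ?_ ?_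
  · refine Continuous.aestronglyMeasurable ?_
    have h1 : Continuous fun θ => circleMap 0 (Real.exp t) θ ^ j :=
      (continuous_circleMap _ _).zpow₀ j fun θ =>
        Or.inl (ne_zero_of_mem_logAnnulus (hann _ (hmem θ)))
    exact ((continuous_circleMap _ _).mul continuous_const).smul
      (huc.mul (continuous_const.mul h1))
  · refine Eventually.of_forall fun θ _ => ?_
    have h1 : ‖circleMap 0 (Real.exp t) θ * Complex.I‖ = Real.exp t := by simp
    rw [smul_eq_mul, norm_mul, norm_mul (u _), h1, mul_assoc, mul_assoc B]
    have h2 := norm_symbol_term_le hD (hann _ (hmem θ)) j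
    have h3 := hB _ (hmem θ)
    have h4 : 0 ≤ B := (norm_nonneg _).trans h3
    gcongr
  · exact Eventually.of_forall fun θ _ => hsum
  · exact intervalIntegrable_const
  · exact Eventually.of_forall fun θ _ =>
      (((hasSum_symbol hM hD (hann _ (hmem θ))).mul_left _).mul_left _)

theorem circleIntegral_zpow {r : ℝ} (hr : r ≠ 0) (n : ℤ) :
    (2 * Real.pi * Complex.I : ℂ)⁻¹ * ∮ z in C(0, r), z ^ (n - 1) = if n = 0 then 1 else 0 := by
  split_ifs with h
  · have h1 := circleIntegral.integral_sub_center_inv (0 : ℂ) hr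
    simp only [sub_zero] at h1
    subst h
    simp only [zero_sub, zpow_neg_one, h1]
    exact inv_mul_cancel₀ Complex.two_pi_I_ne_zero
  · have h1 := circleIntegral.integral_sub_zpow_of_ne (n := n - 1) (by omega) (0 : ℂ) 0 r
    simp only [sub_zero] at h1
    rw [h1, mul_zero]

/-- The zeros of the symbol on the unit circle are isolated in the annulus. -/
theorem exists_symbol_ne_zero (hM : 0 < M)
    (hD : ∀ k : ℤ, ‖D k‖ ≤ L * Real.exp (-(M * |(k : ℝ)|))) (hD0 : D ≠ 0) :
    ∃ ε, 0 < ε ∧ ε < M / 2 ∧ ∀ z ∈ logAnnulus ε, ‖z‖ ≠ 1 → symbol D z ≠ 0 := by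
  have hann : ∀ z ∈ sphere (0 : ℂ) 1, z ∈ logAnnulus (M / 2) := fun z hz =>
    mem_logAnnulus_of_norm_eq_exp (t := 0) (by simpa using hz) (by simpa using hM)
  have hanalytic : AnalyticOnNhd ℂ (symbol D) (logAnnulus (M / 2)) :=
    (differentiableOn_symbol hM hD).analyticOnNhd (isOpen_logAnnulus _)
  have hloc : ∀ z₀ ∈ sphere (0 : ℂ) 1, ∀ᶠ z in 𝓝 z₀, ‖z‖ ≠ 1 → symbol D z ≠ 0 := by
    intro z₀ hz₀
    rcases (hanalytic z₀ (hann z₀ hz₀)).eventually_eq_zero_or_eventually_ne_zero with h | h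
    · exfalso
      have hzero := hanalytic.eqOn_zero_of_preconnected_of_eventuallyEq_zero
        (isPreconnected_logAnnulus _) (hann z₀ hz₀) h
      refine hD0 (funext fun k => ?_)
      have hu : ContinuousOn (fun z : ℂ => z ^ (-k - 1)) (sphere 0 (Real.exp 0)) := by
        intro z hz
        refine (continuousAt_zpow₀ z _ (Or.inl ?_)).continuousWithinAt
        rintro rfl
        simp at hz
      have hsum := hasSum_circleIntegral_mul_symbol hM hD (t := 0) (by simpa using hM) hu
      rw [Real.exp_zero] at hsum
      have h0 : (∮ z in C(0, 1), z ^ (-k - 1) * symbol D z) = 0 := by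
        rw [circleIntegral.integral_congr (g := fun _ => (0 : ℂ)) zero_le_one
          (fun z hz => by rw [hzero (hann z hz), Pi.zero_apply, mul_zero])]
        simp [circleIntegral]
      have hterm : ∀ j : ℤ, (∮ z in C(0, 1), z ^ (-k - 1) * (D j * z ^ j))
          = D j * ((2 * Real.pi * Complex.I : ℂ) * if j - k = 0 then 1 else 0) := by
        intro j
        rw [← circleIntegral_zpow one_ne_zero (j - k),
          mul_inv_cancel_left₀ Complex.two_pi_I_ne_zero, ← circleIntegral.integral_const_mul]
        refine circleIntegral.integral_congr zero_le_one fun z hz => ?_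
        have hz0 : z ≠ 0 := ne_zero_of_mem_logAnnulus (hann z hz)
        rw [mul_left_comm, ← zpow_add₀ hz0]
        congr 2
        ring
      simp only [hterm, h0] at hsum
      have h1 := hsum.unique (hasSum_single k fun j hj => by
        rw [if_neg (by omega)]; simp)
      simpa [Complex.two_pi_I_ne_zero] using h1.symm
    · rw [eventually_nhdsWithin_iff] at h
      filter_upwards [h] with z hz hz1
      refine hz ?_
      rintro rfl
      exact hz1 (by simpa using hz₀)
  obtain ⟨δ, hδ, hsub⟩ := (hasBasis_nhdsSet_thickening (isCompact_sphere (0 : ℂ) 1)).mem_iff.1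
    (mem_nhdsSet_iff_forall.2 hloc)
  have hcont : ∀ᶠ t : ℝ in 𝓝 0, |Real.exp t - 1| < δ := by
    have h := (Real.continuous_exp.sub continuous_const).abs.tendsto (x := 0)
      (f := fun t => |Real.exp t - 1|)
    simp only [Real.exp_zero, sub_self, abs_zero] at h
    exact h.eventually (gt_mem_nhds hδ)
  obtain ⟨η, hη, hball⟩ := Metric.eventually_nhds_iff.1 hcont
  refine ⟨min η (M / 4), lt_min hη (by linarith), (min_le_right _ _).trans_lt (by linarith), ?_⟩
  intro z hz
  have hz0 := ne_zero_of_mem_logAnnulus hz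
  have hpos := norm_pos_iff.2 hz0
  refine hsub (mem_thickening_iff.2 ⟨z / ‖z‖, ?_, ?_⟩)
  · simp [hz0]
  · have hlog : |Real.log ‖z‖| < η := lt_of_lt_of_le (abs_lt.2
      ⟨(Real.lt_log_iff_exp_lt hpos).2 hz.1, (Real.log_lt_iff_lt_exp hpos).2 hz.2⟩)
        (min_le_left _ _)
    have h := hball (y := Real.log ‖z‖) (by simpa [Real.dist_eq] using hlog)
    rw [Real.exp_log hpos] at h
    have hne : (‖z‖ : ℂ) ≠ 0 := by exact_mod_cast hpos.ne'
    have e : z - z / ‖z‖ = (z / ‖z‖) * ((‖z‖ - 1 : ℝ) : ℂ) := by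
      push_cast
      field_simp
    rw [dist_eq_norm, e, norm_mul, Complex.norm_real, Real.norm_eq_abs]
    simpa [hz0] using h

/-- The Laurent coefficients of the inverse of the symbol on the circle of radius `e^t`. -/
noncomputable def inverseCoeff (D : ℤ → ℂ) (t : ℝ) (c : ℤ) : ℂ :=
  (2 * Real.pi * Complex.I : ℂ)⁻¹ * ∮ z in C(0, Real.exp t), z ^ (c - 1) * (symbol D z)⁻¹

variable {ε : ℝ}

theorem differentiableOn_inverseCoeff_integrand (hM : 0 < M)
    (hD : ∀ k : ℤ, ‖D k‖ ≤ L * Real.exp (-(M * |(k : ℝ)|))) (hεM : ε < M / 2)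
    (hne : ∀ z ∈ logAnnulus ε, ‖z‖ ≠ 1 → symbol D z ≠ 0) (c : ℤ) :
    DifferentiableOn ℂ (fun z => z ^ (c - 1) * (symbol D z)⁻¹) (logAnnulus ε ∩ {z | ‖z‖ ≠ 1}) := by
  have hsub : logAnnulus ε ⊆ logAnnulus (M / 2) := fun z hz =>
    ⟨(Real.exp_lt_exp.2 (by linarith)).trans hz.1, hz.2.trans (Real.exp_lt_exp.2 hεM)⟩
  refine DifferentiableOn.mul (fun z hz => ?_)
    (((differentiableOn_symbol hM hD).mono fun z hz => hsub hz.1).inv fun z hz => hne z hz.1 hz.2)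
  exact (differentiableAt_zpow.2
    (Or.inl (ne_zero_of_mem_logAnnulus hz.1))).differentiableWithinAt

/-- Convolution of `D` with the Laurent coefficients of the inverse symbol gives the unit. -/
theorem hasSum_inverseCoeff (hM : 0 < M)
    (hD : ∀ k : ℤ, ‖D k‖ ≤ L * Real.exp (-(M * |(k : ℝ)|))) (hεM : ε < M / 2)
    (hne : ∀ z ∈ logAnnulus ε, ‖z‖ ≠ 1 → symbol D z ≠ 0) {t : ℝ} (ht0 : t ≠ 0) (ht : |t| < ε)
    (c : ℤ) : HasSum (fun j => inverseCoeff D t (c + j) * D j) (if c = 0 then 1 else 0) := by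
  have hann : ∀ z ∈ sphere (0 : ℂ) (Real.exp t), z ∈ logAnnulus ε ∩ {z | ‖z‖ ≠ 1} := fun z hz => by
    have hz' : ‖z‖ = Real.exp t := by simpa using hz
    exact ⟨mem_logAnnulus_of_norm_eq_exp hz' ht, by simpa [hz'] using ht0⟩
  have hdiff := differentiableOn_inverseCoeff_integrand hM hD hεM hne
  have hsum := (hasSum_circleIntegral_mul_symbol hM hD (ht.trans hεM)
    ((hdiff c).continuousOn.mono hann)).mul_left (2 * Real.pi * Complex.I : ℂ)⁻¹
  convert! hsum using 1
  · funext j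
    rw [inverseCoeff, mul_assoc, mul_comm _ (D j), ← circleIntegral.integral_const_mul]
    congr 1
    refine circleIntegral.integral_congr (Real.exp_nonneg _) fun z hz => ?_
    have hz0 : z ≠ 0 := ne_zero_of_mem_logAnnulus (hann z hz).1
    rw [show c + j - 1 = (c - 1) + j by ring, zpow_add₀ hz0]
    ring
  · rw [← circleIntegral_zpow (Real.exp_pos t).ne' c]
    congr 1
    refine circleIntegral.integral_congr (Real.exp_nonneg _) fun z hz => ?_
    rw [inv_mul_cancel_right₀ (hne z (hann z hz).1 (hann z hz).2)]

/-- The Laurent coefficients do not change with the radius as long as the circle does not cross the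
unit circle, which may carry zeros of the symbol. -/
theorem inverseCoeff_eq (hM : 0 < M)
    (hD : ∀ k : ℤ, ‖D k‖ ≤ L * Real.exp (-(M * |(k : ℝ)|))) (hεM : ε < M / 2)
    (hne : ∀ z ∈ logAnnulus ε, ‖z‖ ≠ 1 → symbol D z ≠ 0) {t t' : ℝ} (htt' : t ≤ t')
    (h : ∀ u ∈ Set.Icc t t', u ≠ 0 ∧ |u| < ε) (c : ℤ) :
    inverseCoeff D t' c = inverseCoeff D t c := by
  have hdiff := differentiableOn_inverseCoeff_integrand hM hD hεM hne c
  have hopen : IsOpen (logAnnulus ε ∩ {z : ℂ | ‖z‖ ≠ 1}) :=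
    (isOpen_logAnnulus ε).inter (isOpen_ne_fun continuous_norm continuous_const)
  have hsub : closedBall (0 : ℂ) (Real.exp t') \ ball 0 (Real.exp t)
      ⊆ logAnnulus ε ∩ {z | ‖z‖ ≠ 1} := by
    rintro z ⟨h1, h2⟩
    simp only [mem_closedBall, dist_zero_right, mem_ball, not_lt] at h1 h2
    have hpos : 0 < ‖z‖ := (Real.exp_pos _).trans_le h2
    have hu := h (Real.log ‖z‖) ⟨(Real.le_log_iff_exp_le hpos).2 h2,
      (Real.log_le_iff_le_exp hpos).2 h1⟩
    exact ⟨mem_logAnnulus_of_norm_eq_exp (Real.exp_log hpos).symm hu.2, fun h1 => hu.1 (by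
      rw [h1, Real.log_one])⟩
  unfold inverseCoeff
  congr 1
  refine Complex.circleIntegral_eq_of_differentiable_on_annulus_off_countable (Real.exp_pos _)
    (Real.exp_le_exp.2 htt') Set.countable_empty (hdiff.continuousOn.mono hsub) ?_
  rintro z ⟨⟨h1, h2⟩, -⟩
  exact hdiff.differentiableAt (hopen.mem_nhds
    (hsub ⟨ball_subset_closedBall h1, fun h => h2 (ball_subset_closedBall h)⟩))

theorem norm_inverseCoeff_le (hM : 0 < M)
    (hD : ∀ k : ℤ, ‖D k‖ ≤ L * Real.exp (-(M * |(k : ℝ)|))) (hεM : ε < M / 2)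
    (hne : ∀ z ∈ logAnnulus ε, ‖z‖ ≠ 1 → symbol D z ≠ 0) {t : ℝ} (ht0 : t ≠ 0) (ht : |t| < ε) :
    ∃ B, 0 ≤ B ∧ ∀ c : ℤ, ‖inverseCoeff D t c‖ ≤ B * Real.exp (t * c) := by
  have hann : ∀ z ∈ sphere (0 : ℂ) (Real.exp t), z ∈ logAnnulus ε ∩ {z | ‖z‖ ≠ 1} := fun z hz => by
    have hz' : ‖z‖ = Real.exp t := by simpa using hz
    exact ⟨mem_logAnnulus_of_norm_eq_exp hz' ht, by simpa [hz'] using ht0⟩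
  have hdiff := differentiableOn_inverseCoeff_integrand hM hD hεM hne 1
  obtain ⟨B, hB⟩ := (isCompact_sphere (0 : ℂ) (Real.exp t)).exists_bound_of_continuousOn
    (hdiff.continuousOn.mono hann)
  simp only [sub_self, zpow_zero, one_mul] at hB
  refine ⟨|B|, abs_nonneg _, fun c => ?_⟩
  have h := circleIntegral.norm_two_pi_i_inv_smul_integral_le_of_norm_le_const (c := 0)
    (f := fun z => z ^ (c - 1) * (symbol D z)⁻¹) (C := Real.exp t ^ (c - 1) * |B|)
    (Real.exp_nonneg t) fun z hz => by
      rw [norm_mul, norm_zpow, show ‖z‖ = Real.exp t by simpa using hz]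
      exact mul_le_mul_of_nonneg_left ((hB z hz).trans (le_abs_self B)) (by positivity)
  rw [smul_eq_mul] at h
  refine h.trans (le_of_eq ?_)
  rw [← Real.rpow_intCast, ← Real.exp_mul, ← mul_assoc, ← Real.exp_add, mul_comm]
  congr 2
  push_cast
  ring

end Symbol

/-- A left inverse of the convolution by `D` on exponentially decaying sequences. On nonnegative
sites it inverts the symbol inside the unit circle and on negative sites outside, which makes it
insensitive to the zeros of the symbol on the unit circle and leaves the decay intact. -/
theorem exists_leftInverse_kernel {D : ℤ → ℂ} {L M : ℝ} (hM : 0 < M)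
    (hD : ∀ k : ℤ, ‖D k‖ ≤ L * Real.exp (-(M * |(k : ℝ)|))) (hD0 : D ≠ 0) :
    ∃ (G : ℤ → ℤ → ℂ) (ε₀ : ℝ), 0 < ε₀ ∧
      (∀ ε, 0 < ε → ε < ε₀ → ∃ B, 0 ≤ B ∧
        ∀ a l : ℤ, ‖G a l‖ ≤ B * Real.exp (-(ε * |(a : ℝ)|) + ε * |(l : ℝ)|)) ∧
      ∀ a b : ℤ, ∑' l, G a l * D (b - l) = if b = a then 1 else 0 := by
  obtain ⟨ε₀, hε₀, hεM, hne⟩ := exists_symbol_ne_zero hM hD hD0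
  have habs : |ε₀ / 2| < ε₀ := by rw [abs_of_pos (half_pos hε₀)]; linarith
  refine ⟨fun a l => if 0 ≤ a then inverseCoeff D (-(ε₀ / 2)) (a - l)
    else inverseCoeff D (ε₀ / 2) (a - l), ε₀, hε₀, fun ε h0 h1 => ?_, fun a b => ?_⟩
  · have habs' : |ε| < ε₀ := by rwa [abs_of_pos h0]
    obtain ⟨B₁, hB₁, h₁⟩ := norm_inverseCoeff_le hM hD hεM hne (t := -ε) (by linarith)
      (by rwa [abs_neg])
    obtain ⟨B₂, hB₂, h₂⟩ := norm_inverseCoeff_le hM hD hεM hne (t := ε) h0.ne' habs'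
    -- The radius may be moved to `e^{∓ε}` on either side of the unit circle.
    have e₁ : ∀ c, inverseCoeff D (-(ε₀ / 2)) c = inverseCoeff D (-ε) c := by
      intro c
      rcases le_total ε (ε₀ / 2) with h | h
      · exact (inverseCoeff_eq hM hD hεM hne (neg_le_neg h) (fun u hu =>
          ⟨by linarith [hu.2], abs_lt.2 ⟨by linarith [hu.1], by linarith [hu.2]⟩⟩) c).symm
      · exact inverseCoeff_eq hM hD hεM hne (neg_le_neg h) (fun u hu =>
          ⟨by linarith [hu.2], abs_lt.2 ⟨by linarith [hu.1], by linarith [hu.2]⟩⟩) c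
    have e₂ : ∀ c, inverseCoeff D (ε₀ / 2) c = inverseCoeff D ε c := by
      intro c
      rcases le_total ε (ε₀ / 2) with h | h
      · exact inverseCoeff_eq hM hD hεM hne h (fun u hu =>
          ⟨by linarith [hu.1], abs_lt.2 ⟨by linarith [hu.1], by linarith [hu.2]⟩⟩) c
      · exact (inverseCoeff_eq hM hD hεM hne h (fun u hu =>
          ⟨by linarith [hu.1], abs_lt.2 ⟨by linarith [hu.1], by linarith [hu.2]⟩⟩) c).symm
    refine ⟨max B₁ B₂, hB₁.trans (le_max_left _ _), fun a l => ?_⟩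
    have hl := abs_le.1 (le_refl |(l : ℝ)|)
    simp only [e₁, e₂]
    split_ifs with ha
    · refine (h₁ _).trans ?_
      have ha' : (0 : ℝ) ≤ a := by exact_mod_cast ha
      rw [abs_of_nonneg ha']
      refine mul_le_mul (le_max_left _ _) (Real.exp_le_exp.2 ?_) (Real.exp_nonneg _)
        (hB₁.trans (le_max_left _ _))
      push_cast
      nlinarith
    · refine (h₂ _).trans ?_
      have ha' : (a : ℝ) ≤ 0 := by exact_mod_cast (not_le.1 ha).le
      rw [abs_of_nonpos ha']
      refine mul_le_mul (le_max_right _ _) (Real.exp_le_exp.2 ?_) (Real.exp_nonneg _)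
        (hB₁.trans (le_max_left _ _))
      push_cast
      nlinarith
  · have key : ∀ t : ℝ, t ≠ 0 → |t| < ε₀ →
        ∑' l, inverseCoeff D t (a - l) * D (b - l) = if b = a then 1 else 0 := by
      intro t ht0 ht
      have h := hasSum_inverseCoeff hM hD hεM hne ht0 ht (a - b)
      rw [← (Equiv.subLeft b).hasSum_iff] at h
      have h' := h.tsum_eq
      simp only [Function.comp_def, Equiv.subLeft_apply, sub_add_sub_cancel, sub_eq_zero,
        eq_comm (a := a)] at h'
      exact h'
    by_cases ha : 0 ≤ a
    · simp only [ha, if_true]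
      exact key _ (by linarith) (by rwa [abs_neg])
    · simp only [ha, if_false]
      exact key _ (by linarith) habs

end LeftInverseKernel

/-! ### Odd derivations given by polynomial matrices -/

section Derivations

open Polynomial

variable {d : ℕ} {E : Type*} [AddCommGroup E] [Module ℂ E]

theorem aeval_mul_eq_mul_aeval {S T U : Module.End ℂ E} (h : T * U = U * S) (p : ℂ[X]) :
    aeval T p * U = U * aeval S p := by
  induction p using Polynomial.induction_on with
  | C a => simp [Algebra.algebraMap_eq_smul_one]
  | add p q hp hq => simp only [map_add, add_mul, mul_add, hp, hq]
  | monomial n a h' =>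
    rw [pow_succ, ← mul_assoc, map_mul, map_mul (aeval S), aeval_X, aeval_X, mul_assoc, h,
      ← mul_assoc, h', mul_assoc]

theorem commute_aeval {S T : Module.End ℂ E} (h : Commute T S) (p q : ℂ[X]) :
    Commute (aeval T p) (aeval S q) :=
  (aeval_mul_eq_mul_aeval (aeval_mul_eq_mul_aeval h.symm.eq q).symm p)

variable (X : Fin d → Module.End ℂ E)

/-- The odd left derivation given on single fields by the matrix `κ`: the field `v` is sent to
`∑ x, κ v x` times the field `x`, where the indeterminate of `κ v x` acts on the `i`-th lattice site
by `X i`. It acts on families of coefficients `A`, indexed by words in the fields. -/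
noncomputable def oddDer (κ : Matrix Letter Letter ℂ[X]) :
    ((Fin d → Letter) → E) →ₗ[ℂ] ((Fin d → Letter) → E) where
  toFun A w := ∑ i, (-1 : ℂ) ^ oddBefore w i •
    ∑ v, aeval (X i) (κ v (w i)) (A (Function.update w i v))
  map_add' A B := by
    funext w
    simp only [Pi.add_apply, map_add, Finset.sum_add_distrib, smul_add]
  map_smul' c A := by
    funext w
    simp only [Pi.smul_apply, map_smul, RingHom.id_apply, Finset.smul_sum]
    exact Finset.sum_congr rfl fun i _ => Finset.sum_congr rfl fun v _ => smul_comm _ _ _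

theorem oddDer_apply (κ : Matrix Letter Letter ℂ[X]) (A : (Fin d → Letter) → E)
    (w : Fin d → Letter) : oddDer X κ A w = ∑ i, (-1 : ℂ) ^ oddBefore w i •
      ∑ v, aeval (X i) (κ v (w i)) (A (Function.update w i v)) := rfl

/-- The even derivation given on single fields by the matrix `κ`. -/
noncomputable def evenDer (κ : Matrix Letter Letter ℂ[X]) (A : (Fin d → Letter) → E) :
    (Fin d → Letter) → E :=
  fun w => ∑ i, ∑ v, aeval (X i) (κ v (w i)) (A (Function.update w i v))

/-- The part of the composition of two odd derivations in which they act on different fields. -/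
noncomputable def pairDer (κ₁ κ₂ : Matrix Letter Letter ℂ[X]) (A : (Fin d → Letter) → E) :
    (Fin d → Letter) → E :=
  fun w => ∑ i, ∑ j, if i = j then 0 else
    ((if i < j then -1 else 1) * ((-1 : ℂ) ^ oddBefore w i * (-1 : ℂ) ^ oddBefore w j)) •
      ∑ v, ∑ v', aeval (X i) (κ₁ v (w i)) (aeval (X j) (κ₂ v' (w j))
        (A (Function.update (Function.update w i v) j v')))

/-- The matrix `κ` changes the parity of fields. -/
def IsOddKernel (κ : Matrix Letter Letter ℂ[X]) : Prop :=
  ∀ v x, κ v x ≠ 0 → v.isOdd ≠ x.isOdd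

theorem oddDer_oddDer {κ₁ : Matrix Letter Letter ℂ[X]} (h₁ : IsOddKernel κ₁)
    (κ₂ : Matrix Letter Letter ℂ[X]) (A : (Fin d → Letter) → E) :
    oddDer X κ₁ (oddDer X κ₂ A) = evenDer X (κ₂ * κ₁) A + pairDer X κ₁ κ₂ A := by
  funext w
  rw [Pi.add_apply, evenDer, pairDer, oddDer_apply, ← Finset.sum_add_distrib]
  refine Finset.sum_congr rfl fun i _ => ?_
  have hdiag : ∑ v, aeval (X i) ((κ₂ * κ₁) v (w i)) (A (Function.update w i v))
      = ∑ v, ∑ v', aeval (X i) (κ₁ v (w i)) (aeval (X i) (κ₂ v' v)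
          (A (Function.update w i v'))) := by
    rw [Finset.sum_comm]
    refine Finset.sum_congr rfl fun v' _ => ?_
    rw [Matrix.mul_apply, map_sum, LinearMap.sum_apply]
    refine Finset.sum_congr rfl fun v _ => ?_
    rw [mul_comm, map_mul, Module.End.mul_apply]
  have hinner : ∀ v, aeval (X i) (κ₁ v (w i)) (oddDer X κ₂ A (Function.update w i v))
      = (-1 : ℂ) ^ oddBefore w i • (∑ v', aeval (X i) (κ₁ v (w i)) (aeval (X i) (κ₂ v' v)
          (A (Function.update w i v'))))
        + ∑ j, if i = j then 0 else
          ((if i < j then -1 else 1) * (-1 : ℂ) ^ oddBefore w j) •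
            ∑ v', aeval (X i) (κ₁ v (w i)) (aeval (X j) (κ₂ v' (w j))
              (A (Function.update (Function.update w i v) j v'))) := by
    intro v
    by_cases hv : κ₁ v (w i) = 0
    · simp [hv]
    have hodd := h₁ _ _ hv
    rw [oddDer_apply, ← Finset.add_sum_erase _ _ (Finset.mem_univ i),
      ← Finset.add_sum_erase (a := i) _ (fun j => if i = j then (0 : E) else _)
        (Finset.mem_univ i), if_pos rfl, zero_add, map_add]
    congr 1
    · rw [neg_one_pow_oddBefore_update_of_le w v le_rfl]
      simp only [map_smul, map_sum, Function.update_self, Function.update_idem]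
    · rw [map_sum]
      refine Finset.sum_congr rfl fun j hj => ?_
      have hji : j ≠ i := Finset.ne_of_mem_erase hj
      rw [if_neg hji.symm, neg_one_pow_oddBefore_update hodd]
      simp only [map_smul, map_sum, Function.update_of_ne hji]
  simp only [hinner, Finset.sum_add_distrib, smul_add]
  congr 1
  · rw [hdiag, ← Finset.smul_sum, smul_smul, neg_one_pow_oddBefore_mul_self, one_smul]
  · rw [Finset.sum_comm, Finset.smul_sum]
    refine Finset.sum_congr rfl fun j _ => ?_
    by_cases hij : i = j
    · simp [hij]
    · simp only [hij, if_false]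
      rw [← Finset.smul_sum, smul_smul]
      congr 1
      ring

variable {X}

theorem pairDer_swap (hX : ∀ i j, Commute (X i) (X j)) (κ₁ κ₂ : Matrix Letter Letter ℂ[X])
    (A : (Fin d → Letter) → E) : pairDer X κ₁ κ₂ A = -pairDer X κ₂ κ₁ A := by
  funext w
  rw [Pi.neg_apply, pairDer, pairDer, Finset.sum_comm, ← Finset.sum_neg_distrib]
  refine Finset.sum_congr rfl fun i _ => ?_
  rw [← Finset.sum_neg_distrib]
  refine Finset.sum_congr rfl fun j _ => ?_
  by_cases hij : i = j
  · simp [hij]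
  · rw [if_neg (Ne.symm hij), if_neg hij, ← neg_smul, Finset.sum_comm]
    congr 1
    · rcases lt_or_gt_of_ne hij with h | h
      · simp only [h, lt_asymm h, if_true, if_false]
        ring
      · simp only [h, lt_asymm h, if_true, if_false]
        ring
    · refine Finset.sum_congr rfl fun v _ => Finset.sum_congr rfl fun v' _ => ?_
      rw [Function.update_comm hij, ← Module.End.mul_apply, ← Module.End.mul_apply,
        (commute_aeval (hX i j) _ _).eq]

theorem oddDer_anticomm (hX : ∀ i j, Commute (X i) (X j)) {κ₁ κ₂ : Matrix Letter Letter ℂ[X]}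
    (h₁ : IsOddKernel κ₁) (h₂ : IsOddKernel κ₂) (A : (Fin d → Letter) → E) :
    oddDer X κ₁ (oddDer X κ₂ A) + oddDer X κ₂ (oddDer X κ₁ A)
      = evenDer X (κ₂ * κ₁ + κ₁ * κ₂) A := by
  rw [oddDer_oddDer X h₁, oddDer_oddDer X h₂, pairDer_swap hX κ₁ κ₂]
  funext w
  simp only [evenDer, Pi.add_apply, Pi.neg_apply, Matrix.add_apply, map_add, LinearMap.add_apply,
    Finset.sum_add_distrib]
  abel

theorem oddDer_anticomm_eq_neg (hX : ∀ i j, Commute (X i) (X j))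
    {κ₁ κ₂ : Matrix Letter Letter ℂ[X]} (h₁ : IsOddKernel κ₁) (h₂ : IsOddKernel κ₂)
    (h : κ₂ * κ₁ + κ₁ * κ₂ = 0) (A : (Fin d → Letter) → E) :
    oddDer X κ₁ (oddDer X κ₂ A) = -oddDer X κ₂ (oddDer X κ₁ A) := by
  rw [eq_neg_iff_add_eq_zero, oddDer_anticomm hX h₁ h₂, h]
  funext w
  simp [evenDer]

variable (X)

/-! ### Weights -/

/-- Multiplication of the coefficients by a function of the word. -/
def scale (c : (Fin d → Letter) → ℂ) (A : (Fin d → Letter) → E) : (Fin d → Letter) → E :=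
  fun w => c w • A w

theorem scale_oddDer {κ : Matrix Letter Letter ℂ[X]} {c c' : (Fin d → Letter) → ℂ}
    (h : ∀ w i v, κ v (w i) ≠ 0 → c w = c' (Function.update w i v)) (A : (Fin d → Letter) → E) :
    scale c (oddDer X κ A) = oddDer X κ (scale c' A) := by
  funext w
  simp only [scale, oddDer_apply, map_smul, Finset.smul_sum]
  refine Finset.sum_congr rfl fun i _ => Finset.sum_congr rfl fun v _ => ?_
  by_cases hv : κ v (w i) = 0
  · simp [hv]
  · rw [h w i v hv, smul_comm]

/-- If a coefficient of a derivation does not vanish, it comes from a coefficient that does not. -/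
theorem exists_of_oddDer_ne_zero {κ : Matrix Letter Letter ℂ[X]} {A : (Fin d → Letter) → E}
    {w : Fin d → Letter} (h : oddDer X κ A w ≠ 0) :
    ∃ i v, κ v (w i) ≠ 0 ∧ A (Function.update w i v) ≠ 0 := by
  by_contra hcon
  push Not at hcon
  rw [oddDer_apply] at h
  refine h (Finset.sum_eq_zero fun i _ => ?_)
  rw [Finset.sum_eq_zero, smul_zero]
  intro v _
  by_cases hv : κ v (w i) = 0
  · simp [hv]
  · rw [hcon i v hv, map_zero]

theorem oddDer_congr {κ κ' : Matrix Letter Letter ℂ[X]} {A : (Fin d → Letter) → E}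
    (h : ∀ w i v, A (Function.update w i v) ≠ 0 → κ v (w i) = κ' v (w i)) :
    oddDer X κ A = oddDer X κ' A := by
  funext w
  rw [oddDer_apply, oddDer_apply]
  refine Finset.sum_congr rfl fun i _ => ?_
  congr 1
  refine Finset.sum_congr rfl fun v _ => ?_
  by_cases hv : A (Function.update w i v) = 0
  · rw [hv, map_zero, map_zero]
  · rw [h w i v hv]

/-- The total weight of a word. -/
def weight (u : Letter → ℤ) (w : Fin d → Letter) : ℤ := ∑ i, u (w i)

theorem weight_update (u : Letter → ℤ) (w : Fin d → Letter) (i : Fin d) (v : Letter) :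
    weight u (Function.update w i v) = weight u w + (u v - u (w i)) := by
  rw [weight, weight, ← Finset.add_sum_erase _ _ (Finset.mem_univ i),
    ← Finset.add_sum_erase (a := i) _ (fun j => u (w j)) (Finset.mem_univ i), Function.update_self,
    Finset.sum_congr rfl fun j hj => by rw [Function.update_of_ne (Finset.ne_of_mem_erase hj)]]
  ring

theorem weight_comp_perm (u : Letter → ℤ) (w : Fin d → Letter) (σ : Equiv.Perm (Fin d)) :
    weight u (w ∘ σ) = weight u w := Equiv.sum_comp σ fun i => u (w i)

theorem weight_nonneg {u : Letter → ℤ} (hu : ∀ v, 0 ≤ u v) (w : Fin d → Letter) :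
    0 ≤ weight u w := Finset.sum_nonneg fun i _ => hu (w i)

theorem eq_zero_of_weight_eq_zero {u : Letter → ℤ} (hu : ∀ v, 0 ≤ u v) {w : Fin d → Letter}
    (h : weight u w = 0) (i : Fin d) : u (w i) = 0 :=
  (Finset.sum_eq_zero_iff_of_nonneg fun i _ => hu (w i)).1 h i (Finset.mem_univ i)

theorem weight_eq_of_oddDer_ne_zero {κ : Matrix Letter Letter ℂ[X]} {u : Letter → ℤ} {c a : ℤ}
    (hκ : ∀ v x, κ v x ≠ 0 → u x = u v + c) {A : (Fin d → Letter) → E}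
    (hA : ∀ w, A w ≠ 0 → weight u w = a) (w : Fin d → Letter) (h : oddDer X κ A w ≠ 0) :
    weight u w = a + c := by
  obtain ⟨i, v, hv, hAv⟩ := exists_of_oddDer_ne_zero X h
  have h1 := hA _ hAv
  rw [weight_update] at h1
  have h2 := hκ _ _ hv
  linarith

/-! ### Reorderings -/

variable (ρ : Equiv.Perm (Fin d) →* Module.End ℂ E)

/-- The action of reorderings, with their signs, on families of coefficients. -/
noncomputable def reorder (σ : Equiv.Perm (Fin d)) (A : (Fin d → Letter) → E) :
    (Fin d → Letter) → E :=
  fun w => reorderSign w σ • ρ σ (A (w ∘ σ))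

theorem reorder_reorder (σ τ : Equiv.Perm (Fin d)) (A : (Fin d → Letter) → E) :
    reorder ρ σ (reorder ρ τ A) = reorder ρ (σ * τ) A := by
  funext w
  simp only [reorder, map_smul, smul_smul, map_mul, Module.End.mul_apply, reorderSign_mul]
  rfl

theorem scale_reorder {c : (Fin d → Letter) → ℂ}
    (hc : ∀ w (σ : Equiv.Perm (Fin d)), c (w ∘ σ) = c w)
    (σ : Equiv.Perm (Fin d)) (A : (Fin d → Letter) → E) :
    reorder ρ σ (scale c A) = scale c (reorder ρ σ A) := by
  funext w
  simp only [reorder, scale, map_smul, hc, smul_comm (c w)]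

/-- The sum over all reorderings. -/
noncomputable def reorderSum (A : (Fin d → Letter) → E) : (Fin d → Letter) → E :=
  ∑ σ, reorder ρ σ A

theorem reorder_reorderSum (σ : Equiv.Perm (Fin d)) (A : (Fin d → Letter) → E) :
    reorder ρ σ (reorderSum ρ A) = reorderSum ρ A := by
  have h : reorder ρ σ (reorderSum ρ A) = ∑ τ, reorder ρ σ (reorder ρ τ A) := by
    funext w
    simp only [reorder, reorderSum, Finset.sum_apply, map_sum, Finset.smul_sum]
  rw [h]
  simp only [reorder_reorder]
  exact Equiv.sum_comp (Equiv.mulLeft σ) fun τ => reorder ρ τ A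

variable {X ρ}

theorem aeval_perm (hρ : ∀ (σ : Equiv.Perm (Fin d)) i, X (σ i) * ρ σ = ρ σ * X i)
    (σ : Equiv.Perm (Fin d)) (i : Fin d) (p : ℂ[X]) (x : E) :
    aeval (X (σ i)) p (ρ σ x) = ρ σ (aeval (X i) p x) :=
  LinearMap.congr_fun (aeval_mul_eq_mul_aeval (hρ σ i) p) x

/-- Odd derivations commute with reorderings. -/
theorem reorder_oddDer (hρ : ∀ (σ : Equiv.Perm (Fin d)) i, X (σ i) * ρ σ = ρ σ * X i)
    {κ : Matrix Letter Letter ℂ[X]} (hκ : IsOddKernel κ) (σ : Equiv.Perm (Fin d))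
    (A : (Fin d → Letter) → E) :
    reorder ρ σ (oddDer X κ A) = oddDer X κ (reorder ρ σ A) := by
  funext w
  rw [reorder, oddDer_apply, oddDer_apply, map_sum, Finset.smul_sum, ← Equiv.sum_comp σ
    (fun i => (-1 : ℂ) ^ oddBefore w i • ∑ v, aeval (X i) (κ v (w i))
      (reorder ρ σ A (Function.update w i v)))]
  refine Finset.sum_congr rfl fun i _ => ?_
  rw [map_smul, map_sum, smul_smul, Finset.smul_sum, Finset.smul_sum]
  refine Finset.sum_congr rfl fun v _ => ?_
  by_cases hv : κ v (w (σ i)) = 0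
  · simp [hv]
  · rw [reorder, update_comp_perm, map_smul, aeval_perm hρ, smul_smul,
      reorderSign_mul_oddBefore (hκ _ _ hv)]
    rfl

theorem reorderSum_oddDer (hρ : ∀ (σ : Equiv.Perm (Fin d)) i, X (σ i) * ρ σ = ρ σ * X i)
    {κ : Matrix Letter Letter ℂ[X]} (hκ : IsOddKernel κ) (A : (Fin d → Letter) → E) :
    reorderSum ρ (oddDer X κ A) = oddDer X κ (reorderSum ρ A) := by
  rw [reorderSum, reorderSum, map_sum]
  exact Finset.sum_congr rfl fun σ _ => reorder_oddDer hρ hκ σ A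

end Derivations

/-! ### Acyclicity of the Koszul complex -/

namespace Kind

/-- Whether the field is in the image of the difference operator under the supercharges: `φ` and
`χ̄` are, and they are reached from `χ` and `F`. -/
def isLow : Kind → Bool
  | phi => true
  | chibar => true
  | chi => false
  | aux => false

/-- The field that is sent to (the difference of) the given one: `χ` for `φ`, and `F` for `χ̄`. -/
def raise : Kind → Kind
  | phi => chi
  | chibar => aux
  | chi => chi
  | aux => aux

/-- The inverse of `Kind.raise` on `χ` and `F`. -/
def lower : Kind → Kind
  | phi => phi
  | chibar => chibar
  | chi => phi
  | aux => chibar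

theorem raise_lower {a : Kind} (h : a.isLow = false) : a.lower.raise = a := by
  cases a <;> simp_all [isLow, lower, raise]

theorem isLow_lower (a : Kind) : a.lower.isLow = true := by cases a <;> rfl

theorem isLow_raise (a : Kind) : a.raise.isLow = false := by cases a <;> rfl

end Kind

theorem Letter.isOdd_raise_ne {a : Kind} (h : a.isLow = true) (s t : Sgn) :
    Letter.isOdd (a.raise, s) ≠ Letter.isOdd (a, t) := by
  cases a <;> simp_all [Kind.isLow, Kind.raise, isOdd]

theorem Letter.isOdd_lower_ne {a : Kind} (h : a.isLow = false) (s t : Sgn) :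
    Letter.isOdd (a.lower, s) ≠ Letter.isOdd (a, t) := by
  cases a <;> simp_all [Kind.isLow, Kind.lower, isOdd]

theorem Sgn.val_ne_zero (s : Sgn) : s.val ≠ 0 := by cases s <;> simp [Sgn.val]

section Koszul

open Polynomial

/-- The coefficient of the difference operator in `Q_{-s} χ_s` and in `Q_{-s} F_s`. -/
noncomputable def koszulCoeff (s : Sgn) (a : Kind) : ℂ :=
  if a = Kind.phi then s.val * Complex.I else -Complex.I

theorem koszulCoeff_ne_zero (s : Sgn) (a : Kind) : koszulCoeff s a ≠ 0 := by
  unfold koszulCoeff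
  split_ifs <;> simp [Sgn.val_ne_zero]

/-- The part of the supercharge `Q_{-s}` that acts on the fields of sign `s`. It is the Koszul
differential of the commuting difference operators in the lattice sites. -/
noncomputable def koszulKernel (s : Sgn) : Matrix Letter Letter ℂ[X] := fun v x =>
  if (x.2 = s ∧ x.1.isLow = true) ∧ v = (x.1.raise, s) then C (koszulCoeff s x.1) * X else 0

theorem isOddKernel_koszulKernel (s : Sgn) : IsOddKernel (koszulKernel s) := by
  intro v x h
  have h' : (x.2 = s ∧ x.1.isLow = true) ∧ v = (x.1.raise, s) := by
    by_contra hcon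
    exact h (if_neg hcon)
  obtain ⟨⟨-, h1⟩, rfl⟩ := h'
  exact Letter.isOdd_raise_ne h1 _ _

/-- The fields `χ_s` and `F_s`, which have Koszul degree one. -/
def isHigh (s : Sgn) (v : Letter) : Prop := v.2 = s ∧ v.1.isLow = false

instance (s : Sgn) (v : Letter) : Decidable (isHigh s v) := instDecidableAnd

/-- The Koszul degree of a single field. -/
def highWeight (s : Sgn) (v : Letter) : ℤ := if isHigh s v then 1 else 0

variable {d : ℕ} {E : Type*} [AddCommGroup E] [Module ℂ E] (X : Fin d → Module.End ℂ E)

theorem oddDer_koszulKernel (s : Sgn) (A : (Fin d → Letter) → E) (w : Fin d → Letter) :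
    oddDer X (koszulKernel s) A w = ∑ i, (-1 : ℂ) ^ oddBefore w i •
      if (w i).2 = s ∧ (w i).1.isLow = true then
        koszulCoeff s (w i).1 • X i (A (Function.update w i ((w i).1.raise, s))) else 0 := by
  rw [oddDer_apply]
  refine Finset.sum_congr rfl fun i _ => ?_
  congr 1
  by_cases h : (w i).2 = s ∧ (w i).1.isLow = true
  · rw [if_pos h, Finset.sum_eq_single ((w i).1.raise, s)]
    · rw [koszulKernel, if_pos ⟨h, rfl⟩, map_mul, aeval_C, aeval_X,
        Algebra.algebraMap_eq_smul_one, smul_mul_assoc, one_mul, LinearMap.smul_apply]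
    · intro v _ hv
      rw [koszulKernel, if_neg fun h' => hv h'.2, map_zero, LinearMap.zero_apply]
    · simp
  · rw [if_neg h]
    refine Finset.sum_eq_zero fun v _ => ?_
    rw [koszulKernel, if_neg fun h' => h h'.1, map_zero, LinearMap.zero_apply]

variable {X}

theorem oddDer_koszulKernel_sq (hX : ∀ i j, Commute (X i) (X j)) (s : Sgn)
    (A : (Fin d → Letter) → E) :
    oddDer X (koszulKernel s) (oddDer X (koszulKernel s) A) = 0 := by
  have hsq : koszulKernel s * koszulKernel s = 0 := by
    refine Matrix.ext fun v x => ?_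
    rw [Matrix.mul_apply, Matrix.zero_apply]
    refine Finset.sum_eq_zero fun u _ => ?_
    unfold koszulKernel
    split_ifs with h1 h2
    · rw [h2.2] at h1
      simp [Kind.isLow_raise] at h1
    all_goals simp
  have hodd := isOddKernel_koszulKernel s
  have h := oddDer_anticomm_eq_neg hX hodd hodd (by rw [hsq, add_zero]) A
  rw [eq_neg_iff_add_eq_zero, ← two_smul ℂ] at h
  exact (smul_eq_zero_iff_right two_ne_zero).1 h

/-- The contracting homotopy of the Koszul differential in the `i`-th position, built from a left
inverse `U` of the difference operator. -/
noncomputable def koszulHomotopy (s : Sgn) (i : Fin d) (U : Module.End ℂ E)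
    (A : (Fin d → Letter) → E) : (Fin d → Letter) → E := fun w =>
  if isHigh s (w i) then ((-1 : ℂ) ^ oddBefore w i * (koszulCoeff s (w i).1.lower)⁻¹) •
    U (A (Function.update w i ((w i).1.lower, s))) else 0

/-- The coefficients of `A` vanish on the words that have Koszul degree one at all positions in
`S`. -/
def VanishOn (s : Sgn) (S : Set (Fin d)) (A : (Fin d → Letter) → E) : Prop :=
  ∀ w, (∀ j ∈ S, isHigh s (w j)) → A w = 0

theorem isHigh_update_raise {s : Sgn} {w : Fin d → Letter} {j : Fin d} (i : Fin d) (a : Kind)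
    (h : isHigh s (w j)) : isHigh s (Function.update w i (a.raise, s) j) := by
  by_cases hij : j = i
  · subst hij
    rw [Function.update_self]
    exact ⟨rfl, Kind.isLow_raise a⟩
  · rwa [Function.update_of_ne hij]

theorem VanishOn.oddDer_koszulHomotopy {s : Sgn} {S : Set (Fin d)} {A : (Fin d → Letter) → E}
    (hA : VanishOn s S A) {i : Fin d} (hi : i ∉ S) (U : Module.End ℂ E) :
    VanishOn s S (oddDer X (koszulKernel s) (koszulHomotopy s i U A)) := by
  intro w hw
  rw [oddDer_koszulKernel]
  refine Finset.sum_eq_zero fun j _ => ?_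
  split_ifs with hj
  · rw [koszulHomotopy]
    split_ifs with hh
    · rw [hA, map_zero, smul_zero, map_zero, smul_zero, smul_zero]
      intro l hl
      have hli : l ≠ i := fun e => hi (e ▸ hl)
      rw [Function.update_of_ne hli]
      exact isHigh_update_raise j _ (hw l hl)
    · simp
  · simp

theorem VanishOn.sub {F : Type*} [AddCommGroup F] {s : Sgn} {S : Set (Fin d)}
    {A B : (Fin d → Letter) → F}
    (hA : VanishOn s S A) (hB : VanishOn s S B) : VanishOn s S (A - B) := fun w hw => by
  rw [Pi.sub_apply, hA w hw, hB w hw, sub_zero]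

theorem highWeight_update_raise {s : Sgn} {w : Fin d → Letter} {i : Fin d}
    (h : (w i).2 = s ∧ (w i).1.isLow = true) :
    weight (highWeight s) (Function.update w i ((w i).1.raise, s))
      = weight (highWeight s) w + 1 := by
  rw [weight_update]
  simp [highWeight, isHigh, h, Kind.isLow_raise]

theorem highWeight_update_lower {s : Sgn} {w : Fin d → Letter} {i : Fin d}
    (h : isHigh s (w i)) :
    weight (highWeight s) (Function.update w i ((w i).1.lower, s))
      = weight (highWeight s) w - 1 := by
  rw [weight_update, highWeight, highWeight, if_pos h, if_neg]
  · ring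
  · simp [isHigh, Kind.isLow_lower]

/-- The homotopy formula. A closed family of coefficients is reproduced on the words of Koszul
degree one in the `i`-th position, if the left inverse commutes with the difference operators in
all other positions except for one, `o`, at which the coefficients can be controlled. -/
theorem oddDer_koszulHomotopy_apply {s : Sgn} {i o : Fin d} {U : Module.End ℂ E}
    (hU : ∀ x, U (X i x) = x) (hUX : ∀ j, j ≠ i → j ≠ o → ∀ x, U (X j x) = X j (U x))
    {A : (Fin d → Letter) → E} (hA : oddDer X (koszulKernel s) A = 0) {w : Fin d → Letter}
    (hwi : isHigh s (w i)) (ho : isHigh s (w o) ∨ VanishOn s {o} A) :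
    oddDer X (koszulKernel s) (koszulHomotopy s i U A) w = A w := by
  set w' := Function.update w i ((w i).1.lower, s) with hw'
  have hparity : Letter.isOdd ((w i).1.lower, s) ≠ (w i).isOdd :=
    Letter.isOdd_lower_ne (t := (w i).2) hwi.2 s
  have hclosed := congrFun hA w'
  rw [oddDer_koszulKernel, Pi.zero_apply, ← Finset.add_sum_erase _ _ (Finset.mem_univ i)] at hclosed
  have hi : (w' i).2 = s ∧ (w' i).1.isLow = true := by
    simp [hw', Kind.isLow_lower]
  have hback : Function.update w' i ((w' i).1.raise, s) = w := by
    rw [hw', Function.update_idem, Function.update_self, Kind.raise_lower hwi.2]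
    conv_rhs => rw [← Function.update_eq_self i w]
    rw [← hwi.1]
  have hcoeff : (w' i).1 = (w i).1.lower := by rw [hw', Function.update_self]
  rw [if_pos hi, hback, neg_one_pow_oddBefore_update_of_le w _ le_rfl, hcoeff] at hclosed
  set c := koszulCoeff s (w i).1.lower with hc
  have hc0 : c ≠ 0 := koszulCoeff_ne_zero _ _
  -- Apply `U` to the closedness relation at the lowered word.
  have hclosed' := congrArg (fun x => ((-1 : ℂ) ^ oddBefore w i * c⁻¹) • U x) hclosed
  simp only [map_add, map_smul, hU, map_sum, map_zero, smul_zero, smul_add, smul_smul] at hclosed'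
  have hone : (-1 : ℂ) ^ oddBefore w i * c⁻¹ * ((-1 : ℂ) ^ oddBefore w i * c) = 1 := by
    rw [mul_mul_mul_comm, neg_one_pow_oddBefore_mul_self, inv_mul_cancel₀ hc0, one_mul]
  rw [hone, one_smul] at hclosed'
  rw [oddDer_koszulKernel, ← Finset.add_sum_erase _ _ (Finset.mem_univ i),
    if_neg (by simp [hwi.2]), smul_zero, zero_add]
  rw [add_eq_zero_iff_eq_neg] at hclosed'
  rw [hclosed', Finset.smul_sum, ← Finset.sum_neg_distrib]
  refine Finset.sum_congr rfl fun j hj => ?_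
  have hji : j ≠ i := Finset.ne_of_mem_erase hj
  have hwj : w' j = w j := by rw [hw', Function.update_of_ne hji]
  rw [hwj]
  by_cases hlow : (w j).2 = s ∧ (w j).1.isLow = true
  · rw [if_pos hlow, if_pos hlow]
    have hcomm : Function.update (Function.update w j ((w j).1.raise, s)) i ((w i).1.lower, s)
        = Function.update w' j ((w j).1.raise, s) := by
      rw [hw', Function.update_comm hji]
    have hUXj : U (X j (A (Function.update w' j ((w j).1.raise, s))))
        = X j (U (A (Function.update w' j ((w j).1.raise, s)))) := by
      by_cases hjo : j = o
      · have hvan : VanishOn s {o} A := by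
          refine ho.resolve_left fun h => ?_
          rw [← hjo] at h
          simp [h.2] at hlow
        rw [hvan _ (by
          rintro l rfl
          rw [hjo, Function.update_self]
          exact ⟨rfl, Kind.isLow_raise _⟩)]
        simp
      · exact hUX j hji hjo _
    rw [koszulHomotopy, Function.update_of_ne hji.symm, if_pos hwi, hcomm,
      neg_one_pow_oddBefore_update (Letter.isOdd_raise_ne (t := (w j).2) hlow.2 s), map_smul,
      map_smul, hUXj, smul_smul, smul_smul, smul_smul, smul_smul, ← neg_smul,
      neg_one_pow_oddBefore_update hparity, ← hc]
    congr 1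
    rcases lt_or_gt_of_ne hji with h | h
    · simp only [h, lt_asymm h, if_true, if_false]
      ring
    · simp only [h, lt_asymm h, if_true, if_false]
      ring
  · rw [if_neg hlow, if_neg hlow]
    simp

end Koszul

section Acyclicity

variable {k : ℕ} {E : Type*} [AddCommGroup E] [Module ℂ E] {X : Fin (k + 1) → Module.End ℂ E}

/-- Closed families of coefficients that are homologous to `A` and have Koszul degree at least
two. -/
structure IsReduction (X : Fin (k + 1) → Module.End ℂ E) (s : Sgn)
    (A B : (Fin (k + 1) → Letter) → E) : Prop where
  closed : oddDer X (koszulKernel s) B = 0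
  degree : ∀ w, B w ≠ 0 → 2 ≤ weight (highWeight s) w
  homologous : ∃ T, A - B = oddDer X (koszulKernel s) T

theorem IsReduction.sub_koszulHomotopy {s : Sgn} {A B : (Fin (k + 1) → Letter) → E}
    (hX : ∀ i j, Commute (X i) (X j)) (h : IsReduction X s A B) (i : Fin (k + 1))
    (U : Module.End ℂ E) :
    IsReduction X s A (B - oddDer X (koszulKernel s) (koszulHomotopy s i U B)) where
  closed := by rw [map_sub, h.closed, oddDer_koszulKernel_sq hX, sub_zero]
  degree w hw := by
    by_cases hB : B w = 0
    · rw [Pi.sub_apply, hB, zero_sub, neg_ne_zero] at hw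
      obtain ⟨j, hj⟩ : ∃ j, ((w j).2 = s ∧ (w j).1.isLow = true) ∧
          koszulHomotopy s i U B (Function.update w j ((w j).1.raise, s)) ≠ 0 := by
        by_contra hcon
        push Not at hcon
        rw [oddDer_koszulKernel] at hw
        refine hw (Finset.sum_eq_zero fun j _ => ?_)
        split_ifs with hj
        · rw [hcon j hj, map_zero, smul_zero, smul_zero]
        · rw [smul_zero]
      obtain ⟨hlow, hne⟩ := hj
      rw [koszulHomotopy] at hne
      split_ifs at hne with hhigh
      · have h1 := h.degree _ fun h0 => hne (by rw [h0, map_zero, smul_zero])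
        rw [highWeight_update_lower hhigh, highWeight_update_raise hlow] at h1
        linarith
      · exact absurd rfl hne
    · exact h.degree w hB
  homologous := by
    obtain ⟨T, hT⟩ := h.homologous
    refine ⟨T + koszulHomotopy s i U B, ?_⟩
    rw [map_add, ← hT]
    abel

/-- The Koszul complex of `k + 1` commuting operators, of which all but the zeroth have left
inverses that commute with the other operators except for the zeroth, has no homology in degree
two and higher. -/
theorem exists_oddDer_koszulKernel_eq (hX : ∀ i j, Commute (X i) (X j))
    (U : Fin (k + 1) → Module.End ℂ E) (hU : ∀ i, i ≠ 0 → ∀ x, U i (X i x) = x)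
    (hUX : ∀ i, i ≠ 0 → ∀ j, j ≠ i → j ≠ 0 → ∀ x, U i (X j x) = X j (U i x)) (s : Sgn)
    {A : (Fin (k + 1) → Letter) → E} (hA : oddDer X (koszulKernel s) A = 0)
    (hdeg : ∀ w, A w ≠ 0 → 2 ≤ weight (highWeight s) w) :
    ∃ T, oddDer X (koszulKernel s) T = A := by
  -- The first pass removes the words of degree one in the zeroth and in some other position.
  have pass₁ : ∀ n, ∃ B, IsReduction X s A B ∧
      ∀ j : Fin (k + 1), j ≠ 0 → j.val < n → VanishOn s {0, j} B := by
    intro n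
    induction n with
    | zero => exact ⟨A, ⟨hA, hdeg, 0, by simp⟩, fun j _ hj => absurd hj (Nat.not_lt_zero _)⟩
    | succ n ih =>
      obtain ⟨B, hB, hvan⟩ := ih
      by_cases hn : n ≠ 0 ∧ n < k + 1
      · have hi : (⟨n, hn.2⟩ : Fin (k + 1)) ≠ 0 := fun e => hn.1 (congrArg Fin.val e)
        refine ⟨_, hB.sub_koszulHomotopy hX ⟨n, hn.2⟩ (U ⟨n, hn.2⟩), fun j hj hjn => ?_⟩
        rcases (Nat.lt_succ_iff_lt_or_eq.1 hjn) with h | h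
        · refine (hvan j hj h).sub ((hvan j hj h).oddDer_koszulHomotopy ?_ _)
          rintro (e | e)
          · exact hi e
          · have := congrArg Fin.val e
            simp only at this
            omega
        · obtain rfl : j = ⟨n, hn.2⟩ := Fin.ext h
          intro w hw
          rw [Pi.sub_apply, oddDer_koszulHomotopy_apply (hU _ hi) (hUX _ hi) hB.closed
            (hw _ (Or.inr rfl)) (Or.inl (hw _ (Or.inl rfl))), sub_self]
      · refine ⟨B, hB, fun j hj hjn => hvan j hj ?_⟩
        have h1 : j.val ≠ 0 := fun e => hj (Fin.ext e)
        have h2 := j.isLt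
        omega
  obtain ⟨B, hB, hvan⟩ := pass₁ (k + 1)
  have hvan₀ : VanishOn s {0} B := by
    intro w hw
    by_contra hne
    have h2 := hB.degree w hne
    rw [weight, Fin.sum_univ_succ, Finset.sum_eq_zero] at h2
    · unfold highWeight at h2
      split_ifs at h2 <;> omega
    · intro j _
      refine if_neg fun hj => hne (hvan j.succ (Fin.succ_ne_zero j) j.succ.isLt w ?_)
      rintro l (rfl | rfl)
      · exact hw _ rfl
      · exact hj
  -- The second pass removes the words of degree one in some other position.
  have pass₂ : ∀ n, ∃ B, IsReduction X s A B ∧ VanishOn s {0} B ∧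
      ∀ j : Fin (k + 1), j ≠ 0 → j.val < n → VanishOn s {j} B := by
    intro n
    induction n with
    | zero => exact ⟨B, hB, hvan₀, fun j _ hj => absurd hj (Nat.not_lt_zero _)⟩
    | succ n ih =>
      obtain ⟨B, hB, hvan₀, hvan⟩ := ih
      by_cases hn : n ≠ 0 ∧ n < k + 1
      · have hi : (⟨n, hn.2⟩ : Fin (k + 1)) ≠ 0 := fun e => hn.1 (congrArg Fin.val e)
        refine ⟨_, hB.sub_koszulHomotopy hX ⟨n, hn.2⟩ (U ⟨n, hn.2⟩),
          hvan₀.sub (hvan₀.oddDer_koszulHomotopy hi _), fun j hj hjn => ?_⟩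
        rcases (Nat.lt_succ_iff_lt_or_eq.1 hjn) with h | h
        · refine (hvan j hj h).sub ((hvan j hj h).oddDer_koszulHomotopy ?_ _)
          intro e
          have := congrArg Fin.val (Set.mem_singleton_iff.1 e)
          simp only at this
          omega
        · obtain rfl : j = ⟨n, hn.2⟩ := Fin.ext h
          intro w hw
          rw [Pi.sub_apply, oddDer_koszulHomotopy_apply (hU _ hi) (hUX _ hi) hB.closed
            (hw _ rfl) (Or.inr hvan₀), sub_self]
      · refine ⟨B, hB, hvan₀, fun j hj hjn => hvan j hj ?_⟩
        have h1 : j.val ≠ 0 := fun e => hj (Fin.ext e)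
        have h2 := j.isLt
        omega
  obtain ⟨B, hB, hvan₀, hvan⟩ := pass₂ (k + 1)
  have hzero : B = 0 := by
    funext w
    by_contra hne
    have h2 := hB.degree w hne
    rw [weight, Finset.sum_eq_zero] at h2
    · omega
    · intro j _
      refine if_neg fun hj => hne ?_
      by_cases hj0 : j = 0
      · exact hvan₀ w (by rintro l rfl; exact hj0 ▸ hj)
      · exact hvan j hj0 j.isLt w (by rintro l rfl; exact hj)
  obtain ⟨T, hT⟩ := hB.homologous
  exact ⟨T, by rw [← hT, hzero, sub_zero]⟩

end Acyclicity

/-! ### The supercharges and their contracting homotopies -/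

theorem Sgn.ne_iff_eq_opp {s t : Sgn} : t ≠ s ↔ t = s.opp := by
  cases s <;> cases t <;> simp [Sgn.opp]

theorem Sgn.opp_ne (s : Sgn) : s.opp ≠ s := Sgn.ne_iff_eq_opp.2 rfl

theorem Kind.sum_univ {M : Type*} [AddCommMonoid M] (f : Kind → M) :
    ∑ a, f a = f Kind.phi + f Kind.chibar + f Kind.chi + f Kind.aux := by
  rw [show (Finset.univ : Finset Kind) = {Kind.phi, Kind.chibar, Kind.chi, Kind.aux} from rfl]
  simp [add_assoc]

section Kernels

open Polynomial

/-- The action of `Q_s` on the fields of sign `t`. -/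
noncomputable def susyBlock (s t : Sgn) : Matrix Kind Kind ℂ[X]
  | Kind.phi, Kind.chibar => if t = s then C s.val else 0
  | Kind.chi, Kind.aux => if t = s then 1 else 0
  | Kind.chi, Kind.phi => if t = s then 0 else C (t.val * Complex.I) * X
  | Kind.aux, Kind.chibar => if t = s then 0 else C (-Complex.I) * X
  | _, _ => 0

/-- The supercharge `Q_s` on single fields; the indeterminate stands for the difference operator. -/
noncomputable def susyKernel (s : Sgn) : Matrix Letter Letter ℂ[X] :=
  Matrix.blockDiagonal (susyBlock s)

/-- The action of the contracting homotopy of `Q_s` on the fields of sign `t`. -/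
noncomputable def homotopyBlock (s t : Sgn) : Matrix Kind Kind ℂ[X]
  | Kind.chibar, Kind.phi => if t = s then C s.val else 0
  | Kind.aux, Kind.chi => if t = s then 1 else 0
  | _, _ => 0

/-- The contracting homotopy of `Q_s` on the fields of sign `s`: it sends `χ̄_s` to `± φ_s` and
`F_s` to `χ_s`. -/
noncomputable def homotopyKernel (s : Sgn) : Matrix Letter Letter ℂ[X] :=
  Matrix.blockDiagonal (homotopyBlock s)

theorem eq_sign_of_blockDiagonal_ne_zero {M : Sgn → Matrix Kind Kind ℂ[X]} {v x : Letter}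
    (h : Matrix.blockDiagonal M v x ≠ 0) : v.2 = x.2 := by
  rw [Matrix.blockDiagonal_apply] at h
  by_contra hne
  exact h (if_neg hne)

theorem isOddKernel_susyKernel (s : Sgn) : IsOddKernel (susyKernel s) := by
  rintro ⟨a, t⟩ ⟨b, u⟩ h
  rw [susyKernel, Matrix.blockDiagonal_apply] at h
  cases a <;> cases b <;> simp_all [susyBlock, Letter.isOdd]

theorem isOddKernel_homotopyKernel (s : Sgn) : IsOddKernel (homotopyKernel s) := by
  rintro ⟨a, t⟩ ⟨b, u⟩ h
  rw [homotopyKernel, Matrix.blockDiagonal_apply] at h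
  cases a <;> cases b <;> simp_all [homotopyBlock, Letter.isOdd]

theorem fermionNumber_of_homotopyKernel_ne_zero {s : Sgn} (v x : Letter)
    (h : homotopyKernel s v x ≠ 0) : x.fermionNumber = v.fermionNumber + 1 := by
  obtain ⟨a, t⟩ := v
  obtain ⟨b, u⟩ := x
  rw [homotopyKernel, Matrix.blockDiagonal_apply] at h
  cases a <;> cases b <;> simp_all [homotopyBlock, Letter.fermionNumber]

theorem susyKernel_anticomm (s t : Sgn) :
    susyKernel t * susyKernel s + susyKernel s * susyKernel t = 0 := by
  rw [susyKernel, susyKernel, ← Matrix.blockDiagonal_mul, ← Matrix.blockDiagonal_mul,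
    ← Matrix.blockDiagonal_add, ← Matrix.blockDiagonal_zero]
  congr 1
  funext u
  refine Matrix.ext fun a b => ?_
  simp only [Pi.add_apply, Matrix.add_apply, Matrix.mul_apply, Kind.sum_univ, Pi.zero_apply,
    Matrix.zero_apply]
  cases a <;> cases b <;>
    simp only [susyBlock, mul_zero, zero_mul, add_zero] <;>
    cases s <;> cases t <;> cases u <;> simp [Sgn.val]

theorem homotopyKernel_anticomm_opp (s : Sgn) :
    homotopyKernel s * susyKernel s.opp + susyKernel s.opp * homotopyKernel s = 0 := by
  rw [susyKernel, homotopyKernel, ← Matrix.blockDiagonal_mul, ← Matrix.blockDiagonal_mul,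
    ← Matrix.blockDiagonal_add, ← Matrix.blockDiagonal_zero]
  congr 1
  funext u
  refine Matrix.ext fun a b => ?_
  simp only [Pi.add_apply, Matrix.add_apply, Matrix.mul_apply, Kind.sum_univ, Pi.zero_apply,
    Matrix.zero_apply]
  cases a <;> cases b <;>
    simp only [susyBlock, homotopyBlock, mul_zero, zero_mul, add_zero, zero_add] <;>
    cases s <;> cases u <;> simp [Sgn.val, Sgn.opp]

/-- One for the fields of sign `s`, zero for the others. -/
def signWeight (s : Sgn) (v : Letter) : ℤ := if v.2 = s then 1 else 0

theorem homotopyKernel_anticomm (s : Sgn) :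
    homotopyKernel s * susyKernel s + susyKernel s * homotopyKernel s
      = Matrix.diagonal fun v => C (signWeight s v : ℂ) := by
  have h : (Matrix.diagonal fun v => C (signWeight s v : ℂ) : Matrix Letter Letter ℂ[X])
      = Matrix.blockDiagonal fun u => Matrix.diagonal fun _ => if u = s then 1 else 0 := by
    rw [Matrix.blockDiagonal_diagonal]
    congr 1
    funext v
    simp only [signWeight]
    split_ifs <;> simp
  rw [h, susyKernel, homotopyKernel, ← Matrix.blockDiagonal_mul, ← Matrix.blockDiagonal_mul,
    ← Matrix.blockDiagonal_add]
  congr 1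
  funext u
  refine Matrix.ext fun a b => ?_
  simp only [Pi.add_apply, Matrix.add_apply, Matrix.mul_apply, Kind.sum_univ]
  cases a <;> cases b <;>
    simp only [susyBlock, homotopyBlock, mul_zero, zero_mul, add_zero, zero_add] <;>
    cases s <;> cases u <;> simp [Sgn.val]

theorem susyKernel_opp_eq_koszulKernel {s : Sgn} {v : Letter} (hv : v.2 = s) (x : Letter) :
    susyKernel s.opp v x = koszulKernel s v x := by
  obtain ⟨a, t⟩ := v
  obtain ⟨b, u⟩ := x
  subst hv
  rw [susyKernel, Matrix.blockDiagonal_apply, koszulKernel]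
  have h := (Sgn.opp_ne t).symm
  by_cases htu : t = u
  · subst htu
    cases a <;> cases b <;> simp [susyBlock, koszulCoeff, Kind.isLow, Kind.raise, h]
  · simp [htu, Ne.symm htu]

/-- One for `χ̄` and `F`, zero for `φ` and `χ`. -/
def chibarAuxWeight (v : Letter) : ℤ := if v.1 = Kind.chibar ∨ v.1 = Kind.aux then 1 else 0

theorem koszulKernel_weights {s : Sgn} {v x : Letter} (h : koszulKernel s v x ≠ 0) :
    x.2 = v.2 ∧ v.fermionNumber = x.fermionNumber + 1 ∧
      chibarAuxWeight v = chibarAuxWeight x := by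
  have h' : (x.2 = s ∧ x.1.isLow = true) ∧ v = (x.1.raise, s) := by
    by_contra hcon
    exact h (if_neg hcon)
  obtain ⟨⟨h1, h2⟩, rfl⟩ := h'
  obtain ⟨b, u⟩ := x
  refine ⟨h1, ?_⟩
  cases b <;> simp_all [Kind.isLow, Kind.raise, Letter.fermionNumber, chibarAuxWeight]

variable {d : ℕ} {E : Type*} [AddCommGroup E] [Module ℂ E] {X : Fin d → Module.End ℂ E}

theorem evenDer_diagonal (u : Letter → ℤ) (A : (Fin d → Letter) → E) (w : Fin d → Letter) :
    evenDer X (Matrix.diagonal fun v => C (u v : ℂ)) A w = (weight u w : ℂ) • A w := by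
  rw [weight, Int.cast_sum, Finset.sum_smul]
  refine Finset.sum_congr rfl fun i _ => ?_
  rw [Finset.sum_eq_single (w i)]
  · rw [Matrix.diagonal_apply_eq, aeval_C, Algebra.algebraMap_eq_smul_one, LinearMap.smul_apply,
      Module.End.one_apply, Function.update_eq_self]
  · intro v _ hv
    rw [Matrix.diagonal_apply_ne _ hv, map_zero, LinearMap.zero_apply]
  · simp

/-- `h_s` inverts `Q_s` on closed families up to the number of fields of sign `s`. -/
theorem oddDer_susy_homotopy (hX : ∀ i j, Commute (X i) (X j)) {s : Sgn}
    {A : (Fin d → Letter) → E} (hA : oddDer X (susyKernel s) A = 0) :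
    oddDer X (susyKernel s) (oddDer X (homotopyKernel s) A)
      = scale (fun w => (weight (signWeight s) w : ℂ)) A := by
  have h := oddDer_anticomm hX (isOddKernel_susyKernel s) (isOddKernel_homotopyKernel s) A
  rw [hA, map_zero, add_zero, homotopyKernel_anticomm] at h
  rw [h]
  funext w
  exact evenDer_diagonal _ _ _

theorem oddDer_susy_opp_homotopy (hX : ∀ i j, Commute (X i) (X j)) (s : Sgn)
    (A : (Fin d → Letter) → E) :
    oddDer X (susyKernel s.opp) (oddDer X (homotopyKernel s) A)
      = -oddDer X (homotopyKernel s) (oddDer X (susyKernel s.opp) A) :=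
  oddDer_anticomm_eq_neg hX (isOddKernel_susyKernel _) (isOddKernel_homotopyKernel s)
    (homotopyKernel_anticomm_opp s) A

theorem oddDer_susy_anticomm (hX : ∀ i j, Commute (X i) (X j)) (s t : Sgn)
    (A : (Fin d → Letter) → E) :
    oddDer X (susyKernel s) (oddDer X (susyKernel t) A)
      = -oddDer X (susyKernel t) (oddDer X (susyKernel s) A) :=
  oddDer_anticomm_eq_neg hX (isOddKernel_susyKernel _) (isOddKernel_susyKernel _)
    (susyKernel_anticomm s t) A

theorem signWeight_nonneg (s : Sgn) (v : Letter) : 0 ≤ signWeight s v := by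
  unfold signWeight
  split_ifs <;> simp

theorem weight_signWeight_add (s : Sgn) (w : Fin d → Letter) :
    weight (signWeight s) w + weight (signWeight s.opp) w = d := by
  rw [weight, weight, ← Finset.sum_add_distrib, Finset.sum_congr rfl (g := fun _ => (1 : ℤ))]
  · simp
  · intro i _
    unfold signWeight
    by_cases h : (w i).2 = s
    · simp [h, (Sgn.opp_ne s).symm]
    · simp [Sgn.ne_iff_eq_opp.1 h, Sgn.opp_ne s]

theorem sign_eq_of_weight_eq_zero {s : Sgn} {w : Fin d → Letter}
    (h : weight (signWeight s.opp) w = 0) (i : Fin d) : (w i).2 = s := by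
  have h1 := eq_zero_of_weight_eq_zero (signWeight_nonneg s.opp) h i
  by_contra hne
  simp [signWeight, Sgn.ne_iff_eq_opp.1 hne] at h1

theorem weight_signWeight_update {M : Sgn → Matrix Kind Kind ℂ[X]} (s : Sgn) {w : Fin d → Letter}
    {i : Fin d} {v : Letter} (h : Matrix.blockDiagonal M v (w i) ≠ 0) :
    weight (signWeight s) (Function.update w i v) = weight (signWeight s) w := by
  rw [weight_update, signWeight, signWeight, eq_sign_of_blockDiagonal_ne_zero h, sub_self, add_zero]

theorem scale_signWeight_oddDer {M : Sgn → Matrix Kind Kind ℂ[X]} (f : ℤ → ℤ → ℂ)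
    (A : (Fin d → Letter) → E) :
    scale (fun w => f (weight (signWeight Sgn.plus) w) (weight (signWeight Sgn.minus) w))
        (oddDer X (Matrix.blockDiagonal M) A)
      = oddDer X (Matrix.blockDiagonal M)
        (scale (fun w => f (weight (signWeight Sgn.plus) w) (weight (signWeight Sgn.minus) w)) A) :=
  scale_oddDer X (fun w i v h => by
    rw [weight_signWeight_update _ h, weight_signWeight_update _ h]) A

end Kernels

/-! ### Closed families of coefficients -/

section Decomposition

variable {k : ℕ} {E : Type*} [AddCommGroup E] [Module ℂ E] {X : Fin (k + 1) → Module.End ℂ E}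

theorem fermionNumber_eq_of_sign {s : Sgn} {v : Letter} (h : v.2 = s) :
    highWeight s v = v.fermionNumber + chibarAuxWeight v := by
  obtain ⟨a, t⟩ := v
  cases a <;> simp_all [highWeight, isHigh, Kind.isLow, Letter.fermionNumber, chibarAuxWeight]

theorem chibarAuxWeight_nonneg (v : Letter) : 0 ≤ chibarAuxWeight v := by
  unfold chibarAuxWeight
  split_ifs <;> simp

/-- The word of a monomial that consists of one field `χ_s` at position `i` and of fields `φ_s`. -/
def IsChiPhi (s : Sgn) {d : ℕ} (w : Fin d → Letter) (i : Fin d) : Prop :=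
  w i = (Kind.chi, s) ∧ ∀ j, j ≠ i → w j = (Kind.phi, s)

theorem exists_isChiPhi {s : Sgn} {d : ℕ} {w : Fin d → Letter}
    (hs : weight (signWeight s.opp) w = 0) (hf : weight Letter.fermionNumber w = 1)
    (hq : weight chibarAuxWeight w = 0) : ∃ i, IsChiPhi s w i := by
  have hcases : ∀ i, w i = (Kind.chi, s) ∨ w i = (Kind.phi, s) := fun i => by
    have h1 := sign_eq_of_weight_eq_zero hs i
    have h2 := eq_zero_of_weight_eq_zero chibarAuxWeight_nonneg hq i
    generalize w i = v at h1 h2 ⊢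
    obtain ⟨a, t⟩ := v
    cases a <;> simp_all [chibarAuxWeight]
  have hnonneg : ∀ i, 0 ≤ (w i).fermionNumber := fun i => by
    rcases hcases i with h | h <;> simp [h, Letter.fermionNumber]
  obtain ⟨i, hi⟩ : ∃ i, w i = (Kind.chi, s) := by
    by_contra hcon
    push Not at hcon
    rw [weight, Finset.sum_eq_zero] at hf
    · exact zero_ne_one hf
    · intro i _
      rw [(hcases i).resolve_left (hcon i)]
      rfl
  refine ⟨i, hi, fun j hj => (hcases j).resolve_left fun hchi => ?_⟩
  rw [weight, ← Finset.add_sum_erase _ _ (Finset.mem_univ i), hi] at hf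
  have h1 := Finset.single_le_sum (f := fun j => (w j).fermionNumber) (fun j _ => hnonneg j)
    (Finset.mem_erase.2 ⟨hj, Finset.mem_univ j⟩)
  simp only [hchi, Letter.fermionNumber] at h1 hf
  omega

/-- Closed families that involve only fields of one sign `s`. Up to terms in the image of
`Q_+ Q_-` they are `Q_s` of a family with one `χ_s` and otherwise only `φ_s`: the family `h_s A` has
fermion number one and is closed under `Q_{-s}`, and its terms with a field `χ̄_s` or `F_s` have
Koszul degree at least two, so that they are exact. -/
theorem exists_decomposition_of_sign (hX : ∀ i j, Commute (X i) (X j))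
    (U : Fin (k + 1) → Module.End ℂ E) (hU : ∀ i, i ≠ 0 → ∀ x, U i (X i x) = x)
    (hUX : ∀ i, i ≠ 0 → ∀ j, j ≠ i → j ≠ 0 → ∀ x, U i (X j x) = X j (U i x))
    {ρ : Equiv.Perm (Fin (k + 1)) →* Module.End ℂ E}
    (hρ : ∀ (σ : Equiv.Perm (Fin (k + 1))) i, X (σ i) * ρ σ = ρ σ * X i) (s : Sgn)
    {A : (Fin (k + 1) → Letter) → E} (hA : ∀ t, oddDer X (susyKernel t) A = 0)
    (hsymm : ∀ σ, reorder ρ σ A = A) (hfermion : ∀ w, A w ≠ 0 → weight Letter.fermionNumber w = 0)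
    (hsign : ∀ w, A w ≠ 0 → weight (signWeight s.opp) w = 0) :
    ∃ T K : (Fin (k + 1) → Letter) → E,
      (∀ w, T w ≠ 0 → weight Letter.fermionNumber w = 2) ∧
      (∀ w, K w ≠ 0 → ∃ i, IsChiPhi s w i) ∧ (∀ σ, reorder ρ σ K = K) ∧
      oddDer X (susyKernel s.opp) K = 0 ∧
      ((k : ℂ) + 1) • A = oddDer X (susyKernel s) K
        + oddDer X (susyKernel s) (oddDer X (susyKernel s.opp) T) := by
  set B := oddDer X (homotopyKernel s) A with hB
  have hBfermion : ∀ w, B w ≠ 0 → weight Letter.fermionNumber w = 1 := fun w hw => by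
    simpa using weight_eq_of_oddDer_ne_zero X fermionNumber_of_homotopyKernel_ne_zero hfermion w hw
  have hBsign : ∀ w, B w ≠ 0 → weight (signWeight s.opp) w = 0 := fun w hw => by
    simpa using weight_eq_of_oddDer_ne_zero X (c := 0) (fun v x h => by
      rw [signWeight, signWeight, eq_sign_of_blockDiagonal_ne_zero h, add_zero]) hsign w hw
  have hBsymm : ∀ σ, reorder ρ σ B = B := fun σ => by
    rw [hB, reorder_oddDer hρ (isOddKernel_homotopyKernel s), hsymm]
  have hBclosed : oddDer X (koszulKernel s) B = 0 := by
    rw [← oddDer_congr X (κ := susyKernel s.opp), hB, oddDer_susy_opp_homotopy hX, hA, map_zero,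
      neg_zero]
    intro w i v h
    refine susyKernel_opp_eq_koszulKernel ?_ _
    simpa using sign_eq_of_weight_eq_zero (hBsign _ h) i
  have hBA : oddDer X (susyKernel s) B = ((k : ℂ) + 1) • A := by
    rw [hB, oddDer_susy_homotopy hX (hA s)]
    funext w
    by_cases hw : A w = 0
    · simp [scale, hw]
    · have h1 := weight_signWeight_add s w
      rw [hsign w hw, add_zero] at h1
      simp [scale, h1]
  -- The part with a field `χ̄` or `F` has Koszul degree at least two.
  let c : (Fin (k + 1) → Letter) → ℂ := fun w => if weight chibarAuxWeight w = 0 then 1 else 0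
  let c' : (Fin (k + 1) → Letter) → ℂ := fun w => if weight chibarAuxWeight w = 0 then 0 else 1
  have hsum : scale c B + scale c' B = B := by
    funext w
    simp only [scale, c, c', Pi.add_apply]
    split_ifs <;> simp
  have hKdeg : ∀ w, scale c' B w ≠ 0 → 2 ≤ weight (highWeight s) w := by
    intro w hw
    have hne : weight chibarAuxWeight w ≠ 0 := fun h => hw (by simp [scale, c', h])
    have hBw : B w ≠ 0 := fun h => hw (by simp [scale, h])
    have h1 : weight (highWeight s) w
        = weight Letter.fermionNumber w + weight chibarAuxWeight w := by
      rw [weight, weight, weight, ← Finset.sum_add_distrib]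
      exact Finset.sum_congr rfl fun i _ =>
        fermionNumber_eq_of_sign (sign_eq_of_weight_eq_zero (hBsign w hBw) i)
    have h2 := weight_nonneg chibarAuxWeight_nonneg w
    rw [h1, hBfermion w hBw]
    omega
  have hcloseds : ∀ f : ℤ → ℂ, oddDer X (koszulKernel s)
      (scale (fun w => f (weight chibarAuxWeight w)) B) = 0 := fun f => by
    rw [← scale_oddDer (c := fun w => f (weight chibarAuxWeight w)), hBclosed]
    · funext w
      simp [scale]
    · intro w i v h
      rw [weight_update, (koszulKernel_weights h).2.2, sub_self, add_zero]
  obtain ⟨T₀, hT₀⟩ := exists_oddDer_koszulKernel_eq hX U hU hUX s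
    (hcloseds fun n => if n = 0 then 0 else 1) hKdeg
  let e : ℤ → (Fin (k + 1) → Letter) → ℂ := fun n w =>
    if weight (signWeight s.opp) w = 0 ∧ weight Letter.fermionNumber w = n then 1 else 0
  have hT : oddDer X (koszulKernel s) (scale (e 2) T₀) = scale c' B := by
    rw [← scale_oddDer (c := e 1), hT₀]
    · funext w
      by_cases hBw : B w = 0
      · simp [scale, hBw]
      · simp only [scale, e, hBsign w hBw, hBfermion w hBw, and_self, if_true, one_smul]
        rfl
    · intro w i v h
      obtain ⟨h1, h2, -⟩ := koszulKernel_weights h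
      simp only [e, weight_update, h2, signWeight, h1]
      congr 1
      apply propext
      constructor <;> rintro ⟨h3, h4⟩ <;> constructor <;> linarith
  have hTsupp : ∀ w, scale (e 2) T₀ w ≠ 0 →
      weight (signWeight s.opp) w = 0 ∧ weight Letter.fermionNumber w = 2 := by
    intro w hw
    by_contra hcon
    exact hw (by simp only [scale, e, if_neg hcon, zero_smul])
  have hcsupp : ∀ w, scale c B w ≠ 0 → B w ≠ 0 := fun w hw h => hw (by simp [scale, h])
  refine ⟨scale (e 2) T₀, scale c B, fun w hw => (hTsupp w hw).2, fun w hw => ?_, fun σ => ?_, ?_,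
    ?_⟩
  · refine exists_isChiPhi (hBsign w (hcsupp w hw)) (hBfermion w (hcsupp w hw)) ?_
    by_contra hne
    exact hw (by simp [scale, c, hne])
  · rw [scale_reorder, hBsymm]
    intro w σ
    simp only [c, weight_comp_perm]
  · rw [oddDer_congr X (κ' := koszulKernel s)]
    · exact hcloseds fun n => if n = 0 then 1 else 0
    · intro w i v h
      refine susyKernel_opp_eq_koszulKernel ?_ _
      simpa using sign_eq_of_weight_eq_zero (hBsign _ (hcsupp _ h)) i
  · rw [oddDer_congr X (κ := susyKernel s.opp) (κ' := koszulKernel s), hT, ← map_add, hsum, hBA]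
    intro w i v h
    refine susyKernel_opp_eq_koszulKernel ?_ _
    simpa using sign_eq_of_weight_eq_zero (hTsupp _ h).1 i

theorem scale_ne_zero {d : ℕ} {c : (Fin d → Letter) → ℂ} {A : (Fin d → Letter) → E}
    {w : Fin d → Letter} (h : scale c A w ≠ 0) : A w ≠ 0 ∧ c w ≠ 0 :=
  ⟨fun h0 => h (by simp [scale, h0]), fun h0 => h (by simp [scale, h0])⟩

/-- A family that is closed under both supercharges is the sum of a term in the image of `Q_- Q_+`
and of `Q_s` of families with one `χ_s` and otherwise only `φ_s`, which are closed under the other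
supercharge. The operators `X i` stand for the difference operator in the lattice site `i`. -/
theorem exists_decomposition (hX : ∀ i j, Commute (X i) (X j))
    (U : Fin (k + 1) → Module.End ℂ E) (hU : ∀ i, i ≠ 0 → ∀ x, U i (X i x) = x)
    (hUX : ∀ i, i ≠ 0 → ∀ j, j ≠ i → j ≠ 0 → ∀ x, U i (X j x) = X j (U i x))
    {ρ : Equiv.Perm (Fin (k + 1)) →* Module.End ℂ E}
    (hρ : ∀ (σ : Equiv.Perm (Fin (k + 1))) i, X (σ i) * ρ σ = ρ σ * X i)
    {A : (Fin (k + 1) → Letter) → E} (hA : ∀ t, oddDer X (susyKernel t) A = 0)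
    (hsymm : ∀ σ, reorder ρ σ A = A)
    (hfermion : ∀ w, A w ≠ 0 → weight Letter.fermionNumber w = 0) :
    ∃ (T : (Fin (k + 1) → Letter) → E) (K : Sgn → (Fin (k + 1) → Letter) → E),
      (∀ w, T w ≠ 0 → weight Letter.fermionNumber w = 2) ∧
      (∀ s w, K s w ≠ 0 → ∃ i, IsChiPhi s w i) ∧ (∀ s σ, reorder ρ σ (K s) = K s) ∧
      (∀ s, oddDer X (susyKernel s.opp) (K s) = 0) ∧
      A = oddDer X (susyKernel Sgn.minus) (oddDer X (susyKernel Sgn.plus) T)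
        + oddDer X (susyKernel Sgn.plus) (K Sgn.plus)
        + oddDer X (susyKernel Sgn.minus) (K Sgn.minus) := by
  have hk : (k : ℂ) + 1 ≠ 0 := Nat.cast_add_one_ne_zero k
  have hclosed : ∀ (f : ℤ → ℤ → ℂ) t, oddDer X (susyKernel t) (scale (fun w =>
      f (weight (signWeight Sgn.plus) w) (weight (signWeight Sgn.minus) w)) A) = 0 := fun f t => by
    rw [susyKernel, ← scale_signWeight_oddDer, ← susyKernel, hA]
    funext w
    simp [scale]
  have hinv : ∀ (f : ℤ → ℤ → ℂ) σ, reorder ρ σ (scale (fun w =>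
      f (weight (signWeight Sgn.plus) w) (weight (signWeight Sgn.minus) w)) A)
      = scale (fun w => f (weight (signWeight Sgn.plus) w) (weight (signWeight Sgn.minus) w)) A :=
    fun f σ => by
      rw [scale_reorder, hsymm]
      intro w σ
      simp only [weight_comp_perm]
  -- Words with `a > 0` fields of sign `+` and `b > 0` of sign `-`: both homotopies can be used. On
  -- the words with fields of one sign only, `(a * b)⁻¹` is zero.
  let f₀ : ℤ → ℤ → ℂ := fun a b => ((a : ℂ) * b)⁻¹
  let A₀ := scale (fun w => f₀ (weight (signWeight Sgn.plus) w) (weight (signWeight Sgn.minus) w)) A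
  let T₀ := oddDer X (homotopyKernel Sgn.minus) (oddDer X (homotopyKernel Sgn.plus) A₀)
  have hT₀ : ∀ w, T₀ w ≠ 0 → weight Letter.fermionNumber w = 2 := fun w hw =>
    weight_eq_of_oddDer_ne_zero X fermionNumber_of_homotopyKernel_ne_zero
      (weight_eq_of_oddDer_ne_zero X fermionNumber_of_homotopyKernel_ne_zero
        fun w hw => hfermion w (scale_ne_zero hw).1) w hw
  have hmixed : oddDer X (susyKernel Sgn.minus) (oddDer X (susyKernel Sgn.plus) T₀)
      = -scale (fun w => (fun a b : ℤ => (a : ℂ) * b * ((a : ℂ) * b)⁻¹)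
          (weight (signWeight Sgn.plus) w) (weight (signWeight Sgn.minus) w)) A := by
    have h1 : oddDer X (susyKernel Sgn.plus) T₀ = -oddDer X (homotopyKernel Sgn.minus)
        (scale (fun w => (fun a b : ℤ => (a : ℂ) * f₀ a b)
          (weight (signWeight Sgn.plus) w) (weight (signWeight Sgn.minus) w)) A) := by
      have h2 := oddDer_susy_opp_homotopy hX Sgn.minus (oddDer X (homotopyKernel Sgn.plus) A₀)
      rw [Sgn.opp, oddDer_susy_homotopy hX (hclosed f₀ Sgn.plus)] at h2
      rw [h2]
      congr 2
      funext w
      simp only [scale, smul_smul]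
    rw [h1, map_neg, oddDer_susy_homotopy hX (hclosed (fun a b => (a : ℂ) * f₀ a b) Sgn.minus)]
    congr 1
    funext w
    simp only [scale, smul_smul, f₀]
    congr 1
    ring
  -- Words with fields of one sign only.
  let f₁ : ℤ → ℤ → ℂ := fun _ b => if b = 0 then ((k : ℂ) + 1)⁻¹ else 0
  let f₂ : ℤ → ℤ → ℂ := fun a _ => if a = 0 then ((k : ℂ) + 1)⁻¹ else 0
  obtain ⟨T₁, K₁, hT₁, hK₁, hK₁symm, hK₁closed, h₁⟩ := exists_decomposition_of_sign hX U hU hUX hρ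
    Sgn.plus (hclosed f₁) (hinv f₁) (fun w hw => hfermion w (scale_ne_zero hw).1) (fun w hw => by
      have h := (scale_ne_zero hw).2
      simp only [f₁] at h
      by_contra hne
      exact h (if_neg hne))
  obtain ⟨T₂, K₂, hT₂, hK₂, hK₂symm, hK₂closed, h₂⟩ := exists_decomposition_of_sign hX U hU hUX hρ
    Sgn.minus (hclosed f₂) (hinv f₂) (fun w hw => hfermion w (scale_ne_zero hw).1) (fun w hw => by
      have h := (scale_ne_zero hw).2
      simp only [f₂] at h
      by_contra hne
      exact h (if_neg hne))
  refine ⟨-T₀ - T₁ + T₂, fun s => match s with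
    | Sgn.plus => K₁
    | Sgn.minus => K₂, fun w hw => ?_, fun s => ?_, fun s => ?_, fun s => ?_, ?_⟩
  · by_contra hne
    refine hw ?_
    rw [Pi.add_apply, Pi.sub_apply, Pi.neg_apply, by_contra fun h => hne (hT₀ w h),
      by_contra fun h => hne (hT₁ w h), by_contra fun h => hne (hT₂ w h)]
    simp
  · cases s
    · exact hK₁
    · exact hK₂
  · cases s
    · exact hK₁symm
    · exact hK₂symm
  · cases s
    · exact hK₁closed
    · exact hK₂closed
  · have h₁' : oddDer X (susyKernel Sgn.plus) K₁
        = ((k : ℂ) + 1) • scale (fun w => f₁ (weight (signWeight Sgn.plus) w)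
            (weight (signWeight Sgn.minus) w)) A
          + oddDer X (susyKernel Sgn.minus) (oddDer X (susyKernel Sgn.plus) T₁) := by
      rw [h₁, oddDer_susy_anticomm hX Sgn.minus Sgn.plus]
      exact (add_neg_cancel_right _ _).symm
    have h₂' : oddDer X (susyKernel Sgn.minus) K₂
        = ((k : ℂ) + 1) • scale (fun w => f₂ (weight (signWeight Sgn.plus) w)
            (weight (signWeight Sgn.minus) w)) A
          - oddDer X (susyKernel Sgn.minus) (oddDer X (susyKernel Sgn.plus) T₂) := by
      rw [h₂]
      exact (add_sub_cancel_right _ _).symm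
    simp only [h₁', h₂', map_add, map_sub, map_neg, hmixed]
    have hA' : A = scale (fun w => (fun a b : ℤ => (a : ℂ) * b * ((a : ℂ) * b)⁻¹)
          (weight (signWeight Sgn.plus) w) (weight (signWeight Sgn.minus) w)) A
        + ((k : ℂ) + 1) • scale (fun w => f₁ (weight (signWeight Sgn.plus) w)
            (weight (signWeight Sgn.minus) w)) A
        + ((k : ℂ) + 1) • scale (fun w => f₂ (weight (signWeight Sgn.plus) w)
            (weight (signWeight Sgn.minus) w)) A := by
      funext w
      have hw := weight_signWeight_add Sgn.plus w
      rw [Sgn.opp] at hw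
      simp only [scale, Pi.add_apply, Pi.smul_apply, smul_smul, ← add_smul, f₁, f₂]
      generalize weight (signWeight Sgn.plus) w = a at hw
      generalize weight (signWeight Sgn.minus) w = b at hw
      conv_lhs => rw [← one_smul ℂ (A w)]
      congr 1
      by_cases ha : a = 0
      · have hb : b ≠ 0 := by omega
        simp [ha, hb, hk]
      · by_cases hb : b = 0
        · simp [ha, hb, hk]
        · have ha' : (a : ℂ) ≠ 0 := by exact_mod_cast ha
          have hb' : (b : ℂ) ≠ 0 := by exact_mod_cast hb
          simp only [ha, hb, if_false, mul_zero, add_zero, mul_inv_cancel₀ (mul_ne_zero ha' hb')]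
    conv_lhs => rw [hA']
    abel

end Decomposition

/-! ### Operators on translationally invariant local coefficients -/

section Coefficients

variable {k : ℕ}

theorem IsTILC.add {f g : (Fin (k + 1) → ℤ) → ℂ} (hf : IsTILC f) (hg : IsTILC g) :
    IsTILC (f + g) := by
  obtain ⟨hf, L₁, M₁, hL₁, hM₁, h₁⟩ := hf
  obtain ⟨hg, L₂, M₂, hL₂, hM₂, h₂⟩ := hg
  refine ⟨fun m => by rw [Pi.add_apply, Pi.add_apply, hf, hg], L₁ + L₂, min M₁ M₂,
    add_pos hL₁ hL₂, lt_min hM₁ hM₂, fun m l => ?_⟩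
  rw [add_mul]
  refine (norm_add_le _ _).trans (add_le_add ((h₁ m l).trans ?_) ((h₂ m l).trans ?_)) <;> gcongr
  · exact min_le_left _ _
  · exact min_le_right _ _

theorem IsTILC.smul (c : ℂ) {f : (Fin (k + 1) → ℤ) → ℂ} (hf : IsTILC f) : IsTILC (c • f) := by
  obtain ⟨hf, L, M, hL, hM, h⟩ := hf
  refine ⟨fun m => by rw [Pi.smul_apply, Pi.smul_apply, hf], (‖c‖ + 1) * L, M, by positivity, hM,
    fun m l => ?_⟩
  rw [Pi.smul_apply, norm_smul, mul_assoc]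
  exact mul_le_mul (by linarith) (h m l) (norm_nonneg _) (by positivity)

theorem isTILC_zero : IsTILC (0 : (Fin (k + 1) → ℤ) → ℂ) :=
  ⟨fun _ => rfl, 1, 1, one_pos, one_pos, fun m l => by
    rw [Pi.zero_apply, norm_zero]
    positivity⟩

/-- The vector space of the translationally invariant local coefficients with `k + 1` indices. -/
def tilc (k : ℕ) : Submodule ℂ ((Fin (k + 1) → ℤ) → ℂ) where
  carrier := {f | IsTILC f}
  add_mem' := IsTILC.add
  zero_mem' := isTILC_zero
  smul_mem' := fun c _ hf => hf.smul c

/-- A TILC decays exponentially in the sum of two distances. -/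
theorem exists_norm_le_of_isTILC {f : (Fin (k + 1) → ℤ) → ℂ} (hf : IsTILC f) :
    ∃ L M : ℝ, 0 < L ∧ 0 < M ∧ ∀ m a b, ‖f m‖ ≤ L *
      Real.exp (-(M * (|((m 0 - m a : ℤ) : ℝ)| + |((m 0 - m b : ℤ) : ℝ)|))) := by
  obtain ⟨-, L, M, hL, hM, h⟩ := hf
  refine ⟨L, M / 2, hL, by positivity, fun m a b => ?_⟩
  rcases le_total |((m 0 - m a : ℤ) : ℝ)| |((m 0 - m b : ℤ) : ℝ)| with hab | hab
  · refine (h m b).trans ?_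
    gcongr L * Real.exp ?_
    nlinarith
  · refine (h m a).trans ?_
    gcongr L * Real.exp ?_
    nlinarith

/-- The sum over the site at position `i` with the weight `κ`. -/
noncomputable def siteSum (i : Fin (k + 1)) (κ : (Fin (k + 1) → ℤ) → ℤ → ℂ)
    (f : (Fin (k + 1) → ℤ) → ℂ) : (Fin (k + 1) → ℤ) → ℂ :=
  fun n => ∑' l, f (Function.update n i l) * κ n l

/-- The weights for which the sum over the site at position `i` converges and leads from TILC to
TILC. -/
def IsSiteKernel (i : Fin (k + 1)) (κ : (Fin (k + 1) → ℤ) → ℤ → ℂ) : Prop :=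
  ∀ f, IsTILC f →
    (∀ n, Summable fun l => f (Function.update n i l) * κ n l) ∧ IsTILC (siteSum i κ f)

/-- The sum over the site at position `i`, as an operator on TILC. -/
noncomputable def siteOp {i : Fin (k + 1)} {κ : (Fin (k + 1) → ℤ) → ℤ → ℂ}
    (h : IsSiteKernel i κ) : Module.End ℂ (tilc k) where
  toFun f := ⟨siteSum i κ f, (h f f.2).2⟩
  map_add' f g := by
    ext n
    simp only [siteSum, Submodule.coe_add, Pi.add_apply, add_mul]
    exact ((h f f.2).1 n).tsum_add ((h g g.2).1 n)
  map_smul' c f := by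
    ext n
    simp only [siteSum, Submodule.coe_smul, Pi.smul_apply, smul_eq_mul, mul_assoc,
      RingHom.id_apply]
    exact tsum_mul_left

theorem siteOp_apply {i : Fin (k + 1)} {κ : (Fin (k + 1) → ℤ) → ℤ → ℂ} (h : IsSiteKernel i κ)
    (f : tilc k) (n : Fin (k + 1) → ℤ) :
    (siteOp h f : (Fin (k + 1) → ℤ) → ℂ) n = ∑' l, (f : (Fin (k + 1) → ℤ) → ℂ)
      (Function.update n i l) * κ n l := rfl

/-- A criterion for weights to lead from TILC to TILC. -/
theorem isSiteKernel_of_bound {i : Fin (k + 1)} {κ : (Fin (k + 1) → ℤ) → ℤ → ℂ}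
    (hκ : ∀ n l, κ (fun j => n j + 1) (l + 1) = κ n l)
    (h : ∀ f, IsTILC f → ∃ (L M : ℝ) (g : ℤ → ℝ) (c : (Fin (k + 1) → ℤ) → ℤ),
      0 < L ∧ 0 < M ∧ Summable g ∧ (∀ l, 0 ≤ g l) ∧ ∀ n l a,
        ‖f (Function.update n i l) * κ n l‖
          ≤ L * Real.exp (-(M * |((n 0 - n a : ℤ) : ℝ)|)) * g (l - c n)) :
    IsSiteKernel i κ := by
  intro f hf
  obtain ⟨L, M, g, c, hL, hM, hg, hg0, hbound⟩ := h f hf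
  have hsum : ∀ n, HasSum (fun l => g (l - c n)) (∑' l, g l) := fun n =>
    ((Equiv.subRight (c n)).hasSum_iff (f := g)).2 hg.hasSum
  refine ⟨fun n => Summable.of_norm_bounded ((hsum n).summable.mul_left _) (fun l => hbound n l 0),
    fun n => ?_, L * (∑' l, g l + 1), M, mul_pos hL (add_pos_of_nonneg_of_pos (tsum_nonneg hg0)
      one_pos), hM, fun n a => ?_⟩
  · unfold siteSum
    rw [← (Equiv.addRight (1 : ℤ)).tsum_eq]
    refine tsum_congr fun l => ?_
    rw [Equiv.coe_addRight, hκ, ← hf.1 (Function.update n i l)]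
    congr 2
    funext j
    by_cases hj : j = i
    · subst hj
      simp
    · simp [hj]
  · refine (tsum_of_norm_bounded ((hsum n).mul_left _) fun l => hbound n l a).trans ?_
    rw [mul_right_comm]
    gcongr
    linarith

section Convolution

variable {D : ℤ → ℂ}

/-- The exponential decay of a local difference operator. -/
def HasExpDecay (D : ℤ → ℂ) : Prop :=
  ∃ L M : ℝ, 0 < L ∧ 0 < M ∧ ∀ k : ℤ, ‖D k‖ ≤ L * Real.exp (-(M * |(k : ℝ)|))

theorem HasExpDecay.summable_norm (hD : HasExpDecay D) : Summable fun k => ‖D k‖ := by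
  obtain ⟨L, M, hL, hM, h⟩ := hD
  exact Summable.of_nonneg_of_le (fun _ => norm_nonneg _) h
    ((summable_exp_neg_mul_abs hM).mul_left L)

theorem isSiteKernel_conv (hD : HasExpDecay D) (i : Fin (k + 1)) :
    IsSiteKernel i fun n l => D (l - n i) := by
  refine isSiteKernel_of_bound (fun n l => by simp) fun f hf => ?_
  obtain ⟨-, L, M, hL, hM, h⟩ := hf
  obtain ⟨L', M', hL', hM', h'⟩ := hD
  refine ⟨L * L', min M (M' / 2), fun l => Real.exp (-(M' / 2 * |(l : ℝ)|)), fun n => n i,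
    by positivity, lt_min hM (by positivity), summable_exp_neg_mul_abs (by positivity),
    fun _ => Real.exp_nonneg _, fun n l a => ?_⟩
  have htri : |((n 0 - n a : ℤ) : ℝ)| ≤
      |((Function.update n i l 0 - Function.update n i l a : ℤ) : ℝ)| + |((l - n i : ℤ) : ℝ)| := by
    by_cases h0 : i = 0
    · by_cases ha : i = a
      · have : a = 0 := by rw [← ha, h0]
        subst this
        simp only [sub_self, Int.cast_zero, abs_zero]
        positivity
      · subst h0
        rw [Function.update_self, Function.update_of_ne (Ne.symm ha)]
        have := abs_sub_le (n 0 : ℝ) l (n a)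
        rw [abs_sub_comm (n 0 : ℝ) l] at this
        push_cast
        linarith
    · rw [Function.update_of_ne (Ne.symm h0)]
      by_cases ha : i = a
      · subst ha
        rw [Function.update_self]
        exact_mod_cast abs_sub_le (n 0 : ℝ) l (n i)
      · rw [Function.update_of_ne (Ne.symm ha)]
        linarith [abs_nonneg ((l - n i : ℤ) : ℝ)]
  have hb := h (Function.update n i l) a
  have hx0 : 0 ≤ |((Function.update n i l 0 - Function.update n i l a : ℤ) : ℝ)| := abs_nonneg _
  generalize |((Function.update n i l 0 - Function.update n i l a : ℤ) : ℝ)| = x at hb htri hx0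
  have hx : 0 ≤ |((n 0 - n a : ℤ) : ℝ)| := abs_nonneg _
  calc ‖f (Function.update n i l) * D (l - n i)‖
      ≤ (L * Real.exp (-(M * x))) * (L' * Real.exp (-(M' * |((l - n i : ℤ) : ℝ)|))) := by
        rw [norm_mul]
        exact mul_le_mul hb (h' _) (norm_nonneg _) (by positivity)
    _ = L * L' * Real.exp (-(M * x) + -(M' * |((l - n i : ℤ) : ℝ)|)) := by
        rw [Real.exp_add]
        ring
    _ ≤ L * L' * Real.exp (-(min M (M' / 2) * |((n 0 - n a : ℤ) : ℝ)|)
          + -(M' / 2 * |((l - n i : ℤ) : ℝ)|)) := by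
        gcongr ?_ * Real.exp ?_
        have hy : 0 ≤ |((l - n i : ℤ) : ℝ)| := abs_nonneg _
        generalize |((l - n i : ℤ) : ℝ)| = y at htri hy
        generalize |((n 0 - n a : ℤ) : ℝ)| = z at htri hx
        have h1 := min_le_left M (M' / 2)
        have h2 := min_le_right M (M' / 2)
        have h3 : 0 < min M (M' / 2) := lt_min hM (by positivity)
        generalize min M (M' / 2) = μ at h1 h2 h3
        nlinarith [mul_le_mul_of_nonneg_left htri h3.le, mul_le_mul_of_nonneg_right h1 hx0,
          mul_le_mul_of_nonneg_right h2 hy]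
    _ = _ := by
        rw [Real.exp_add]
        ring

/-- The difference operator in the `i`-th lattice site. -/
noncomputable def conv (hD : HasExpDecay D) (i : Fin (k + 1)) : Module.End ℂ (tilc k) :=
  siteOp (isSiteKernel_conv hD i)

theorem isTILC_norm_bounded {f : (Fin (k + 1) → ℤ) → ℂ} (hf : IsTILC f) :
    ∃ L, 0 < L ∧ ∀ m, ‖f m‖ ≤ L := by
  obtain ⟨-, L, M, hL, hM, h⟩ := hf
  exact ⟨L, hL, fun m => by simpa using h m 0⟩

theorem summable_conv_conv (hD : HasExpDecay D) {f : (Fin (k + 1) → ℤ) → ℂ} (hf : IsTILC f)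
    (u : ℤ → ℤ → (Fin (k + 1) → ℤ)) (a b : ℤ) :
    Summable (Function.uncurry fun l l' => f (u l l') * D (l' - b) * D (l - a)) := by
  obtain ⟨L, hL, h⟩ := isTILC_norm_bounded hf
  have h1 := hD.summable_norm
  have h2 := ((Equiv.subRight a).summable_iff (f := fun k => ‖D k‖)).2 h1
  have h3 := ((Equiv.subRight b).summable_iff (f := fun k => ‖D k‖)).2 h1
  refine Summable.of_norm_bounded ((h2.mul_of_nonneg h3 (fun _ => norm_nonneg _)
    (fun _ => norm_nonneg _)).mul_left L) ?_
  rintro ⟨l, l'⟩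
  simp only [Function.uncurry, Function.comp_apply, Equiv.subRight_apply, norm_mul]
  rw [mul_assoc, mul_comm ‖D (l' - b)‖]
  exact mul_le_mul_of_nonneg_right (h _) (by positivity)

theorem commute_conv (hD : HasExpDecay D) (i j : Fin (k + 1)) :
    Commute (conv hD i) (conv hD j) := by
  by_cases hij : i = j
  · subst hij
    exact Commute.refl _
  refine LinearMap.ext fun f => Subtype.ext (funext fun n => ?_)
  simp only [Module.End.mul_apply, conv, siteOp_apply, Function.update_of_ne hij,
    Function.update_of_ne (Ne.symm hij), ← tsum_mul_right]
  rw [← (summable_conv_conv hD f.2 (fun l l' => Function.update (Function.update n i l) j l') (n i)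
    (n j)).tsum_comm]
  refine tsum_congr fun l => tsum_congr fun l' => ?_
  rw [Function.update_comm (Ne.symm hij)]
  ring

/-- The action of permutations of the lattice sites. -/
def permute : Equiv.Perm (Fin (k + 1)) →* Module.End ℂ (tilc k) where
  toFun σ :=
    { toFun := fun f => ⟨fun n => (f : (Fin (k + 1) → ℤ) → ℂ) (n ∘ σ), by
        obtain ⟨L, M, hL, hM, h⟩ := exists_norm_le_of_isTILC f.2
        refine ⟨fun n => f.2.1 (n ∘ σ), L, M, hL, hM, fun n l =>
          (h _ (σ.symm 0) (σ.symm l)).trans ?_⟩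
        simp only [Function.comp_apply, Equiv.apply_symm_apply]
        have h1 := abs_sub_le (n 0 : ℝ) (n (σ 0)) (n l)
        rw [abs_sub_comm (n 0 : ℝ) (n (σ 0))] at h1
        gcongr
        push_cast
        exact h1⟩
      map_add' := fun f g => rfl
      map_smul' := fun c f => rfl }
  map_one' := rfl
  map_mul' σ τ := rfl

theorem permute_apply (σ : Equiv.Perm (Fin (k + 1))) (f : tilc k) (n : Fin (k + 1) → ℤ) :
    (permute σ f : (Fin (k + 1) → ℤ) → ℂ) n = (f : (Fin (k + 1) → ℤ) → ℂ) (n ∘ σ) := rfl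

theorem conv_mul_permute (hD : HasExpDecay D) (σ : Equiv.Perm (Fin (k + 1))) (i : Fin (k + 1)) :
    conv hD (σ i) * permute σ = permute σ * conv hD i := by
  refine LinearMap.ext fun f => Subtype.ext (funext fun n => ?_)
  simp only [Module.End.mul_apply, conv, siteOp_apply, permute_apply, update_comp_perm]
  rfl

end Convolution

section LeftInverse

variable {D : ℤ → ℂ} {G : ℤ → ℤ → ℂ} {ε₀ : ℝ}

/-- The bounds satisfied by the left inverse of the convolution: it preserves any sufficiently small
rate of exponential decay. -/
def IsTame (G : ℤ → ℤ → ℂ) : Prop :=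
  ∃ ε₀ : ℝ, 0 < ε₀ ∧ ∀ ε, 0 < ε → ε < ε₀ → ∃ B, 0 ≤ B ∧
    ∀ a l : ℤ, ‖G a l‖ ≤ B * Real.exp (-(ε * |(a : ℝ)|) + ε * |(l : ℝ)|)

theorem isSiteKernel_relative (hG : IsTame G) {i : Fin (k + 1)} (hi : i ≠ 0) :
    IsSiteKernel i fun n l => G (n i - n 0) (l - n 0) := by
  refine isSiteKernel_of_bound (fun n l => by simp) fun f hf => ?_
  obtain ⟨L, M, hL, hM, h⟩ := exists_norm_le_of_isTILC hf
  obtain ⟨ε₀, hε₀, hG⟩ := hG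
  have hε : 0 < min (ε₀ / 2) (M / 2) := lt_min (by positivity) (by positivity)
  obtain ⟨B, hB, hGB⟩ := hG (min (ε₀ / 2) (M / 2)) hε
    ((min_le_left _ _).trans_lt (by linarith))
  have hεM : min (ε₀ / 2) (M / 2) ≤ M / 2 := min_le_right _ _
  generalize min (ε₀ / 2) (M / 2) = ε at hε hGB hεM
  refine ⟨L * (B + 1), ε, fun l => Real.exp (-(M / 2 * |(l : ℝ)|)), fun n => n 0, by positivity, hε,
    summable_exp_neg_mul_abs (by positivity), fun _ => Real.exp_nonneg _, fun n l a => ?_⟩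
  have hb := h (Function.update n i l) i a
  rw [Function.update_of_ne (Ne.symm hi), Function.update_self] at hb
  have e1 : |((n 0 - l : ℤ) : ℝ)| = |((l - n 0 : ℤ) : ℝ)| := by
    push_cast
    exact abs_sub_comm _ _
  have e2 : |((n i - n 0 : ℤ) : ℝ)| = |((n 0 - n i : ℤ) : ℝ)| := by
    push_cast
    exact abs_sub_comm _ _
  have hg := hGB (n i - n 0) (l - n 0)
  rw [e1] at hb
  rw [e2] at hg
  have hy : 0 ≤ |((l - n 0 : ℤ) : ℝ)| := abs_nonneg _
  calc ‖f (Function.update n i l) * G (n i - n 0) (l - n 0)‖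
      ≤ (L * Real.exp (-(M * (|((l - n 0 : ℤ) : ℝ)|
          + |((n 0 - Function.update n i l a : ℤ) : ℝ)|))))
        * ((B + 1) * Real.exp (-(ε * |((n 0 - n i : ℤ) : ℝ)|) + ε * |((l - n 0 : ℤ) : ℝ)|)) := by
        rw [norm_mul]
        refine mul_le_mul hb (hg.trans ?_) (norm_nonneg _) (by positivity)
        gcongr
        linarith
    _ = L * (B + 1) * Real.exp (-(M * (|((l - n 0 : ℤ) : ℝ)|
          + |((n 0 - Function.update n i l a : ℤ) : ℝ)|))
          + (-(ε * |((n 0 - n i : ℤ) : ℝ)|) + ε * |((l - n 0 : ℤ) : ℝ)|)) := by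
        rw [mul_mul_mul_comm, ← Real.exp_add]
    _ ≤ L * (B + 1) * Real.exp (-(ε * |((n 0 - n a : ℤ) : ℝ)|)
          + -(M / 2 * |((l - n 0 : ℤ) : ℝ)|)) := by
        gcongr ?_ * Real.exp ?_
        by_cases ha : a = i
        · subst ha
          rw [Function.update_self, e1]
          nlinarith [abs_nonneg ((n 0 - n a : ℤ) : ℝ)]
        · rw [Function.update_of_ne ha]
          have h1 : 0 ≤ |((n 0 - n a : ℤ) : ℝ)| := abs_nonneg _
          have h2 : 0 ≤ |((n 0 - n i : ℤ) : ℝ)| := abs_nonneg _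
          generalize |((n 0 - n a : ℤ) : ℝ)| = p at h1
          generalize |((n 0 - n i : ℤ) : ℝ)| = q at h2
          generalize |((l - n 0 : ℤ) : ℝ)| = y at hy
          nlinarith [mul_nonneg hε.le h2, mul_le_mul_of_nonneg_right hεM h1,
            mul_le_mul_of_nonneg_right hεM hy, mul_nonneg hM.le h1]
    _ = _ := by
        rw [Real.exp_add]
        ring

/-- The left inverse of the difference operator in the `i`-th lattice site. The kernel `G` singles
out an origin; it is put at the zeroth site, so that the result is translationally invariant. The
price is that `leftInv hG i` does not commute with the difference operator in the zeroth site. For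
`i = 0` the value is zero by convention. -/
noncomputable def leftInv (hG : IsTame G) (i : Fin (k + 1)) : Module.End ℂ (tilc k) :=
  if hi : i ≠ 0 then siteOp (isSiteKernel_relative hG hi) else 0

theorem leftInv_conv_of_ne (hD : HasExpDecay D) (hG : IsTame G) {i j : Fin (k + 1)} (hi : i ≠ 0)
    (hji : j ≠ i) (hj : j ≠ 0) (f : tilc k) :
    leftInv hG i (conv hD j f) = conv hD j (leftInv hG i f) := by
  refine Subtype.ext (funext fun n => ?_)
  simp only [leftInv, dif_pos hi, conv, siteOp_apply, Function.update_of_ne hji,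
    Function.update_of_ne (Ne.symm hji), Function.update_of_ne (Ne.symm hj), ← tsum_mul_right]
  have hsum : Summable (Function.uncurry fun l l' =>
      (f : (Fin (k + 1) → ℤ) → ℂ) (Function.update (Function.update n i l) j l') * D (l' - n j)
        * G (n i - n 0) (l - n 0)) := by
    obtain ⟨L, M, hL, hM, h⟩ := exists_norm_le_of_isTILC f.2
    obtain ⟨ε₀, hε₀, hG⟩ := hG
    have hε : 0 < min (ε₀ / 2) (M / 2) := lt_min (by positivity) (by positivity)
    obtain ⟨B, hB, hGB⟩ := hG (min (ε₀ / 2) (M / 2)) hε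
      ((min_le_left _ _).trans_lt (by linarith))
    have hεM : min (ε₀ / 2) (M / 2) ≤ M / 2 := min_le_right _ _
    generalize min (ε₀ / 2) (M / 2) = ε at hε hGB hεM
    have h2 := ((Equiv.subRight (n 0)).summable_iff).2
      (summable_exp_neg_mul_abs (half_pos hM))
    have h3 := ((Equiv.subRight (n j)).summable_iff (f := fun k => ‖D k‖)).2 hD.summable_norm
    refine Summable.of_norm_bounded ((h2.mul_of_nonneg h3 (fun _ => Real.exp_nonneg _)
      (fun _ => norm_nonneg _)).mul_left (L * B)) ?_
    rintro ⟨l, l'⟩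
    simp only [Function.uncurry, Function.comp_apply, Equiv.subRight_apply, norm_mul]
    have hb := h (Function.update (Function.update n i l) j l') i i
    rw [Function.update_of_ne (Ne.symm hj), Function.update_of_ne (Ne.symm hi),
      Function.update_of_ne (Ne.symm hji), Function.update_self] at hb
    have e1 : |((n 0 - l : ℤ) : ℝ)| = |((l - n 0 : ℤ) : ℝ)| := by
      push_cast
      exact abs_sub_comm _ _
    rw [e1] at hb
    have hy : 0 ≤ |((l - n 0 : ℤ) : ℝ)| := abs_nonneg _
    have hz : 0 ≤ |((n i - n 0 : ℤ) : ℝ)| := abs_nonneg _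
    have hg := hGB (n i - n 0) (l - n 0)
    rw [mul_right_comm, ← mul_assoc]
    refine mul_le_mul_of_nonneg_right ?_ (norm_nonneg _)
    refine (mul_le_mul hb hg (norm_nonneg _) (by positivity)).trans ?_
    rw [mul_mul_mul_comm, ← Real.exp_add]
    gcongr
    nlinarith [mul_nonneg hε.le hz]
  rw [← hsum.tsum_comm]
  refine tsum_congr fun l => tsum_congr fun l' => ?_
  rw [Function.update_comm hji]
  ring

theorem leftInv_conv_self (hD : HasExpDecay D) (hG : IsTame G)
    (hGD : ∀ a b : ℤ, ∑' l, G a l * D (b - l) = if b = a then 1 else 0) {i : Fin (k + 1)}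
    (hi : i ≠ 0) (f : tilc k) : leftInv hG i (conv hD i f) = f := by
  refine Subtype.ext (funext fun n => ?_)
  simp only [leftInv, dif_pos hi, conv, siteOp_apply, Function.update_idem, Function.update_self,
    ← tsum_mul_right]
  have hsum : Summable (Function.uncurry fun l l' =>
      (f : (Fin (k + 1) → ℤ) → ℂ) (Function.update n i l') * D (l' - l)
        * G (n i - n 0) (l - n 0)) := by
    obtain ⟨L, M, hL, hM, h⟩ := exists_norm_le_of_isTILC f.2
    obtain ⟨L', M', hL', hM', h'⟩ := hD
    obtain ⟨ε₀, hε₀, hG⟩ := hG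
    have hε : 0 < min (ε₀ / 2) (min (M / 2) (M' / 2)) :=
      lt_min (by positivity) (lt_min (by positivity) (by positivity))
    obtain ⟨B, hB, hGB⟩ := hG (min (ε₀ / 2) (min (M / 2) (M' / 2))) hε
      ((min_le_left _ _).trans_lt (by linarith))
    have hεM : min (ε₀ / 2) (min (M / 2) (M' / 2)) ≤ M / 2 :=
      (min_le_right _ _).trans (min_le_left _ _)
    have hεM' : min (ε₀ / 2) (min (M / 2) (M' / 2)) ≤ M' / 2 :=
      (min_le_right _ _).trans (min_le_right _ _)
    generalize min (ε₀ / 2) (min (M / 2) (M' / 2)) = ε at hε hGB hεM hεM'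
    -- The bound is a product in the variables `l' - n 0` and `l' - l`.
    have h2 := ((Equiv.subRight (n 0)).summable_iff).2 (summable_exp_neg_mul_abs (half_pos hM))
    have h3 := (h2.mul_of_nonneg (summable_exp_neg_mul_abs (half_pos hM'))
      (fun _ => Real.exp_nonneg _) (fun _ => Real.exp_nonneg _)).mul_left (L * L' * B)
    let e : ℤ × ℤ ≃ ℤ × ℤ :=
      { toFun := fun p => (p.2, p.2 - p.1)
        invFun := fun p => (p.1 - p.2, p.1)
        left_inv := fun p => by simp
        right_inv := fun p => by simp }
    refine Summable.of_norm_bounded ((e.summable_iff).2 h3) ?_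
    rintro ⟨l, l'⟩
    simp only [Function.uncurry, Function.comp_apply, Equiv.subRight_apply, norm_mul, e,
      Equiv.coe_fn_mk]
    have hb := h (Function.update n i l') i i
    rw [Function.update_of_ne (Ne.symm hi), Function.update_self] at hb
    have e1 : |((n 0 - l' : ℤ) : ℝ)| = |((l' - n 0 : ℤ) : ℝ)| := by
      push_cast
      exact abs_sub_comm _ _
    rw [e1] at hb
    have htri : |((l - n 0 : ℤ) : ℝ)| ≤ |((l' - n 0 : ℤ) : ℝ)| + |((l' - l : ℤ) : ℝ)| := by
      have := abs_sub_le (l : ℝ) l' (n 0)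
      rw [abs_sub_comm (l : ℝ) l'] at this
      push_cast
      linarith
    have hx : 0 ≤ |((l' - n 0 : ℤ) : ℝ)| := abs_nonneg _
    have hy : 0 ≤ |((l' - l : ℤ) : ℝ)| := abs_nonneg _
    have hz : 0 ≤ |((n i - n 0 : ℤ) : ℝ)| := abs_nonneg _
    refine (mul_le_mul (mul_le_mul hb (h' _) (norm_nonneg _) (by positivity))
      (hGB (n i - n 0) (l - n 0)) (norm_nonneg _) (by positivity)).trans ?_
    have hexp : ∀ x y z : ℝ, L * Real.exp x * (L' * Real.exp y) * (B * Real.exp z)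
        = L * L' * B * Real.exp (x + y + z) := fun x y z => by
      rw [Real.exp_add, Real.exp_add]
      ring
    rw [hexp, ← Real.exp_add]
    gcongr ?_ * Real.exp ?_
    generalize |((l' - n 0 : ℤ) : ℝ)| = x at *
    generalize |((l' - l : ℤ) : ℝ)| = y at *
    nlinarith [mul_nonneg hε.le hz, mul_le_mul_of_nonneg_left htri hε.le,
      mul_le_mul_of_nonneg_right hεM hx, mul_le_mul_of_nonneg_right hεM' hy, mul_nonneg hM.le hx]
  rw [← hsum.tsum_comm]
  have hinner : ∀ l', ∑' l, (f : (Fin (k + 1) → ℤ) → ℂ) (Function.update n i l') * D (l' - l)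
      * G (n i - n 0) (l - n 0)
      = if l' = n i then (f : (Fin (k + 1) → ℤ) → ℂ) n else 0 := by
    intro l'
    have h1 := hGD (n i - n 0) (l' - n 0)
    rw [← (Equiv.subRight (n 0)).tsum_eq] at h1
    simp only [Equiv.subRight_apply, sub_sub_sub_cancel_right, sub_left_inj] at h1
    rw [tsum_congr fun l => show _ = (f : (Fin (k + 1) → ℤ) → ℂ) (Function.update n i l')
      * (G (n i - n 0) (l - n 0) * D (l' - l)) by ring, tsum_mul_left, h1]
    split_ifs with h
    · rw [h, Function.update_eq_self, mul_one]
    · rw [mul_zero]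
  simp only [hinner]
  exact tsum_ite_eq _ _

end LeftInverse

end Coefficients

/-! ### Expansion of functionals of superfields -/

section Theta

namespace Theta

variable {M : Type} [AddCommGroup M]

theorem add_one' (x y : Theta M) : (x + y).one = x.one + y.one := rfl
theorem add_tp (x y : Theta M) : (x + y).tp = x.tp + y.tp := rfl
theorem add_tm (x y : Theta M) : (x + y).tm = x.tm + y.tm := rfl
theorem add_tpm (x y : Theta M) : (x + y).tpm = x.tpm + y.tpm := rfl
variable [Module ℂ M]

theorem smul_one' (c : ℂ) (x : Theta M) : (c • x).one = c • x.one := rfl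
theorem smul_tp (c : ℂ) (x : Theta M) : (c • x).tp = c • x.tp := rfl
theorem smul_tm (c : ℂ) (x : Theta M) : (c • x).tm = c • x.tm := rfl
theorem smul_tpm (c : ℂ) (x : Theta M) : (c • x).tpm = c • x.tpm := rfl

theorem involute_iterate (p : ℕ) (x : Theta ℂ) :
    involute^[p] x = ⟨x.one, (-1) ^ p * x.tp, (-1) ^ p * x.tm, x.tpm⟩ := by
  induction p with
  | zero => simp
  | succ p ih =>
    rw [Function.iterate_succ_apply', ih, involute, pow_succ]
    simp

theorem mul_one' (x y : Theta ℂ) : (x * y).one = x.one * y.one := rfl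
theorem mul_tp (x y : Theta ℂ) : (x * y).tp = x.one * y.tp + x.tp * y.one := rfl
theorem mul_tm (x y : Theta ℂ) : (x * y).tm = x.one * y.tm + x.tm * y.one := rfl
theorem mul_tpm (x y : Theta ℂ) : (x * y).tpm
    = x.one * y.tpm + x.tp * y.tm - x.tm * y.tp + x.tpm * y.one := rfl

theorem prod_one {d : ℕ} (x : Fin d → Theta ℂ) : (List.ofFn x).prod.one = ∏ i, (x i).one := by
  induction d with
  | zero => rfl
  | succ d ih =>
    rw [List.ofFn_succ, List.prod_cons, mul_one', ih, Fin.prod_univ_succ]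

theorem prod_tp {d : ℕ} (x : Fin d → Theta ℂ) :
    (List.ofFn x).prod.tp = ∑ i, ∏ j, if j = i then (x j).tp else (x j).one := by
  induction d with
  | zero => rfl
  | succ d ih =>
    rw [List.ofFn_succ, List.prod_cons, mul_tp, ih, prod_one, Fin.sum_univ_succ, add_comm,
      Finset.mul_sum]
    simp only [Fin.prod_univ_succ, Fin.succ_ne_zero, if_true, if_false, Fin.succ_inj,
      (Fin.succ_ne_zero _).symm]

theorem prod_tm {d : ℕ} (x : Fin d → Theta ℂ) :
    (List.ofFn x).prod.tm = ∑ i, ∏ j, if j = i then (x j).tm else (x j).one := by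
  induction d with
  | zero => rfl
  | succ d ih =>
    rw [List.ofFn_succ, List.prod_cons, mul_tm, ih, prod_one, Fin.sum_univ_succ, add_comm,
      Finset.mul_sum]
    simp only [Fin.prod_univ_succ, Fin.succ_ne_zero, if_true, if_false, Fin.succ_inj,
      (Fin.succ_ne_zero _).symm]

theorem prod_tpm {d : ℕ} (x : Fin d → Theta ℂ) :
    (List.ofFn x).prod.tpm = (∑ i, ∏ j, if j = i then (x j).tpm else (x j).one)
      + ∑ i, ∑ j, if i = j then 0 else (if i < j then -1 else 1) *
        ∏ l, if l = i then (x l).tm else if l = j then (x l).tp else (x l).one := by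
  induction d with
  | zero =>
    change (0 : ℂ) = _
    simp
  | succ d ih =>
    rw [List.ofFn_succ, List.prod_cons, mul_tpm, ih, prod_one, prod_tm, prod_tp]
    simp only [Fin.sum_univ_succ, Fin.prod_univ_succ, Fin.succ_ne_zero, if_true, if_false,
      Fin.succ_inj, (Fin.succ_ne_zero _).symm, Fin.succ_pos, Fin.not_lt_zero, Fin.succ_lt_succ_iff,
      zero_add, Finset.sum_add_distrib, mul_add, Finset.mul_sum, neg_mul, one_mul,
      Finset.sum_neg_distrib, mul_ite, mul_zero]
    simp only [ite_mul, neg_mul, one_mul, mul_ite, mul_neg]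
    ring

end Theta

variable (D : ℤ → ℂ)

theorem superfield_one (v : Letter) (n : ℤ) : (superfield D v n).one = fieldAt v n := by
  obtain ⟨a, s⟩ := v
  cases a <;> cases s <;>
    simp [superfield, Theta.add_one', Theta.smul_one', Theta.const, Theta.thetaMul, Sgn.opp]

theorem superfield_tp (v : Letter) (n : ℤ) : (superfield D v n).tp = delta D Sgn.plus v n := by
  obtain ⟨a, s⟩ := v
  cases a <;> cases s <;>
    simp [superfield, Theta.add_tp, Theta.smul_tp, Theta.add_one', Theta.smul_one', Theta.const,
      Theta.thetaMul, delta, Sgn.val, Sgn.opp]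

theorem superfield_tm (v : Letter) (n : ℤ) : (superfield D v n).tm = delta D Sgn.minus v n := by
  obtain ⟨a, s⟩ := v
  cases a <;> cases s <;>
    simp [superfield, Theta.add_tm, Theta.smul_tm, Theta.add_one', Theta.smul_one', Theta.const,
      Theta.thetaMul, delta, Sgn.val, Sgn.opp]

theorem superfield_tpm (v : Letter) (n : ℤ) : (superfield D v n).tpm
    = if v.1 = Kind.chi then (-(v.2.val * Complex.I)) • nablaAt D (Kind.chibar, v.2) n else 0 := by
  obtain ⟨a, s⟩ := v
  cases a <;> cases s <;>
    simp [superfield, Theta.add_tpm, Theta.smul_tpm, Theta.add_tm, Theta.smul_tm, Theta.add_tp,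
      Theta.smul_tp, Theta.const, Theta.thetaMul, Sgn.val, Sgn.opp]

end Theta

section SiteSums

variable {d : ℕ}

theorem eq_update_of_forall_ne {α : Type*} {w v : Fin d → α} {i : Fin d}
    (h : ∀ l, l ≠ i → w l = v l) : Function.update w i (v i) = v := by
  funext l
  by_cases hl : l = i
  · subst hl
    simp
  · rw [Function.update_of_ne hl, h l hl]

theorem eq_update_update_of_forall_ne {α : Type*} {w v : Fin d → α} {i j : Fin d}
    (h : ∀ l, l ≠ i → l ≠ j → w l = v l) :
    Function.update (Function.update w i (v i)) j (v j) = v := by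
  refine eq_update_of_forall_ne fun l hlj => ?_
  by_cases hl : l = i
  · subst hl
    simp
  · rw [Function.update_of_ne hl, h l hl hlj]

theorem update_update_injective {α : Type*} (w : Fin d → α) {i j : Fin d} (hij : i ≠ j) :
    Function.Injective fun p : α × α => Function.update (Function.update w i p.1) j p.2 := by
  rintro ⟨a, b⟩ ⟨a', b'⟩ h
  have h1 := congrFun h i
  have h2 := congrFun h j
  simp only [Function.update_self, Function.update_of_ne hij] at h1 h2
  rw [h1, h2]

/-- The product of matrix elements which are Kronecker deltas except at position `i`. -/
noncomputable def deltaExcept (w : Fin d → Letter) (m : Fin d → ℤ) (i : Fin d)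
    (g : Letter → ℤ → ℂ) (v : Fin d → Letter) (n : Fin d → ℤ) : ℂ :=
  ∏ l, if l = i then g (v l) (n l) else fieldAt (v l) (n l) (w l) (m l)

/-- The product of matrix elements which are Kronecker deltas except at positions `i` and `j`. -/
noncomputable def deltaExceptTwo (w : Fin d → Letter) (m : Fin d → ℤ) (i j : Fin d)
    (g h : Letter → ℤ → ℂ) (v : Fin d → Letter) (n : Fin d → ℤ) : ℂ :=
  ∏ l, if l = i then g (v l) (n l) else if l = j then h (v l) (n l)
    else fieldAt (v l) (n l) (w l) (m l)

theorem deltaExcept_ne_zero {w : Fin d → Letter} {m : Fin d → ℤ} {i : Fin d}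
    {g : Letter → ℤ → ℂ} {v : Fin d → Letter} {n : Fin d → ℤ} (h : deltaExcept w m i g v n ≠ 0)
    (l : Fin d) (hl : l ≠ i) : w l = v l ∧ m l = n l := by
  have h1 := Finset.prod_ne_zero_iff.1 h l (Finset.mem_univ l)
  rw [if_neg hl, fieldAt] at h1
  by_contra hcon
  exact h1 (if_neg hcon)

theorem deltaExceptTwo_ne_zero {w : Fin d → Letter} {m : Fin d → ℤ} {i j : Fin d}
    {g h : Letter → ℤ → ℂ} {v : Fin d → Letter} {n : Fin d → ℤ}
    (hne : deltaExceptTwo w m i j g h v n ≠ 0) (l : Fin d) (hi : l ≠ i) (hj : l ≠ j) :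
    w l = v l ∧ m l = n l := by
  have h1 := Finset.prod_ne_zero_iff.1 hne l (Finset.mem_univ l)
  rw [if_neg hi, if_neg hj, fieldAt] at h1
  by_contra hcon
  exact h1 (if_neg hcon)

theorem deltaExcept_update (w : Fin d → Letter) (m : Fin d → ℤ) (i : Fin d)
    (g : Letter → ℤ → ℂ) (v : Letter) (n : ℤ) :
    deltaExcept w m i g (Function.update w i v) (Function.update m i n) = g v n := by
  rw [deltaExcept, Finset.prod_eq_single i]
  · simp
  · intro l _ hl
    simp [hl, fieldAt]
  · simp

theorem deltaExceptTwo_update (w : Fin d → Letter) (m : Fin d → ℤ) {i j : Fin d} (hij : i ≠ j)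
    (g h : Letter → ℤ → ℂ) (v v' : Letter) (n n' : ℤ) :
    deltaExceptTwo w m i j g h (Function.update (Function.update w i v) j v')
      (Function.update (Function.update m i n) j n') = g v n * h v' n' := by
  rw [deltaExceptTwo, Finset.prod_eq_mul i j hij]
  · simp [hij, hij.symm]
  · intro l _ hl
    simp [hl.1, hl.2, fieldAt]
  · simp
  · simp

variable {A : (Fin d → Letter) → (Fin d → ℤ) → ℂ}

theorem summable_deltaExcept (w : Fin d → Letter) (m : Fin d → ℤ) (i : Fin d)
    {g : Letter → ℤ → ℂ} (hsum : ∀ v, Summable fun a =>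
      A (Function.update w i v) (Function.update m i a) * g v a) (v : Fin d → Letter) :
    Summable fun n => A v n * deltaExcept w m i g v n := by
  by_cases hv : ∀ l, l ≠ i → w l = v l
  · rw [← (Function.update_injective m i).summable_iff]
    · refine (hsum (v i)).congr fun a => ?_
      rw [Function.comp_apply]
      conv_rhs => rw [← eq_update_of_forall_ne hv]
      rw [deltaExcept_update]
    · intro n hn
      by_contra hne
      exact hn ⟨n i, eq_update_of_forall_ne fun l hl =>
        (deltaExcept_ne_zero (right_ne_zero_of_mul hne) l hl).2⟩
  · push Not at hv
    obtain ⟨l, hl, hne⟩ := hv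
    refine summable_zero.congr fun n => ?_
    by_contra hcon
    exact hne (deltaExcept_ne_zero (right_ne_zero_of_mul (Ne.symm hcon)) l hl).1

theorem sum_tsum_deltaExcept (w : Fin d → Letter) (m : Fin d → ℤ) (i : Fin d)
    (g : Letter → ℤ → ℂ) :
    ∑ v, ∑' n, A v n * deltaExcept w m i g v n
      = ∑ v, ∑' a, A (Function.update w i v) (Function.update m i a) * g v a := by
  refine (Fintype.sum_of_injective (Function.update w i) (Function.update_injective w i) _ _
    (fun v hv => ?_) fun v => ?_).symm
  · rw [← tsum_zero]
    refine tsum_congr fun n => ?_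
    by_contra hne
    exact hv ⟨v i, eq_update_of_forall_ne fun l hl =>
      (deltaExcept_ne_zero (right_ne_zero_of_mul hne) l hl).1⟩
  · rw [← (Function.update_injective m i).tsum_eq]
    · exact tsum_congr fun a => by rw [deltaExcept_update]
    · intro n hn
      exact ⟨n i, eq_update_of_forall_ne fun l hl =>
        (deltaExcept_ne_zero (right_ne_zero_of_mul hn) l hl).2⟩

theorem summable_deltaExceptTwo (w : Fin d → Letter) (m : Fin d → ℤ) {i j : Fin d} (hij : i ≠ j)
    {g h : Letter → ℤ → ℂ} (hsum : ∀ v v', Summable fun p : ℤ × ℤ =>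
      A (Function.update (Function.update w i v) j v')
        (Function.update (Function.update m i p.1) j p.2) * (g v p.1 * h v' p.2))
    (v : Fin d → Letter) :
    Summable fun n => A v n * deltaExceptTwo w m i j g h v n := by
  by_cases hv : ∀ l, l ≠ i → l ≠ j → w l = v l
  · rw [← (update_update_injective m hij).summable_iff]
    · refine (hsum (v i) (v j)).congr fun p => ?_
      rw [Function.comp_apply]
      conv_rhs => rw [← eq_update_update_of_forall_ne hv]
      rw [deltaExceptTwo_update w m hij]
    · intro n hn
      by_contra hne
      exact hn ⟨(n i, n j), eq_update_update_of_forall_ne fun l hl hl' =>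
        (deltaExceptTwo_ne_zero (right_ne_zero_of_mul hne) l hl hl').2⟩
  · push Not at hv
    obtain ⟨l, hl, hl', hne⟩ := hv
    refine summable_zero.congr fun n => ?_
    by_contra hcon
    exact hne (deltaExceptTwo_ne_zero (right_ne_zero_of_mul (Ne.symm hcon)) l hl hl').1

theorem sum_tsum_deltaExceptTwo (w : Fin d → Letter) (m : Fin d → ℤ) {i j : Fin d} (hij : i ≠ j)
    (g h : Letter → ℤ → ℂ) :
    ∑ v, ∑' n, A v n * deltaExceptTwo w m i j g h v n
      = ∑ v, ∑ v', ∑' p : ℤ × ℤ, A (Function.update (Function.update w i v) j v')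
        (Function.update (Function.update m i p.1) j p.2) * (g v p.1 * h v' p.2) := by
  rw [← Fintype.sum_prod_type']
  refine (Fintype.sum_of_injective
    (fun p : Letter × Letter => Function.update (Function.update w i p.1) j p.2)
    (update_update_injective w hij) _ _ (fun v hv => ?_) fun q => ?_).symm
  · rw [← tsum_zero]
    refine tsum_congr fun n => ?_
    by_contra hne
    exact hv ⟨(v i, v j), eq_update_update_of_forall_ne fun l hl hl' =>
      (deltaExceptTwo_ne_zero (right_ne_zero_of_mul hne) l hl hl').1⟩
  · rw [← (update_update_injective m hij).tsum_eq]
    · exact tsum_congr fun a => by rw [deltaExceptTwo_update w m hij]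
    · intro n hn
      exact ⟨(n i, n j), eq_update_update_of_forall_ne fun l hl hl' =>
        (deltaExceptTwo_ne_zero (right_ne_zero_of_mul hn) l hl hl').2⟩

theorem superMonomial_one (D : ℤ → ℂ) (v : Fin d → Letter) (n : Fin d → ℤ) (w : Fin d → Letter)
    (m : Fin d → ℤ) :
    (superMonomial D v n w m).one = ∏ l, fieldAt (v l) (n l) (w l) (m l) := by
  simp only [superMonomial, Theta.prod_one, Theta.involute_iterate, Theta.coeffAt, superfield_one]

theorem superMonomial_tp (D : ℤ → ℂ) (v : Fin d → Letter) (n : Fin d → ℤ) (w : Fin d → Letter)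
    (m : Fin d → ℤ) :
    (superMonomial D v n w m).tp = ∑ i, (-1 : ℂ) ^ oddBefore w i *
      deltaExcept w m i (fun x a => delta D Sgn.plus x a (w i) (m i)) v n := by
  simp only [superMonomial, Theta.prod_tp, Theta.involute_iterate, Theta.coeffAt, superfield_one,
    superfield_tp]
  refine Finset.sum_congr rfl fun i _ => ?_
  rw [deltaExcept, ← Finset.mul_prod_erase _ _ (Finset.mem_univ i),
    ← Finset.mul_prod_erase (a := i) _ (fun l => if l = i then _ else _) (Finset.mem_univ i),
    if_pos rfl, if_pos rfl, mul_assoc]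
  congr 2
  refine Finset.prod_congr rfl fun l hl => ?_
  rw [if_neg (Finset.ne_of_mem_erase hl), if_neg (Finset.ne_of_mem_erase hl)]

theorem superMonomial_tm (D : ℤ → ℂ) (v : Fin d → Letter) (n : Fin d → ℤ) (w : Fin d → Letter)
    (m : Fin d → ℤ) :
    (superMonomial D v n w m).tm = ∑ i, (-1 : ℂ) ^ oddBefore w i *
      deltaExcept w m i (fun x a => delta D Sgn.minus x a (w i) (m i)) v n := by
  simp only [superMonomial, Theta.prod_tm, Theta.involute_iterate, Theta.coeffAt, superfield_one,
    superfield_tm]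
  refine Finset.sum_congr rfl fun i _ => ?_
  rw [deltaExcept, ← Finset.mul_prod_erase _ _ (Finset.mem_univ i),
    ← Finset.mul_prod_erase (a := i) _ (fun l => if l = i then _ else _) (Finset.mem_univ i),
    if_pos rfl, if_pos rfl, mul_assoc]
  congr 2
  refine Finset.prod_congr rfl fun l hl => ?_
  rw [if_neg (Finset.ne_of_mem_erase hl), if_neg (Finset.ne_of_mem_erase hl)]

theorem superMonomial_tpm (D : ℤ → ℂ) (v : Fin d → Letter) (n : Fin d → ℤ) (w : Fin d → Letter)
    (m : Fin d → ℤ) :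
    (superMonomial D v n w m).tpm
      = (∑ i, deltaExcept w m i (fun x a => (superfield D x a).tpm (w i) (m i)) v n)
        + ∑ i, ∑ j, if i = j then 0 else
          ((if i < j then -1 else 1) * ((-1 : ℂ) ^ oddBefore w i * (-1 : ℂ) ^ oddBefore w j)) *
          deltaExceptTwo w m i j (fun x a => delta D Sgn.minus x a (w i) (m i))
            (fun x a => delta D Sgn.plus x a (w j) (m j)) v n := by
  simp only [superMonomial, Theta.prod_tpm, Theta.involute_iterate, Theta.coeffAt, superfield_one,
    superfield_tm, superfield_tp]
  congr 1
  · refine Finset.sum_congr rfl fun i _ => Finset.prod_congr rfl fun l _ => ?_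
    by_cases hl : l = i
    · subst hl
      rfl
    · rw [if_neg hl, if_neg hl]
  · refine Finset.sum_congr rfl fun i _ => Finset.sum_congr rfl fun j _ => ?_
    by_cases hij : i = j
    · rw [if_pos hij, if_pos hij]
    rw [if_neg hij, if_neg hij, mul_assoc]
    congr 1
    have hji : j ∈ Finset.univ.erase i := Finset.mem_erase.2 ⟨Ne.symm hij, Finset.mem_univ j⟩
    rw [deltaExceptTwo, ← Finset.mul_prod_erase _ _ (Finset.mem_univ i),
      ← Finset.mul_prod_erase _ _ hji,
      ← Finset.mul_prod_erase (a := i) _ (fun l => if l = i then _ else ite (l = j) _ _)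
        (Finset.mem_univ i),
      ← Finset.mul_prod_erase (a := j) _ (fun l => if l = i then _ else ite (l = j) _ _) hji]
    simp only [if_true, if_neg (Ne.symm hij)]
    rw [Finset.prod_congr rfl fun l hl => by
      rw [if_neg (Finset.ne_of_mem_erase (Finset.mem_of_mem_erase hl)),
        if_neg (Finset.ne_of_mem_erase hl)]]
    rw [Finset.prod_congr (s₁ := (Finset.univ.erase i).erase j)
      (f := fun l => if l = i then _ else ite (l = j) _ _) rfl fun l hl => by
      rw [if_neg (Finset.ne_of_mem_erase (Finset.mem_of_mem_erase hl)),
        if_neg (Finset.ne_of_mem_erase hl)]]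
    ring

end SiteSums

/-! ### Components of functionals as derivations -/

section Components

open Polynomial

variable {D : ℤ → ℂ} {k : ℕ}

theorem summable_norm_fieldAt (v x : Letter) (p : ℤ) : Summable fun n => ‖fieldAt v n x p‖ :=
  summable_of_ne_finset_zero (s := {p}) fun n hn => by
    rw [fieldAt, if_neg, norm_zero]
    rintro ⟨-, h⟩
    exact hn (Finset.mem_singleton.2 h.symm)

theorem summable_norm_nablaAt (hD : HasExpDecay D) (v x : Letter) (p : ℤ) :
    Summable fun n => ‖nablaAt D v n x p‖ := by
  unfold nablaAt
  by_cases h : x = v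
  · simp only [if_pos h]
    exact ((Equiv.subRight p).summable_iff (f := fun j => ‖D j‖)).2 hD.summable_norm
  · simp only [if_neg h, norm_zero]
    exact summable_zero

theorem summable_norm_smul {g : ℤ → LinForm} {x : Letter} {p : ℤ}
    (h : Summable fun n => ‖g n x p‖) (c : ℂ) : Summable fun n => ‖(c • g n) x p‖ := by
  simp only [Pi.smul_apply, norm_smul]
  exact h.mul_left _

theorem delta_phi (D : ℤ → ℂ) (s t : Sgn) (n : ℤ) : delta D s (Kind.phi, t) n
    = if t = s then s.val • fieldAt (Kind.chibar, t) n else 0 := by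
  cases s <;> cases t <;> simp [delta, Sgn.val]

theorem delta_chibar (D : ℤ → ℂ) (s t : Sgn) (n : ℤ) : delta D s (Kind.chibar, t) n = 0 := by
  cases s <;> cases t <;> rfl

theorem delta_chi (D : ℤ → ℂ) (s t : Sgn) (n : ℤ) : delta D s (Kind.chi, t) n
    = if t = s then fieldAt (Kind.aux, t) n
      else (t.val * Complex.I) • nablaAt D (Kind.phi, t) n := by
  cases s <;> cases t <;> simp [delta, Sgn.val]

theorem delta_aux (D : ℤ → ℂ) (s t : Sgn) (n : ℤ) : delta D s (Kind.aux, t) n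
    = if t = s then 0 else (-Complex.I) • nablaAt D (Kind.chibar, t) n := by
  cases s <;> cases t <;> simp [delta]

theorem summable_norm_delta (hD : HasExpDecay D) (s : Sgn) (v x : Letter) (p : ℤ) :
    Summable fun n => ‖delta D s v n x p‖ := by
  obtain ⟨a, t⟩ := v
  have h0 : Summable fun _ : ℤ => ‖(0 : LinForm) x p‖ := by simp
  cases a <;> simp only [delta_phi, delta_chibar, delta_chi, delta_aux]
  · split_ifs
    · exact summable_norm_smul (summable_norm_fieldAt _ _ _) _
    · exact h0
  · exact h0
  · split_ifs
    · exact summable_norm_fieldAt _ _ _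
    · exact summable_norm_smul (summable_norm_nablaAt hD _ _ _) _
  · split_ifs
    · exact h0
    · exact summable_norm_smul (summable_norm_nablaAt hD _ _ _) _

theorem summable_norm_superfield_tpm (hD : HasExpDecay D) (v x : Letter) (p : ℤ) :
    Summable fun n => ‖(superfield D v n).tpm x p‖ := by
  simp only [superfield_tpm]
  split_ifs
  · exact summable_norm_smul (summable_norm_nablaAt hD _ _ _) _
  · simp

theorem tsum_update_mul_fieldAt (f : (Fin (k + 1) → ℤ) → ℂ) (i : Fin (k + 1))
    (m : Fin (k + 1) → ℤ) (v x : Letter) :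
    ∑' n, f (Function.update m i n) * fieldAt v n x (m i) = if x = v then f m else 0 := by
  rw [tsum_eq_single (m i)]
  · simp [fieldAt]
  · intro n hn
    rw [fieldAt, if_neg, mul_zero]
    rintro ⟨-, h⟩
    exact hn h.symm

theorem tsum_update_mul_nablaAt (hD : HasExpDecay D) (f : tilc k) (i : Fin (k + 1))
    (m : Fin (k + 1) → ℤ) (v x : Letter) :
    ∑' n, (f : (Fin (k + 1) → ℤ) → ℂ) (Function.update m i n) * nablaAt D v n x (m i)
      = if x = v then (conv hD i f : (Fin (k + 1) → ℤ) → ℂ) m else 0 := by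
  unfold nablaAt
  split_ifs
  · rfl
  · simp

theorem aeval_C_mul_X_apply (T : Module.End ℂ (tilc k)) (c : ℂ) (f : tilc k) :
    aeval T (C c * X : ℂ[X]) f = c • T f := by
  rw [map_mul, aeval_C, aeval_X, Algebra.algebraMap_eq_smul_one, smul_mul_assoc, one_mul,
    LinearMap.smul_apply]

theorem aeval_C_apply (T : Module.End ℂ (tilc k)) (c : ℂ) (f : tilc k) :
    aeval T (C c : ℂ[X]) f = c • f := by
  rw [aeval_C, Algebra.algebraMap_eq_smul_one, LinearMap.smul_apply, Module.End.one_apply]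

theorem susyKernel_phi (s t : Sgn) (x : Letter) : susyKernel s (Kind.phi, t) x
    = if t = s then if x = (Kind.chibar, t) then C s.val else 0 else 0 := by
  obtain ⟨b, u⟩ := x
  rw [susyKernel, Matrix.blockDiagonal_apply]
  cases b <;> cases s <;> cases t <;> cases u <;> simp [susyBlock]

theorem susyKernel_chibar (s t : Sgn) (x : Letter) : susyKernel s (Kind.chibar, t) x = 0 := by
  obtain ⟨b, u⟩ := x
  rw [susyKernel, Matrix.blockDiagonal_apply]
  cases b <;> simp [susyBlock]

theorem susyKernel_chi (s t : Sgn) (x : Letter) : susyKernel s (Kind.chi, t) x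
    = if t = s then if x = (Kind.aux, t) then C 1 else 0
      else if x = (Kind.phi, t) then C (t.val * Complex.I) * X else 0 := by
  obtain ⟨b, u⟩ := x
  rw [susyKernel, Matrix.blockDiagonal_apply]
  cases b <;> cases s <;> cases t <;> cases u <;> simp [susyBlock]

theorem susyKernel_aux (s t : Sgn) (x : Letter) : susyKernel s (Kind.aux, t) x
    = if t = s then 0 else if x = (Kind.chibar, t) then C (-Complex.I) * X else 0 := by
  obtain ⟨b, u⟩ := x
  rw [susyKernel, Matrix.blockDiagonal_apply]
  cases b <;> cases s <;> cases t <;> cases u <;> simp [susyBlock]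

theorem tsum_update_mul_smul_fieldAt (f : (Fin (k + 1) → ℤ) → ℂ) (i : Fin (k + 1))
    (m : Fin (k + 1) → ℤ) (c : ℂ) (v x : Letter) :
    ∑' n, f (Function.update m i n) * (c • fieldAt v n) x (m i) = if x = v then c * f m else 0 := by
  rw [← mul_ite_zero, ← tsum_update_mul_fieldAt f i m v x, ← tsum_mul_left]
  exact tsum_congr fun n => mul_left_comm _ _ _

theorem tsum_update_mul_smul_nablaAt (hD : HasExpDecay D) (f : tilc k) (i : Fin (k + 1))
    (m : Fin (k + 1) → ℤ) (c : ℂ) (v x : Letter) :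
    ∑' n, (f : (Fin (k + 1) → ℤ) → ℂ) (Function.update m i n) * (c • nablaAt D v n) x (m i)
      = if x = v then c * (conv hD i f : (Fin (k + 1) → ℤ) → ℂ) m else 0 := by
  rw [← mul_ite_zero, ← tsum_update_mul_nablaAt hD f i m v x, ← tsum_mul_left]
  exact tsum_congr fun n => mul_left_comm _ _ _

/-- The polynomial matrix `susyKernel` encodes the supersymmetry transformation of the fields. -/
theorem aeval_susyKernel_apply (hD : HasExpDecay D) (s : Sgn) (v x : Letter) (i : Fin (k + 1))
    (f : tilc k) (m : Fin (k + 1) → ℤ) :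
    (aeval (conv hD i) (susyKernel s v x) f : (Fin (k + 1) → ℤ) → ℂ) m
      = ∑' n, (f : (Fin (k + 1) → ℤ) → ℂ) (Function.update m i n) * delta D s v n x (m i) := by
  have h0 : ∑' n, (f : (Fin (k + 1) → ℤ) → ℂ) (Function.update m i n) * (0 : LinForm) x (m i)
      = 0 := by
    simp
  obtain ⟨a, t⟩ := v
  cases a <;> simp only [delta_phi, delta_chibar, delta_chi, delta_aux, susyKernel_phi,
    susyKernel_chibar, susyKernel_chi, susyKernel_aux]
  · by_cases hs : t = s
    · simp only [if_pos hs, tsum_update_mul_smul_fieldAt]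
      split_ifs
      · rw [aeval_C_apply]
        rfl
      · simp
    · simp only [if_neg hs, h0]
      simp
  · simp
  · by_cases hs : t = s
    · simp only [if_pos hs, tsum_update_mul_fieldAt]
      split_ifs
      · rw [aeval_C_apply, one_smul]
      · simp
    · simp only [if_neg hs, tsum_update_mul_smul_nablaAt hD]
      split_ifs
      · rw [aeval_C_mul_X_apply]
        rfl
      · simp
  · by_cases hs : t = s
    · simp only [if_pos hs, h0]
      simp
    · simp only [if_neg hs, tsum_update_mul_smul_nablaAt hD]
      split_ifs
      · rw [aeval_C_mul_X_apply]
        rfl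
      · simp

theorem susyKernel_plus_mul_minus (v x : Letter) :
    (susyKernel Sgn.plus * susyKernel Sgn.minus) v x
      = if v.1 = Kind.chi then
          if x = (Kind.chibar, v.2) then C (-(v.2.val * Complex.I)) * X else 0
        else 0 := by
  obtain ⟨a, t⟩ := v
  obtain ⟨b, u⟩ := x
  rw [susyKernel, susyKernel, ← Matrix.blockDiagonal_mul, Matrix.blockDiagonal_apply]
  simp only [Matrix.mul_apply, Kind.sum_univ]
  cases a <;> cases b <;> simp only [susyBlock, mul_zero, zero_mul, add_zero] <;>
    cases t <;> cases u <;> simp [Sgn.val]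

/-- The `θ_+ θ_-` component of a superfield is the image of its lowest component under
`Q_- Q_+`. -/
theorem aeval_susyKernel_plus_mul_minus_apply (hD : HasExpDecay D) (v x : Letter) (i : Fin (k + 1))
    (f : tilc k) (m : Fin (k + 1) → ℤ) :
    (aeval (conv hD i) ((susyKernel Sgn.plus * susyKernel Sgn.minus) v x) f :
        (Fin (k + 1) → ℤ) → ℂ) m
      = ∑' n, (f : (Fin (k + 1) → ℤ) → ℂ) (Function.update m i n)
          * (superfield D v n).tpm x (m i) := by
  simp only [susyKernel_plus_mul_minus, superfield_tpm]
  by_cases hv : v.1 = Kind.chi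
  · simp only [if_pos hv, tsum_update_mul_smul_nablaAt hD]
    split_ifs
    · rw [aeval_C_mul_X_apply]
      rfl
    · simp
  · simp [if_neg hv]

theorem summable_mul_of_isTILC {f : (Fin (k + 1) → ℤ) → ℂ} (hf : IsTILC f) {ι : Type*}
    (u : ι → Fin (k + 1) → ℤ) {g : ι → ℂ} (hg : Summable fun a => ‖g a‖) :
    Summable fun a => f (u a) * g a := by
  obtain ⟨L, -, h⟩ := isTILC_norm_bounded hf
  refine Summable.of_norm_bounded (hg.mul_left L) fun a => ?_
  rw [norm_mul]
  exact mul_le_mul_of_nonneg_right (h _) (norm_nonneg _)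

theorem summable_mul_mul_of_isTILC {f : (Fin (k + 1) → ℤ) → ℂ} (hf : IsTILC f)
    (u : ℤ × ℤ → Fin (k + 1) → ℤ) {g h : ℤ → ℂ} (hg : Summable fun a => ‖g a‖)
    (hh : Summable fun a => ‖h a‖) : Summable fun p : ℤ × ℤ => f (u p) * (g p.1 * h p.2) := by
  refine summable_mul_of_isTILC hf u (g := fun p : ℤ × ℤ => g p.1 * h p.2) ?_
  simp only [norm_mul]
  exact Summable.mul_of_nonneg hg hh (fun _ => norm_nonneg _) (fun _ => norm_nonneg _)

theorem sum_tsum_sum_add_sum {ι α β : Type*} [Fintype ι] [Fintype α]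
    {a : ι → α → β → ℂ} {b : ι → ι → α → β → ℂ} (ha : ∀ i v, Summable (a i v))
    (hb : ∀ i j v, Summable (b i j v)) :
    ∑ v, ∑' n, (∑ i, a i v n + ∑ i, ∑ j, b i j v n)
      = ∑ i, ∑ v, ∑' n, a i v n + ∑ i, ∑ j, ∑ v, ∑' n, b i j v n := by
  rw [Finset.sum_congr rfl fun v _ => Summable.tsum_add (summable_sum fun i _ => ha i v)
      (summable_sum fun i _ => summable_sum fun j _ => hb i j v),
    Finset.sum_add_distrib]
  congr 1
  · rw [Finset.sum_congr rfl fun v _ => Summable.tsum_finsetSum fun i _ => ha i v,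
      Finset.sum_comm]
  · rw [Finset.sum_congr rfl fun v _ => (Summable.tsum_finsetSum fun i _ =>
        summable_sum fun j _ => hb i j v).trans
        (Finset.sum_congr rfl fun i _ => Summable.tsum_finsetSum fun j _ => hb i j v),
      Finset.sum_comm]
    exact Finset.sum_congr rfl fun i _ => Finset.sum_comm

section Functional

variable (hD : HasExpDecay D) {A : Functional} {B : (Fin (k + 1) → Letter) → tilc k}

theorem superCharge_apply_eq (hA : ∀ w, A k w = B w) (s : Sgn) (w : Fin (k + 1) → Letter) :
    superCharge D s A k w = oddDer (conv hD) (susyKernel s) B w := by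
  funext m
  simp only [superCharge, oddDer_apply, Submodule.coe_sum, Submodule.coe_smul, Finset.sum_apply,
    Pi.smul_apply, smul_eq_mul, aeval_susyKernel_apply, hA]

theorem superFunctional_one_apply (A : Functional) (w : Fin (k + 1) → Letter) :
    (superFunctional D A).one k w = A k w := by
  funext m
  simp only [superFunctional, superMonomial_one]
  rw [Finset.sum_eq_single w, tsum_eq_single m]
  · simp [fieldAt]
  · intro n hn
    obtain ⟨l, hl⟩ := Function.ne_iff.1 hn
    rw [Finset.prod_eq_zero (Finset.mem_univ l), mul_zero]
    simp [fieldAt, Ne.symm hl]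
  · intro v _ hv
    obtain ⟨l, hl⟩ := Function.ne_iff.1 hv
    refine (tsum_congr fun n => ?_).trans tsum_zero
    rw [Finset.prod_eq_zero (Finset.mem_univ l), mul_zero]
    simp [fieldAt, Ne.symm hl]
  · simp

theorem sum_tsum_sum_deltaExcept (hA : ∀ w, A k w = B w) (s : Sgn) (w : Fin (k + 1) → Letter)
    (m : Fin (k + 1) → ℤ) :
    ∑ v, ∑' n, A k v n * ∑ i, (-1 : ℂ) ^ oddBefore w i *
        deltaExcept w m i (fun x a => delta D s x a (w i) (m i)) v n
      = (oddDer (conv hD) (susyKernel s) B w : (Fin (k + 1) → ℤ) → ℂ) m := by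
  have hsum : ∀ i v, Summable fun n => A k v n *
      deltaExcept w m i (fun x a => delta D s x a (w i) (m i)) v n := fun i =>
    summable_deltaExcept w m i fun v => summable_mul_of_isTILC (by rw [hA]; exact (B _).2) _
      (summable_norm_delta hD s v (w i) (m i))
  simp only [Finset.mul_sum, mul_left_comm (A k _ _)]
  rw [← superCharge_apply_eq hD hA, superCharge,
    Finset.sum_congr rfl fun v _ => Summable.tsum_finsetSum fun i _ => (hsum i v).mul_left _,
    Finset.sum_comm]
  refine Finset.sum_congr rfl fun i _ => ?_
  rw [← sum_tsum_deltaExcept w m i, Finset.mul_sum]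
  exact Finset.sum_congr rfl fun v _ => tsum_mul_left

theorem superFunctional_tp_apply (hA : ∀ w, A k w = B w) (w : Fin (k + 1) → Letter) :
    (superFunctional D A).tp k w = oddDer (conv hD) (susyKernel Sgn.plus) B w := by
  funext m
  rw [← sum_tsum_sum_deltaExcept hD hA]
  simp only [superFunctional, superMonomial_tp]

theorem superFunctional_tm_apply (hA : ∀ w, A k w = B w) (w : Fin (k + 1) → Letter) :
    (superFunctional D A).tm k w = oddDer (conv hD) (susyKernel Sgn.minus) B w := by
  funext m
  rw [← sum_tsum_sum_deltaExcept hD hA]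
  simp only [superFunctional, superMonomial_tm]

/-- The terms of `Q_- Q_+` in which both supercharges act on the same field. -/
theorem sum_tsum_deltaExcept_tpm (hA : ∀ w, A k w = B w) (w : Fin (k + 1) → Letter)
    (m : Fin (k + 1) → ℤ) (i : Fin (k + 1)) :
    ∑ v, ∑' n, A k v n * deltaExcept w m i (fun x a => (superfield D x a).tpm (w i) (m i)) v n
      = ∑ v, (aeval (conv hD i) ((susyKernel Sgn.plus * susyKernel Sgn.minus) v (w i))
          (B (Function.update w i v)) : (Fin (k + 1) → ℤ) → ℂ) m := by
  rw [sum_tsum_deltaExcept]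
  simp only [aeval_susyKernel_plus_mul_minus_apply, hA]

theorem summable_deltaExcept_tpm (hD : HasExpDecay D) (hA : ∀ w, A k w = B w)
    (w : Fin (k + 1) → Letter) (m : Fin (k + 1) → ℤ) (i : Fin (k + 1))
    (v : Fin (k + 1) → Letter) : Summable fun n => A k v n *
      deltaExcept w m i (fun x a => (superfield D x a).tpm (w i) (m i)) v n :=
  summable_deltaExcept w m i (fun v => summable_mul_of_isTILC (by rw [hA]; exact (B _).2) _
    (summable_norm_superfield_tpm hD v (w i) (m i))) v

theorem summable_pair (hD : HasExpDecay D) (hA : ∀ w, A k w = B w) (w : Fin (k + 1) → Letter)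
    (m : Fin (k + 1) → ℤ) (i j : Fin (k + 1)) (v v' : Letter) : Summable fun p : ℤ × ℤ =>
      A k (Function.update (Function.update w i v) j v')
        (Function.update (Function.update m i p.1) j p.2) *
      (delta D Sgn.minus v p.1 (w i) (m i) * delta D Sgn.plus v' p.2 (w j) (m j)) :=
  summable_mul_mul_of_isTILC (f := A k (Function.update (Function.update w i v) j v'))
    (by rw [hA]; exact (B _).2) (fun p => Function.update (Function.update m i p.1) j p.2)
    (g := fun a => delta D Sgn.minus v a (w i) (m i))
    (h := fun a => delta D Sgn.plus v' a (w j) (m j))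
    (summable_norm_delta hD Sgn.minus v (w i) (m i))
    (summable_norm_delta hD Sgn.plus v' (w j) (m j))

/-- The terms of `Q_- Q_+` in which the supercharges act on different fields. -/
theorem sum_tsum_deltaExceptTwo_delta (hA : ∀ w, A k w = B w) (w : Fin (k + 1) → Letter)
    (m : Fin (k + 1) → ℤ) {i j : Fin (k + 1)} (hij : i ≠ j) :
    ∑ v, ∑' n, A k v n * deltaExceptTwo w m i j (fun x a => delta D Sgn.minus x a (w i) (m i))
        (fun x a => delta D Sgn.plus x a (w j) (m j)) v n
      = ∑ v, ∑ v', (aeval (conv hD i) (susyKernel Sgn.minus v (w i))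
          (aeval (conv hD j) (susyKernel Sgn.plus v' (w j))
            (B (Function.update (Function.update w i v) j v'))) : (Fin (k + 1) → ℤ) → ℂ) m := by
  rw [sum_tsum_deltaExceptTwo w m hij]
  refine Finset.sum_congr rfl fun v _ => Finset.sum_congr rfl fun v' _ => ?_
  rw [(summable_pair hD hA w m i j v v').tsum_prod, aeval_susyKernel_apply]
  refine tsum_congr fun a => ?_
  rw [aeval_susyKernel_apply, Function.update_of_ne (Ne.symm hij), ← hA, ← tsum_mul_right]
  exact tsum_congr fun b => by ring

theorem summable_deltaExceptTwo_delta (hD : HasExpDecay D) (hA : ∀ w, A k w = B w)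
    (w : Fin (k + 1) → Letter) (m : Fin (k + 1) → ℤ) (i j : Fin (k + 1)) (c : ℂ)
    (v : Fin (k + 1) → Letter) :
    Summable fun n => A k v n * if i = j then 0 else c *
        deltaExceptTwo w m i j (fun x a => delta D Sgn.minus x a (w i) (m i))
          (fun x a => delta D Sgn.plus x a (w j) (m j)) v n := by
  by_cases hij : i = j
  · simp [hij]
  · simp only [if_neg hij, mul_left_comm]
    exact (summable_deltaExceptTwo (A := A k) w m hij
      (g := fun x a => delta D Sgn.minus x a (w i) (m i))
      (h := fun x a => delta D Sgn.plus x a (w j) (m j))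
      (summable_pair hD hA w m i j) v).mul_left _

/-- The `θ_+ θ_-` component of a functional of superfields is `Q_- Q_+` of its lowest component. -/
theorem superFunctional_tpm_apply (hA : ∀ w, A k w = B w) (w : Fin (k + 1) → Letter) :
    (superFunctional D A).tpm k w
      = oddDer (conv hD) (susyKernel Sgn.minus) (oddDer (conv hD) (susyKernel Sgn.plus) B) w := by
  funext m
  rw [oddDer_oddDer _ (isOddKernel_susyKernel _), Pi.add_apply, Submodule.coe_add, Pi.add_apply]
  simp only [superFunctional, superMonomial_tpm, mul_add, Finset.mul_sum]
  rw [sum_tsum_sum_add_sum (summable_deltaExcept_tpm hD hA w m)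
    (fun i j v => summable_deltaExceptTwo_delta hD hA w m i j _ v)]
  congr 1
  · simp only [evenDer, Submodule.coe_sum, Finset.sum_apply, sum_tsum_deltaExcept_tpm hD hA]
  · simp only [pairDer, Submodule.coe_sum, Finset.sum_apply]
    refine Finset.sum_congr rfl fun i _ => Finset.sum_congr rfl fun j _ => ?_
    by_cases hij : i = j
    · simp [hij]
    simp only [if_neg hij, Submodule.coe_smul, Submodule.coe_sum, Finset.sum_apply, Pi.smul_apply,
      smul_eq_mul, mul_left_comm (A k _ _), tsum_mul_left, ← Finset.mul_sum]
    rw [sum_tsum_deltaExceptTwo_delta hD hA w m hij]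

end Functional

theorem gradedSymm_apply {A : Functional} {B : (Fin (k + 1) → Letter) → tilc k}
    (hA : ∀ w, A k w = B w) (w : Fin (k + 1) → Letter) :
    A.gradedSymm k w = reorderSum permute B w := by
  funext m
  simp only [Functional.gradedSymm, reorderSum, reorder, Finset.sum_apply, Submodule.coe_sum,
    Submodule.coe_smul, Pi.smul_apply, smul_eq_mul, permute_apply, hA]

end Components

/-! ### The cyclic Leibniz rule and the decomposition -/

section CyclicLeibniz

open Polynomial

variable {k : ℕ}

/-- The word `χ_s φ_s ⋯ φ_s`. -/
def chiPhiWord (s : Sgn) (k : ℕ) : Fin (k + 1) → Letter :=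
  Fin.cons (Kind.chi, s) fun _ : Fin k => (Kind.phi, s)

theorem chiPhiWord_eq_update (s : Sgn) (k : ℕ) :
    chiPhiWord s k = Function.update (fun _ => (Kind.phi, s)) 0 (Kind.chi, s) := by
  funext i
  refine Fin.cases rfl (fun j => ?_) i
  rw [Function.update_of_ne (Fin.succ_ne_zero j)]
  rfl

theorem IsChiPhi.eq_update {s : Sgn} {w : Fin (k + 1) → Letter} {i : Fin (k + 1)}
    (h : IsChiPhi s w i) : w = Function.update (fun _ => (Kind.phi, s)) i (Kind.chi, s) := by
  funext j
  by_cases hj : j = i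
  · rw [hj, Function.update_self, h.1]
  · rw [Function.update_of_ne hj, h.2 j hj]

theorem update_phi_comp_perm (s : Sgn) (σ : Equiv.Perm (Fin (k + 1))) :
    Function.update (fun _ => (Kind.phi, s)) (σ 0) (Kind.chi, s) ∘ σ = chiPhiWord s k := by
  rw [update_comp_perm, chiPhiWord_eq_update]
  rfl

/-- If `K` is invariant under reorderings, its coefficients of the words with one `χ` are those of
`χ φ ⋯ φ`. -/
theorem apply_update_phi {s : Sgn} {K : (Fin (k + 1) → Letter) → tilc k}
    (hK : ∀ σ, reorder permute σ K = K) (σ : Equiv.Perm (Fin (k + 1))) :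
    K (Function.update (fun _ => (Kind.phi, s)) (σ 0) (Kind.chi, s))
      = permute σ (K (chiPhiWord s k)) := by
  conv_lhs => rw [← hK σ]
  rw [reorder, update_phi_comp_perm, reorderSign_eq_one (a := σ 0), one_smul]
  intro i hi
  rw [Function.update_of_ne hi]
  rfl

theorem susyKernel_opp_phi (s : Sgn) (v : Letter) : susyKernel s.opp v (Kind.phi, s)
    = if v = (Kind.chi, s) then C (s.val * Complex.I) * X else 0 := by
  obtain ⟨a, t⟩ := v
  rw [susyKernel, Matrix.blockDiagonal_apply]
  cases a <;> cases s <;> cases t <;> simp [susyBlock, Sgn.opp]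

variable {D : ℤ → ℂ}

/-- A family that is closed under the supercharge `Q_{-s}` and invariant under reorderings gives the
cyclic Leibniz rule: this is the coefficient of `φ_s ⋯ φ_s` in `Q_{-s} K`. -/
theorem satisfiesCLR_of_oddDer_eq_zero (hD : HasExpDecay D) {s : Sgn}
    {K : (Fin (k + 1) → Letter) → tilc k} (hK : ∀ σ, reorder permute σ K = K)
    (hQ : oddDer (conv hD) (susyKernel s.opp) K = 0) :
    SatisfiesCLR D (K (chiPhiWord s k) : (Fin (k + 1) → ℤ) → ℂ) := by
  constructor
  · intro m n σ
    have h := apply_update_phi (s := s) hK (Equiv.Perm.decomposeFin.symm (0, σ))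
    rw [Equiv.Perm.decomposeFin_symm_apply_zero, ← chiPhiWord_eq_update] at h
    conv_rhs => rw [h, permute_apply]
    refine congrArg (K (chiPhiWord s k)).1 (funext fun i => ?_)
    refine Fin.cases ?_ (fun j => ?_) i
    · simp
    · simp [Equiv.Perm.decomposeFin_symm_apply_succ]
  · intro n
    have h := congrFun (congrArg Subtype.val (congrFun hQ fun _ => (Kind.phi, s))) n
    have hodd : ∀ i : Fin (k + 1), oddBefore (fun _ => (Kind.phi, s)) i = 0 := fun i => by
      simp [oddBefore, Letter.isOdd]
    simp only [oddDer_apply, hodd, pow_zero, one_smul, susyKernel_opp_phi] at h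
    have hterm : ∀ i : Fin (k + 1), ∑ v, aeval (conv hD i)
        (if v = (Kind.chi, s) then C (s.val * Complex.I) * X else 0 : ℂ[X])
        (K (Function.update (fun _ => (Kind.phi, s)) i v))
        = (s.val * Complex.I) • conv hD i (permute (Equiv.addLeft i) (K (chiPhiWord s k))) := by
      intro i
      have hi := apply_update_phi (s := s) hK (Equiv.addLeft i)
      rw [show Equiv.addLeft i 0 = i from add_zero i] at hi
      rw [Finset.sum_eq_single (Kind.chi, s), if_pos rfl, aeval_C_mul_X_apply, hi]
      · intro v _ hv
        rw [if_neg hv, map_zero, LinearMap.zero_apply]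
      · simp
    simp only [hterm, ← Finset.smul_sum] at h
    have h' := (mul_eq_zero.1 h).resolve_left (mul_ne_zero s.val_ne_zero Complex.I_ne_zero)
    rw [Submodule.coe_sum, Finset.sum_apply] at h'
    refine Eq.trans (Finset.sum_congr rfl fun p _ => tsum_congr fun m => ?_) h'
    rw [permute_apply, mul_comm]
    refine congrArg (fun x => (K (chiPhiWord s k)).1 x * D (m - n p)) (funext fun i => ?_)
    refine Fin.cases ?_ (fun j => ?_) i
    · simp
    · simp

theorem SatisfiesCLR.smul {C : (Fin (k + 1) → ℤ) → ℂ} (h : SatisfiesCLR D C) (c : ℂ) :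
    SatisfiesCLR D (c • C) := by
  refine ⟨fun m n σ => by rw [Pi.smul_apply, Pi.smul_apply, h.1], fun n => ?_⟩
  simp only [Pi.smul_apply, smul_eq_mul, mul_left_comm _ c, tsum_mul_left, ← Finset.mul_sum, h.2,
    mul_zero]

theorem satisfiesCLR_zero : SatisfiesCLR D (0 : (Fin (k + 1) → ℤ) → ℂ) :=
  ⟨fun _ _ _ => rfl, fun _ => by simp⟩

/-- The family of coefficients of `∑ c_{m n_1 … n_k} χ_{s m} φ_{s n_1} ⋯ φ_{s n_k}`. -/
def chiPhiFamily (s : Sgn) (c : tilc k) : (Fin (k + 1) → Letter) → tilc k :=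
  fun w => if w = chiPhiWord s k then c else 0

/-- The number of reorderings that leave the word `χ φ ⋯ φ` unchanged. -/
def chiPhiCard (s : Sgn) (k : ℕ) : ℕ :=
  (Finset.univ.filter fun σ : Equiv.Perm (Fin (k + 1)) => chiPhiWord s k ∘ σ = chiPhiWord s k).card

theorem chiPhiCard_ne_zero (s : Sgn) (k : ℕ) : (chiPhiCard s k : ℂ) ≠ 0 :=
  Nat.cast_ne_zero.2 (Finset.card_ne_zero_of_mem (a := 1) (by simp))

/-- A family that consists of terms with one `χ_s` and otherwise `φ_s` is recovered from its
coefficient of `χ_s φ_s ⋯ φ_s`. -/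
theorem reorderSum_chiPhiFamily {s : Sgn} {K : (Fin (k + 1) → Letter) → tilc k}
    (hK : ∀ σ, reorder permute σ K = K) (hsupp : ∀ w, K w ≠ 0 → ∃ i, IsChiPhi s w i) :
    reorderSum permute (chiPhiFamily s (K (chiPhiWord s k))) = (chiPhiCard s k : ℂ) • K := by
  funext w
  have hterm : ∀ σ, reorder permute σ (chiPhiFamily s (K (chiPhiWord s k))) w
      = if w ∘ σ = chiPhiWord s k then K w else 0 := by
    intro σ
    rw [reorder, chiPhiFamily]
    split_ifs with h
    · conv_rhs => rw [← hK σ]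
      rw [reorder, h]
    · rw [map_zero, smul_zero]
  rw [reorderSum, Finset.sum_apply, Finset.sum_congr rfl fun σ _ => hterm σ, Pi.smul_apply]
  by_cases hw : K w = 0
  · simp [hw]
  obtain ⟨i, hi⟩ := hsupp w hw
  rw [← Finset.sum_filter, Finset.sum_const, ← Nat.cast_smul_eq_nsmul ℂ]
  congr 2
  have hwi := update_phi_comp_perm s (Equiv.swap 0 i)
  rw [Equiv.swap_apply_left, ← hi.eq_update] at hwi
  refine Finset.card_bij (fun σ _ => Equiv.swap 0 i * σ) (fun σ hσ => ?_)
    (fun σ _ τ _ h => mul_left_cancel h) fun σ hσ => ⟨Equiv.swap 0 i * σ, ?_, ?_⟩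
  · rw [Finset.mem_filter] at hσ ⊢
    refine ⟨Finset.mem_univ _, ?_⟩
    rw [← hwi, Equiv.Perm.coe_mul, Function.comp_assoc, ← Function.comp_assoc (Equiv.swap 0 i),
      ← Equiv.Perm.coe_mul, Equiv.swap_mul_self, hwi]
    exact hσ.2
  · rw [Finset.mem_filter] at hσ ⊢
    refine ⟨Finset.mem_univ _, ?_⟩
    rw [Equiv.Perm.coe_mul, ← Function.comp_assoc, hwi, hσ.2]
  · rw [← mul_assoc, Equiv.swap_mul_self, one_mul]

end CyclicLeibniz

section Decomposition

variable {k : ℕ} {D : ℤ → ℂ}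

theorem reorderSum_smul (c : ℂ) (A : (Fin (k + 1) → Letter) → tilc k) :
    reorderSum permute (c • A) = c • reorderSum permute A := by
  funext w
  simp only [reorderSum, reorder, Finset.sum_apply, Pi.smul_apply, map_smul, Finset.smul_sum,
    smul_comm c]

theorem reorderSum_add (A B : (Fin (k + 1) → Letter) → tilc k) :
    reorderSum permute (A + B) = reorderSum permute A + reorderSum permute B := by
  funext w
  simp only [reorderSum, reorder, Finset.sum_apply, Pi.add_apply, map_add, smul_add,
    Finset.sum_add_distrib]

theorem reorderSum_eq_of_invariant {A : (Fin (k + 1) → Letter) → tilc k}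
    (hA : ∀ σ, reorder permute σ A = A) :
    reorderSum permute A = (Fintype.card (Equiv.Perm (Fin (k + 1))) : ℂ) • A := by
  rw [reorderSum, Finset.sum_congr rfl fun σ _ => hA σ, Finset.sum_const, Finset.card_univ,
    Nat.cast_smul_eq_nsmul]

/-- The decomposition of the terms of a fixed order, as functionals of the graded commuting fields:
if `Q_+ B` and `Q_- B` vanish after the sum over reorderings, then `B` has the asserted form after
this sum. -/
theorem exists_decomposition_of_order (hD : HasExpDecay D) (hD0 : D ≠ 0)
    {B : (Fin (k + 1) → Letter) → tilc k}
    (hfermion : ∀ w, B w ≠ 0 → weight Letter.fermionNumber w = 0)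
    (hB : ∀ t, reorderSum permute (oddDer (conv hD) (susyKernel t) B) = 0) :
    ∃ (T : (Fin (k + 1) → Letter) → tilc k) (C : Sgn → tilc k),
      (∀ w, T w ≠ 0 → weight Letter.fermionNumber w = 2) ∧ (∀ s, SatisfiesCLR D (C s).1) ∧
      reorderSum permute B = reorderSum permute
        (oddDer (conv hD) (susyKernel Sgn.minus) (oddDer (conv hD) (susyKernel Sgn.plus) T)
          + oddDer (conv hD) (susyKernel Sgn.plus) (chiPhiFamily Sgn.plus (C Sgn.plus))
          + oddDer (conv hD) (susyKernel Sgn.minus) (chiPhiFamily Sgn.minus (C Sgn.minus))) := by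
  obtain ⟨G, hG, hGD⟩ : ∃ G, IsTame G ∧
      ∀ a b : ℤ, ∑' l, G a l * D (b - l) = if b = a then 1 else 0 := by
    obtain ⟨L, M, -, hM, hbound⟩ := hD
    obtain ⟨G, ε₀, hε₀, hG, hGD⟩ := exists_leftInverse_kernel hM hbound hD0
    exact ⟨G, ⟨ε₀, hε₀, hG⟩, hGD⟩
  have hperm := conv_mul_permute (k := k) hD
  have hsymm : ∀ σ, reorder permute σ (reorderSum permute B) = reorderSum permute B := fun σ =>
    reorder_reorderSum permute σ B
  obtain ⟨T, K, hT, hsupp, hK, hQ, hdecomp⟩ := exists_decomposition (X := conv hD)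
    (commute_conv hD) (leftInv hG) (fun i hi => leftInv_conv_self hD hG hGD hi)
    (fun i hi j hji hj => leftInv_conv_of_ne hD hG hi hji hj) hperm
    (A := reorderSum permute B)
    (fun t => by rw [← reorderSum_oddDer hperm (isOddKernel_susyKernel t), hB]) hsymm
    (fun w hw => by
      obtain ⟨σ, -, hσ⟩ := Finset.exists_ne_zero_of_sum_ne_zero
        (by rwa [reorderSum, Finset.sum_apply] at hw)
      rw [← weight_comp_perm _ _ σ]
      refine hfermion _ fun h => hσ ?_
      rw [reorder, h, map_zero, smul_zero])
  -- Invariant families are recovered by the average over reorderings.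
  have havg : ∀ A : (Fin (k + 1) → Letter) → tilc k, (∀ σ, reorder permute σ A = A) →
      reorderSum permute ((Fintype.card (Equiv.Perm (Fin (k + 1))) : ℂ)⁻¹ • A) = A := by
    intro A hA
    rw [reorderSum_smul, reorderSum_eq_of_invariant hA,
      inv_smul_smul₀ (Nat.cast_ne_zero.2 Fintype.card_ne_zero)]
  have hC : ∀ s, reorderSum permute
      (chiPhiFamily s ((chiPhiCard s k : ℂ)⁻¹ • K s (chiPhiWord s k))) = K s := by
    intro s
    have h : chiPhiFamily s ((chiPhiCard s k : ℂ)⁻¹ • K s (chiPhiWord s k))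
        = (chiPhiCard s k : ℂ)⁻¹ • chiPhiFamily s (K s (chiPhiWord s k)) := by
      funext w
      rw [Pi.smul_apply, chiPhiFamily, chiPhiFamily, smul_ite, smul_zero]
    rw [h, reorderSum_smul, reorderSum_chiPhiFamily (hK s) (hsupp s),
      inv_smul_smul₀ (chiPhiCard_ne_zero s k)]
  refine ⟨(Fintype.card (Equiv.Perm (Fin (k + 1))) : ℂ)⁻¹ • T,
    fun s => (chiPhiCard s k : ℂ)⁻¹ • K s (chiPhiWord s k),
    fun w hw => hT w fun h => hw (by rw [Pi.smul_apply, h, smul_zero]),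
    fun s => (satisfiesCLR_of_oddDer_eq_zero hD (hK s) (hQ s)).smul _, ?_⟩
  conv_lhs => rw [← havg _ hsymm, hdecomp]
  simp only [smul_add, reorderSum_add, ← map_smul]
  simp only [reorderSum_oddDer hperm (isOddKernel_susyKernel _), hC, havg _ (hK _)]

end Decomposition

theorem Functional.gradedSymm_zero : Functional.gradedSymm 0 = 0 := by
  funext k w m
  simp [Functional.gradedSymm]

theorem clrTerms_apply (s : Sgn) {k : ℕ} {C : (k : ℕ) → (Fin (k + 1) → ℤ) → ℂ} {c : tilc k}
    (h : C k = c) (w : Fin (k + 1) → Letter) : clrTerms s C k w = chiPhiFamily s c w := by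
  funext n
  rw [clrTerms, chiPhiFamily, chiPhiWord, h]
  split_ifs <;> rfl

theorem proposition2 (D : ℤ → ℂ) (hD : IsDifferenceOperator D)
    (S : Functional) (hlocal : S.IsLocal) (hfermion : S.HasFermionNumber 0)
    (hplus : (superCharge D Sgn.plus S).Same 0) (hminus : (superCharge D Sgn.minus S).Same 0) :
    ∃ (T : Functional) (Cp Cm : (k : ℕ) → (Fin (k + 1) → ℤ) → ℂ),
      T.IsLocal ∧ T.HasFermionNumber 2 ∧
      (∀ k, IsTILC (Cp k) ∧ SatisfiesCLR D (Cp k)) ∧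
      (∀ k, IsTILC (Cm k) ∧ SatisfiesCLR D (Cm k)) ∧
      (superFunctional D S).Same
        (Theta.const
          ((superFunctional D T).berezin
            - ((superFunctional D (clrTerms Sgn.plus Cp)).thetaMul Sgn.minus).berezin
            + ((superFunctional D (clrTerms Sgn.minus Cm)).thetaMul Sgn.plus).berezin)) ∧
      (∀ k, S k = 0 → T k = 0 ∧ Cp k = 0 ∧ Cm k = 0) := by
  have hE : HasExpDecay D := hD.1
  let B (k : ℕ) (w : Fin (k + 1) → Letter) : tilc k := ⟨S k w, hlocal k w⟩
  have hSB : ∀ k w, S k w = B k w := fun k w => rfl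
  have hQ : ∀ t k, reorderSum permute (oddDer (conv hE) (susyKernel t) (B k)) = 0 := by
    intro t k
    funext w
    refine Subtype.ext ?_
    have h : (superCharge D t S).gradedSymm = 0 := by
      rw [← Functional.gradedSymm_zero]
      cases t
      · exact hplus
      · exact hminus
    rw [← gradedSymm_apply (superCharge_apply_eq hE (hSB k) t) w, h]
    rfl
  have key : ∀ k, ∃ (T : (Fin (k + 1) → Letter) → tilc k) (C : Sgn → tilc k),
      (∀ w, T w ≠ 0 → weight Letter.fermionNumber w = 2) ∧ (∀ s, SatisfiesCLR D (C s).1) ∧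
      reorderSum permute (B k) = reorderSum permute
        (oddDer (conv hE) (susyKernel Sgn.minus) (oddDer (conv hE) (susyKernel Sgn.plus) T)
          + oddDer (conv hE) (susyKernel Sgn.plus) (chiPhiFamily Sgn.plus (C Sgn.plus))
          + oddDer (conv hE) (susyKernel Sgn.minus) (chiPhiFamily Sgn.minus (C Sgn.minus))) ∧
      (S k = 0 → T = 0 ∧ C = 0) := by
    intro k
    by_cases hS : S k = 0
    · have hB0 : B k = 0 := funext fun w => Subtype.ext (congrFun hS w)
      have hC0 : ∀ s, chiPhiFamily s (0 : tilc k) = 0 := fun s => funext fun w => ite_self _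
      refine ⟨0, 0, fun w h => absurd rfl h, fun s => satisfiesCLR_zero, ?_,
        fun _ => ⟨rfl, rfl⟩⟩
      simp only [hB0, Pi.zero_apply, hC0, map_zero, add_zero]
    · obtain ⟨T, C, h1, h2, h3⟩ := exists_decomposition_of_order hE hD.2.2 (B := B k)
        (fun w hw => by
          have h : S k w ≠ 0 := fun h => hw (Subtype.ext h)
          obtain ⟨n, hn⟩ := Function.ne_iff.1 h
          exact hfermion k w n hn) fun t => hQ t k
      exact ⟨T, C, h1, h2, h3, fun h => absurd h hS⟩
  choose T C hT hC hdecomp hzero using key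
  refine ⟨fun k w => T k w, fun k => C k Sgn.plus, fun k => C k Sgn.minus, fun k w => (T k w).2,
    fun k w n hn => hT k w fun h => hn ?_, fun k => ⟨(C k _).2, hC k _⟩,
    fun k => ⟨(C k _).2, hC k _⟩, ⟨?_, ?_, ?_, ?_⟩, fun k hk => ?_⟩
  · beta_reduce
    rw [h]
    rfl
  · refine funext fun k => funext fun w => ?_
    rw [gradedSymm_apply (B := B k) (superFunctional_one_apply S) w, hdecomp]
    refine (gradedSymm_apply (fun w => ?_) w).symm
    change (superFunctional D fun k w => T k w).tpm k w
      - -(superFunctional D (clrTerms Sgn.plus fun k => C k Sgn.plus)).tp k w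
      + (superFunctional D (clrTerms Sgn.minus fun k => C k Sgn.minus)).tm k w = _
    rw [superFunctional_tpm_apply hE (B := T k) fun w => rfl,
      superFunctional_tp_apply hE (clrTerms_apply Sgn.plus rfl),
      superFunctional_tm_apply hE (clrTerms_apply Sgn.minus rfl), sub_neg_eq_add]
    rfl
  · refine funext fun k => funext fun w => ?_
    rw [gradedSymm_apply (superFunctional_tp_apply hE (hSB k)), hQ]
    exact (congrFun (congrFun Functional.gradedSymm_zero k) w).symm
  · refine funext fun k => funext fun w => ?_
    rw [gradedSymm_apply (superFunctional_tm_apply hE (hSB k)), hQ]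
    exact (congrFun (congrFun Functional.gradedSymm_zero k) w).symm
  · refine funext fun k => funext fun w => ?_
    rw [gradedSymm_apply (superFunctional_tpm_apply hE (hSB k)),
      reorderSum_oddDer (conv_mul_permute hE) (isOddKernel_susyKernel _), hQ, map_zero]
    exact (congrFun (congrFun Functional.gradedSymm_zero k) w).symm
  · obtain ⟨h1, h2⟩ := hzero k hk
    refine ⟨funext fun w => ?_, ?_, ?_⟩
    · beta_reduce
      rw [h1]
      rfl
    · beta_reduce
      rw [h2]
      rfl
    · beta_reduce
      rw [h2]
      rfl
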